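/- **Theorem 3.5.** For every finite input alphabet, $$\mathsf{oneway\mbox{-}IP}(\text{cons-space},\text{cons-random-bits})=\mathsf{NL}=\mathsf{IP}_w(\text{log-space},\text{cons-random-bits}).$$ The classes are defined as follows. *Verifiers.* A verifier $V$ is a probabilistic Turing machine with a read-only two-way input tape, holding the input $x$ between two end-markers (the input head starts on the left one and never leaves the part of the tape between the end-markers, these included), one two-way read/write work tape, and a communication cell over a finite alphabet $\Gamma$ containing a null symbol $\epsilon$. Its finite state set consists of coin-tossing states, deterministic states, an accepting and a rejecting halting state, and each state $q$ carries a symbol $\gamma_q\in\Gamma$; the start state is not halting. In a non-halting state $q$ with $\gamma_q\ne\epsilon$ the verifier sends $\gamma_q$ to the prover and receives a symbol of $\Gamma$ in response; if $\gamma_q=\epsilon$ there is no communication. The next state, the symbol written on the work tape and the head movements (each in $\{-1,0,+1\}$) are determined by the state, the two scanned tape symbols, the received symbol (if any) and, in a coin-tossing state, a fresh fair random bit, which the prover does not see. *Provers.* A prover is an arbitrary function giving each response from the input string and the entire communication so far. A one-way prover is one that maps each input string to a sequence over $\Gamma$ and gives the $i$-th symbol of this sequence at the $i$-th communication step, whatever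 the verifier sends. *Proof systems.* A language $L$ has a (strong) interactive proof system with error $\varepsilon$ and verifier $V$ if (1) there is a prover $P$ such that for all $x\in L$ the interaction of $P$ and $V$ on $x$ results in acceptance with probability at least $1-\varepsilon$, and (2) for all $x\notin L$ and all provers $P^*$ the interaction of $P^*$ and $V$ on $x$ results in rejection with probability at least $1-\varepsilon$. It has a weak interactive proof system if (2) is replaced by (2′): for all $x\notin L$ and all provers $P^*$ the interaction results in acceptance with probability at most $\varepsilon$. In one-way proof systems all provers, in (1) and in (2), are one-way. *Classes.* $\mathsf{oneway\mbox{-}IP}(\text{cons-space},\text{cons-random-bits})$ is the class of languages that have, for some $\varepsilon<\frac12$, a strong one-way interactive proof system with error $\varepsilon$ whose verifier visits $O(1)$ work tape cells and tosses $O(1)$ coins; $\mathsf{IP}_w(\text{log-space},\text{cons-random-bits})$ is the class of languages that have, for some $\varepsilon<\frac12$, a weak interactive proof system (with arbitrary provers) with error $\varepsilon$ whose verifier visits $O(\log n)$ work tape cells and tosses $O(1)$ coins. These bounds are functions of the input length $n$ and hold in the worst case, over all inputs, all provers (one-way ones in the first class) and all coin outcomes; no bound on the running time is imposed. $\mathsf{NL}$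 is the class of languages recognized by nondeterministic Turing machines with a read-only two-way input tape and finitely many work tapes, all of whose computations on inputs of length $n$ visit $O(\log n)$ work tape cells. -/

import Mathlib

open MeasureTheory Filter Asymptotics

/-! ### Resource bounds -/

/-- Functions that are `O(1)`. -/
def consBound : Set (ℕ → ℕ) :=
  {f | (fun n => (f n : ℝ)) =O[atTop] (fun _ => (1 : ℝ))}

/-- Functions that are `O(log n)`. -/
def logBound : Set (ℕ → ℕ) :=
  {f | (fun n => (f n : ℝ)) =O[atTop] (fun n => Real.log (n : ℝ))}

/-! ### Tapes -/

/-- The symbol at position `p` of the input tape holding `x`: the input occupies the positions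
`1, …, |x|`, and the positions `0` and `|x| + 1` hold the end-marker `none`. -/
def inputSymbol {α : Type} (x : List α) (p : ℤ) : Option α :=
  if p ≤ 0 then none else x[p.toNat - 1]?

/-- The number of distinct cells on which a head has been at the times `0, …, t`. -/
def cellsVisited (head : ℕ → ℤ) (t : ℕ) : ℕ :=
  ((Finset.range (t + 1)).image head).card

/-! ### Nondeterministic Turing machines and `NL` -/

/-- A nondeterministic Turing machine with a read-only two-way input tape and `k` two-way
infinite work tapes.  Head movements are elements of `{-1, 0, 1}`. -/
structure NTM (α : Type) where
  State : Type
  Work : Type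
  finState : Finite State
  finWork : Finite Work
  k : ℕ
  start : State
  accept : State
  blank : Work
  /-- The possible moves: new state, written symbols, input head move, work head moves. -/
  δ : State → Option α → (Fin k → Work) →
    Set (State × (Fin k → Work) × SignType × (Fin k → SignType))

namespace NTM

variable {α : Type} (M : NTM α)

structure Config where
  state : M.State
  inputPos : ℤ
  work : Fin M.k → ℤ → M.Work
  workPos : Fin M.k → ℤ

def init : M.Config where
  state := M.start
  inputPos := 0
  work := fun _ _ => M.blank
  workPos := fun _ => 0

/-- One computation step on input `x`; the accepting state is halting. -/
def Step (x : List α) (c c' : M.Config) : Prop :=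
  c.state ≠ M.accept ∧
    ∃ m ∈ M.δ c.state (inputSymbol x c.inputPos) (fun i => c.work i (c.workPos i)),
      c' = { state := m.1
             inputPos := c.inputPos + (m.2.2.1 : ℤ)
             work := fun i => Function.update (c.work i) (c.workPos i) (m.2.1 i)
             workPos := fun i => c.workPos i + (m.2.2.2 i : ℤ) }

/-- `c 0, …, c t` is a computation of `M` on `x` (the values of `c` beyond `t` are irrelevant). -/
def IsComputation (x : List α) (c : ℕ → M.Config) (t : ℕ) : Prop :=
  c 0 = M.init ∧ ∀ i < t, M.Step x (c i) (c (i + 1))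

/-- The input head never leaves the part of the tape delimited by the end-markers. -/
def StaysOnInput : Prop :=
  ∀ x c t, M.IsComputation x c t →
    0 ≤ (c t).inputPos ∧ (c t).inputPos ≤ (x.length : ℤ) + 1

/-- On inputs of length `n`, every computation visits at most `s n` work tape cells in total. -/
def SpaceBound (s : ℕ → ℕ) : Prop :=
  ∀ x c t, M.IsComputation x c t →
    ∑ j : Fin M.k, cellsVisited (fun i => (c i).workPos j) t ≤ s x.length

def Accepts (x : List α) : Prop :=
  ∃ c t, M.IsComputation x c t ∧ (c t).state = M.accept

end NTM

/-- Languages recognized by nondeterministic Turing machines in logarithmic space. -/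
def NL (α : Type) : Set (Language α) :=
  {L | ∃ M : NTM α, M.StaysOnInput ∧ (∃ s ∈ logBound, M.SpaceBound s) ∧
    ∀ x, x ∈ L ↔ M.Accepts x}

/-! ### Verifiers and provers -/

/-- The states of a verifier: coin-tossing states, deterministic states, and the two halting
states. -/
inductive VState (R D : Type) : Type
  | coin (q : R)
  | det (q : D)
  | accept
  | reject

/-- A verifier: a probabilistic Turing machine with a read-only input tape, a single work tape
and a communication cell. -/
structure Verifier (α : Type) where
  /-- coin-tossing states -/
  R : Type
  /-- deterministic states -/
  D : Type
  /-- work tape alphabet -/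
  Work : Type
  /-- communication alphabet -/
  Comm : Type
  finR : Finite R
  finD : Finite D
  finWork : Finite Work
  finComm : Finite Comm
  start : VState R D
  start_ne_accept : start ≠ VState.accept
  start_ne_reject : start ≠ VState.reject
  blank : Work
  /-- the null communication symbol -/
  null : Comm
  /-- the communication symbol of each state -/
  msg : VState R D → Comm
  /-- transitions of the coin-tossing states; the last argument is the random bit -/
  δcoin : R → Option α → Work → Comm → Bool → VState R D × Work × SignType × SignType
  /-- transitions of the deterministic states -/
  δdet : D → Option α → Work → Comm → VState R D × Work × SignType × SignType

/-- A prover determines its response from the input string, the communication so far (the list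
of the exchanged pairs (verifier symbol, prover symbol), oldest first), and the verifier symbol
that it has to answer. -/
abbrev Prover (α Γ : Type) : Type := List α → List (Γ × Γ) → Γ → Γ

/-- The prover that writes the sequence `c x`, one symbol at each communication step,
irrespective of what the verifier sends. -/
def Prover.ofSequence {α Γ : Type} (c : List α → ℕ → Γ) : Prover α Γ :=
  fun x h _ => c x h.length

/-- The provers of one-way interactive proof systems. -/
def onewayProvers (α Γ : Type) : Set (Prover α Γ) := Set.range Prover.ofSequence

/-- The law of an infinite sequence of independent fair coin tosses. -/
noncomputable def coinMeasure : Measure (ℕ → Bool) :=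
  Measure.infinitePi fun _ : ℕ => (PMF.uniformOfFintype Bool).toMeasure

namespace Verifier

variable {α : Type} (V : Verifier α)

/-- A configuration of the verifier, together with the communication so far and the number of
coins tossed so far. -/
structure Config where
  state : VState V.R V.D
  inputPos : ℤ
  work : ℤ → V.Work
  workPos : ℤ
  history : List (V.Comm × V.Comm)
  coins : ℕ

def init : V.Config where
  state := V.start
  inputPos := 0
  work := fun _ => V.blank
  workPos := 0
  history := []
  coins := 0

open Classical in
/-- The symbol that the verifier reads from the communication cell: the response of the prover
if the present state communicates, and the null symbol otherwise. -/
noncomputable def received (P : Prover α V.Comm) (x : List α) (c : V.Config) : V.Comm :=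
  if V.msg c.state = V.null then V.null else P x c.history (V.msg c.state)

open Classical in
/-- The communication up to and including the present step. -/
noncomputable def newHistory (P : Prover α V.Comm) (x : List α) (c : V.Config) :
    List (V.Comm × V.Comm) :=
  if V.msg c.state = V.null then c.history
  else c.history ++ [(V.msg c.state, P x c.history (V.msg c.state))]

/-- The effect of the move `m`, with the given new communication and number of coins. -/
def apply (c : V.Config) (m : VState V.R V.D × V.Work × SignType × SignType)
    (h : List (V.Comm × V.Comm)) (n : ℕ) : V.Config where
  state := m.1
  inputPos := c.inputPos + (m.2.2.1 : ℤ)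
  work := Function.update c.work c.workPos m.2.1
  workPos := c.workPos + (m.2.2.2 : ℤ)
  history := h
  coins := n

/-- One step of the interaction; `ω i` is the outcome of the `i`-th coin toss. -/
noncomputable def step (P : Prover α V.Comm) (x : List α) (ω : ℕ → Bool) (c : V.Config) :
    V.Config :=
  match c.state with
  | .coin q =>
      V.apply c
        (V.δcoin q (inputSymbol x c.inputPos) (c.work c.workPos) (V.received P x c) (ω c.coins))
        (V.newHistory P x c) (c.coins + 1)
  | .det q =>
      V.apply c
        (V.δdet q (inputSymbol x c.inputPos) (c.work c.workPos) (V.received P x c))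
        (V.newHistory P x c) c.coins
  | .accept => c
  | .reject => c

/-- The configuration after `t` steps of the interaction. -/
noncomputable def run (P : Prover α V.Comm) (x : List α) (ω : ℕ → Bool) (t : ℕ) : V.Config :=
  (V.step P x ω)^[t] V.init

noncomputable def acceptProb (P : Prover α V.Comm) (x : List α) : ℝ :=
  coinMeasure.real {ω | ∃ t, (V.run P x ω t).state = VState.accept}

noncomputable def rejectProb (P : Prover α V.Comm) (x : List α) : ℝ :=
  coinMeasure.real {ω | ∃ t, (V.run P x ω t).state = VState.reject}

/-- The input head never leaves the part of the tape delimited by the end-markers, whatever the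
input, the prover (among the admissible ones) and the coin tosses. -/
def StaysOnInput (provers : Set (Prover α V.Comm)) : Prop :=
  ∀ P ∈ provers, ∀ x ω t,
    0 ≤ (V.run P x ω t).inputPos ∧ (V.run P x ω t).inputPos ≤ (x.length : ℤ) + 1

/-- Worst-case space bound: at most `s n` work tape cells are visited on inputs of length `n`. -/
def SpaceBound (provers : Set (Prover α V.Comm)) (s : ℕ → ℕ) : Prop :=
  ∀ P ∈ provers, ∀ x ω t, cellsVisited (fun i => (V.run P x ω i).workPos) t ≤ s x.length

/-- Worst-case bound on randomness: at most `r n` coins are tossed on inputs of length `n`. -/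
def CoinBound (provers : Set (Prover α V.Comm)) (r : ℕ → ℕ) : Prop :=
  ∀ P ∈ provers, ∀ x ω t, (V.run P x ω t).coins ≤ r x.length

/-- With some admissible prover, `V` forms an interactive proof system for `L` with error `ε`. -/
def StrongIPS (provers : Set (Prover α V.Comm)) (L : Language α) (ε : ℝ) : Prop :=
  (∃ P ∈ provers, ∀ x ∈ L, 1 - ε ≤ V.acceptProb P x) ∧
    ∀ x, x ∉ L → ∀ P ∈ provers, 1 - ε ≤ V.rejectProb P x

/-- The weak form, in which `V` need not halt on non-members. -/
def WeakIPS (provers : Set (Prover α V.Comm)) (L : Language α) (ε : ℝ) : Prop :=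
  (∃ P ∈ provers, ∀ x ∈ L, 1 - ε ≤ V.acceptProb P x) ∧
    ∀ x, x ∉ L → ∀ P ∈ provers, V.acceptProb P x ≤ ε

/-- `V` is a legitimate verifier whose space lies in `S` and whose randomness lies in `C`. -/
def Restricted (provers : Set (Prover α V.Comm)) (S C : Set (ℕ → ℕ)) : Prop :=
  V.StaysOnInput provers ∧ (∃ s ∈ S, V.SpaceBound provers s) ∧ ∃ r ∈ C, V.CoinBound provers r

end Verifier

/-- `oneway-IP(S-space, C-random-bits)`: one-way interactive proof systems, strong definition,
with some error probability below `1/2`. -/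
def onewayIP (α : Type) (S C : Set (ℕ → ℕ)) : Set (Language α) :=
  {L | ∃ V : Verifier α, V.Restricted (onewayProvers α V.Comm) S C ∧
    ∃ ε : ℝ, ε < 1 / 2 ∧ V.StrongIPS (onewayProvers α V.Comm) L ε}

/-- `IP_w(S-space, C-random-bits)`: (private-coin, two-way) interactive proof systems, weak
definition, with some error probability below `1/2`. -/
def weakIP (α : Type) (S C : Set (ℕ → ℕ)) : Set (Language α) :=
  {L | ∃ V : Verifier α, V.Restricted Set.univ S C ∧
    ∃ ε : ℝ, ε < 1 / 2 ∧ V.WeakIPS Set.univ L ε}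

/-!
All the classes are the class of languages recognized by nondeterministic finite automata with
several two-way input heads. A tuple of head positions is a number polynomial in the input length,
so such an automaton can hold logarithmically many tape symbols, namely two stacks whose codes are
built up by multiplications and divisions on the head positions, and it can simulate a machine of
logarithmic space. It can also simulate a weak proof system that tosses `r` coins: it guesses a set
of more than half of the `2 ^ r` coin outcomes, runs the verifier on all of them in parallel,
guessing the answers of the prover, a single guess for all branches that have sent the same
communication so far, and accepts if all these branches accept. Conversely, the heads can be held in
binary on work tapes.

In the one-way proof system for an automaton with `k` heads, the prover sends an accepting
computation, together with the state of a clock at each step. The verifier uses its coins to choose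
in secret one of the heads or one of the digits of the clock, and checks with its own input head
that the announced edges are correct as far as the chosen head, or digit, is concerned. The clock
prevents a dishonest prover from going on forever. Since a wrong computation is detected only with a
small probability, the verifier rejects without any test on almost half of the coin outcomes; this
keeps the error below one half.
-/

/-! ### Multi-head programs -/

/-- The elementary operations of a read-only head on an input of length `n`; its positions are the
natural numbers `0, …, n + 1`. The last two are tests, which leave the head where it is. -/
inductive HeadOp (α : Type) : Type
  | nop
  | inc
  | dec
  | zero
  | sym (o : Option α)

/-- The possible effects of an operation on the position of the head. -/
def HeadOp.Exec {α : Type} (x : List α) : HeadOp α → ℕ → ℕ → Prop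
  | .nop, p, p' => p' = p
  | .inc, p, p' => p ≤ x.length ∧ p' = p + 1
  | .dec, p, p' => p = p' + 1
  | .zero, p, p' => p = 0 ∧ p' = 0
  | .sym o, p, p' => inputSymbol x p = o ∧ p' = p

/-- A nondeterministic multi-head finite automaton: a finite flow graph, each of whose edges applies
an operation to one of the heads, which are indexed by `ι`. -/
structure HeadProgram (α ι : Type) where
  Node : Type
  finNode : Finite Node
  edge : Node → ι → HeadOp α → Node → Prop
  start : Node
  final : Node

/-- All head positions lie between the end-markers. -/
def HeadsOn {α ι : Type} (x : List α) (v : ι → ℕ) : Prop := ∀ i, v i ≤ x.length + 1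

/-- Relations between tuples of head positions that may depend on the input. -/
abbrev HeadRel (α ι : Type) : Type := List α → (ι → ℕ) → (ι → ℕ) → Prop

theorem HeadOp.Exec.le {α : Type} {x : List α} {op : HeadOp α} {p p' : ℕ} (h : op.Exec x p p')
    (hp : p ≤ x.length + 1) : p' ≤ x.length + 1 := by
  cases op <;> simp only [HeadOp.Exec] at h <;> omega

section Programs

variable {α ι : Type} [DecidableEq ι]

theorem HeadsOn.update {x : List α} {v : ι → ℕ} (hv : HeadsOn x v) {i : ι} {p : ℕ}
    (hp : p ≤ x.length + 1) : HeadsOn x (Function.update v i p) := by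
  intro j
  rcases eq_or_ne j i with rfl | hj
  · simpa only [Function.update_self] using hp
  · simpa only [Function.update_of_ne hj] using hv j

namespace HeadProgram

/-- One step of a program; its configurations consist of a node and the head positions. -/
def Step (P : HeadProgram α ι) (x : List α) (a b : P.Node × (ι → ℕ)) : Prop :=
  ∃ i op p, P.edge a.1 i op b.1 ∧ HeadOp.Exec x op (a.2 i) p ∧ b.2 = Function.update a.2 i p

/-- Reachability of configurations of a program. -/
def Reach (P : HeadProgram α ι) (x : List α) : P.Node × (ι → ℕ) → P.Node × (ι → ℕ) → Prop :=
  Relation.ReflTransGen (P.Step x)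

variable {P : HeadProgram α ι} {x : List α}

theorem Step.headsOn {a b : P.Node × (ι → ℕ)} (h : P.Step x a b) (ha : HeadsOn x a.2) :
    HeadsOn x b.2 := by
  obtain ⟨i, op, p, -, hp, hb⟩ := h
  rw [hb]
  exact ha.update (hp.le (ha i))

theorem Reach.headsOn {a b : P.Node × (ι → ℕ)} (h : P.Reach x a b) (ha : HeadsOn x a.2) :
    HeadsOn x b.2 := by
  induction h with
  | refl => exact ha
  | tail _ h ih => exact h.headsOn ih

theorem Step.of_nop [Nonempty ι] {a b : P.Node} (h : ∀ i, P.edge a i .nop b) (v : ι → ℕ) :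
    P.Step x (a, v) (b, v) := by
  obtain ⟨i⟩ := ‹Nonempty ι›
  exact ⟨i, .nop, v i, h i, rfl, (Function.update_eq_self i v).symm⟩

end HeadProgram

/-- `R` is the input-output relation of `P`, on head positions between the end-markers. -/
def HeadProgram.Implements (P : HeadProgram α ι) (R : HeadRel α ι) : Prop :=
  ∀ x v, HeadsOn x v → ∀ v', R x v v' ↔ P.Reach x (P.start, v) (P.final, v')

/-- `R` is the input-output relation of some program. -/
def Implementable (R : HeadRel α ι) : Prop := ∃ P : HeadProgram α ι, P.Implements R

theorem Implementable.congr {R S : HeadRel α ι} (h : Implementable R)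
    (e : ∀ x v, HeadsOn x v → ∀ v', S x v v' ↔ R x v v') : Implementable S := by
  obtain ⟨P, hP⟩ := h
  exact ⟨P, fun x v hv v' => (e x v hv v').trans (hP x v hv v')⟩

/-- One step in a graph whose edges `j` are labelled with relations `R j`. -/
def GraphStep {N J : Type} (src tgt : J → N) (R : J → HeadRel α ι) (x : List α)
    (a b : N × (ι → ℕ)) : Prop :=
  ∃ j, src j = a.1 ∧ tgt j = b.1 ∧ R j x a.2 b.2

/-- The program obtained from a graph by replacing its edges with programs. -/
def graphProgram {N J : Type} [Finite N] [Finite J] (src tgt : J → N)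
    (P : J → HeadProgram α ι) (s f : N) : HeadProgram α ι where
  Node := N ⊕ Σ j, (P j).Node
  finNode := by
    have := fun j => (P j).finNode
    infer_instance
  edge a i op b :=
    match a, b with
    | .inl a, .inr ⟨j, q⟩ => op = .nop ∧ src j = a ∧ q = (P j).start
    | .inr ⟨j, q⟩, .inl b => op = .nop ∧ tgt j = b ∧ q = (P j).final
    | .inr ⟨j, q⟩, .inr ⟨j', q'⟩ => ∃ h : j' = j, (P j).edge q i op (h ▸ q')
    | .inl _, .inl _ => False
  start := .inl s
  final := .inl f

section Graph

variable {N J : Type} [Finite N] [Finite J] {src tgt : J → N} {R : J → HeadRel α ι}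
  {P : J → HeadProgram α ι} {s f : N} {x : List α}

theorem graphProgram_reach_inr {j : J} {q q' : (P j).Node} {v v' : ι → ℕ}
    (h : (P j).Reach x (q, v) (q', v')) :
    (graphProgram src tgt P s f).Reach x (.inr ⟨j, q⟩, v) (.inr ⟨j, q'⟩, v') :=
  Relation.ReflTransGen.lift
    (fun a : (P j).Node × (ι → ℕ) => ((.inr ⟨j, a.1⟩, a.2) : (N ⊕ Σ j, (P j).Node) × (ι → ℕ)))
    (fun _ _ ⟨i, op, p, he, hp, hv⟩ => ⟨i, op, p, ⟨rfl, he⟩, hp, hv⟩) _ _ h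

theorem graphProgram_reach_inl [Nonempty ι]
    (hP : ∀ j, (P j).Implements (R j)) {v : ι → ℕ} (hv : HeadsOn x v) {b : N × (ι → ℕ)}
    (h : Relation.ReflTransGen (GraphStep src tgt R x) (s, v) b) :
    (graphProgram src tgt P s f).Reach x (.inl s, v) (.inl b.1, b.2) := by
  induction h with
  | refl => exact .refl
  | @tail b c _ hstep ih =>
    obtain ⟨j, hsrc, htgt, hR⟩ := hstep
    have hrun : (P j).Reach x ((P j).start, b.2) ((P j).final, c.2) :=
      (hP j x _ (HeadProgram.Reach.headsOn ih hv) _).1 hR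
    have enter : (graphProgram src tgt P s f).Step x (.inl b.1, b.2) (.inr ⟨j, (P j).start⟩, b.2) :=
      HeadProgram.Step.of_nop (fun _ => show _ ∧ _ from ⟨rfl, hsrc, rfl⟩) _
    have leave : (graphProgram src tgt P s f).Step x (.inr ⟨j, (P j).final⟩, c.2) (.inl c.1, c.2) :=
      HeadProgram.Step.of_nop (fun _ => show _ ∧ _ from ⟨rfl, htgt, rfl⟩) _
    exact ((ih.tail enter).trans (graphProgram_reach_inr hrun)).tail leave

/-- The invariant of the computations of a graph program: the nodes of the graph are passed in
accordance with its labels, and the current label has been executed up to the current node. -/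
def GraphInv (src tgt : J → N) (R : J → HeadRel α ι) (P : J → HeadProgram α ι) (x : List α)
    (a : N × (ι → ℕ)) : (N ⊕ Σ j, (P j).Node) × (ι → ℕ) → Prop
  | (.inl c, v) => Relation.ReflTransGen (GraphStep src tgt R x) a (c, v)
  | (.inr ⟨j, q⟩, v) => ∃ u, HeadsOn x u ∧
      Relation.ReflTransGen (GraphStep src tgt R x) a (src j, u) ∧
      (P j).Reach x ((P j).start, u) (q, v)

theorem GraphInv.of_reach
    (hP : ∀ j, (P j).Implements (R j)) {v : ι → ℕ} (hv : HeadsOn x v)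
    {b : (N ⊕ Σ j, (P j).Node) × (ι → ℕ)}
    (h : (graphProgram src tgt P s f).Reach x (.inl s, v) b) :
    GraphInv src tgt R P x (s, v) b := by
  induction h with
  | refl => exact .refl
  | @tail b c hb hstep ih =>
    have hbOn : HeadsOn x b.2 := HeadProgram.Reach.headsOn hb hv
    obtain ⟨i, op, p, he, hp, hc⟩ := hstep
    obtain ⟨a | ⟨j, q⟩, u⟩ := b <;> obtain ⟨a' | ⟨j', q'⟩, u'⟩ := c
    · exact he.elim
    · obtain ⟨rfl, rfl, rfl⟩ := he
      obtain rfl : p = u i := hp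
      obtain rfl : u' = u := by simpa only [Function.update_eq_self] using hc
      exact ⟨u', hbOn, ih, .refl⟩
    · obtain ⟨rfl, rfl, rfl⟩ := he
      obtain rfl : p = u i := hp
      obtain rfl : u' = u := by simpa only [Function.update_eq_self] using hc
      obtain ⟨w, hw, hpath, hrun⟩ := ih
      exact hpath.tail ⟨j, rfl, rfl, (hP j x w hw _).2 hrun⟩
    · obtain ⟨rfl, he⟩ := he
      obtain ⟨w, hw, hpath, hrun⟩ := ih
      exact ⟨w, hw, hpath, hrun.tail ⟨i, op, p, he, hp, hc⟩⟩

theorem Implementable.graph [Nonempty ι] (src tgt : J → N) (h : ∀ j, Implementable (R j))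
    (s f : N) :
    Implementable fun x v v' =>
      Relation.ReflTransGen (GraphStep src tgt R x) (s, v) (f, v') := by
  choose P hP using h
  exact ⟨graphProgram src tgt P s f, fun x v hv v' =>
    ⟨graphProgram_reach_inl hP hv, fun hr => GraphInv.of_reach hP hv hr⟩⟩

end Graph

theorem Implementable.op (i : ι) (op : HeadOp α) :
    Implementable fun x v v' => ∃ p, op.Exec x (v i) p ∧ v' = Function.update v i p := by
  refine ⟨⟨Bool, inferInstance, fun a j o b => a = false ∧ b = true ∧ j = i ∧ o = op,
    false, true⟩, fun x v _ v' => ⟨?_, fun h => ?_⟩⟩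
  · rintro ⟨p, hp, rfl⟩
    exact .single ⟨i, op, p, ⟨rfl, rfl, rfl, rfl⟩, hp, rfl⟩
  · obtain h | ⟨⟨b, u⟩, ⟨j, o, p, ⟨-, rfl, rfl, rfl⟩, hp, hu⟩, hr⟩ :=
      Relation.ReflTransGen.cases_head h
    · simp only [Prod.mk.injEq, Bool.false_eq_true, false_and] at h
    · obtain h | ⟨c, ⟨_, _, _, ⟨hf, _⟩, _⟩, _⟩ := Relation.ReflTransGen.cases_head hr
      · exact ⟨p, hp, (Prod.mk.inj h).2 ▸ hu⟩
      · simp only [Bool.true_eq_false] at hf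

section Closure

variable [Nonempty ι] {R S : HeadRel α ι}

theorem Implementable.iUnion {J : Type} [Finite J] {R : J → HeadRel α ι}
    (h : ∀ j, Implementable (R j)) : Implementable fun x v v' => ∃ j, R j x v v' := by
  refine (Implementable.graph (fun _ => false) (fun _ => true) h false true).congr
    fun x v _ v' => ⟨fun ⟨j, hj⟩ => .single ⟨j, rfl, rfl, hj⟩, fun h => ?_⟩
  obtain h | ⟨⟨b, u⟩, ⟨j, -, rfl, hj⟩, hr⟩ := Relation.ReflTransGen.cases_head h
  · simp only [Prod.mk.injEq, Bool.false_eq_true, false_and] at h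
  · obtain h | ⟨c, ⟨_, hf, _⟩, _⟩ := Relation.ReflTransGen.cases_head hr
    · exact ⟨j, (Prod.mk.inj h).2 ▸ hj⟩
    · simp only [Bool.false_eq_true] at hf

theorem Implementable.union (hR : Implementable R) (hS : Implementable S) :
    Implementable fun x v v' => R x v v' ∨ S x v v' := by
  refine (Implementable.iUnion (R := fun b : Bool => bif b then R else S)
    (by rintro (_ | _); exacts [hS, hR])).congr fun x v _ v' => ?_
  simp only [Bool.exists_bool, cond_false, cond_true, or_comm]

theorem Implementable.star (hR : Implementable R) :
    Implementable fun x => Relation.ReflTransGen (R x) :=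
  (Implementable.graph (N := Unit) (J := Unit) id id (fun _ => hR) () ()).congr fun _ _ _ _ =>
    ⟨fun h => Relation.ReflTransGen.lift (fun u => ((), u))
        (fun _ _ hab => ⟨(), rfl, rfl, hab⟩) _ _ h,
      fun h => Relation.ReflTransGen.lift (fun u : Unit × (ι → ℕ) => u.2)
        (fun _ _ ⟨_, _, _, hab⟩ => hab) _ _ h⟩

theorem Implementable.comp (hR : Implementable R) (hS : Implementable S) :
    Implementable fun x => Relation.Comp (R x) (S x) := by
  let T : Bool → HeadRel α ι := fun b => bif b then R else S
  let src : Bool → Fin 3 := fun b => bif b then 0 else 1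
  let tgt : Bool → Fin 3 := fun b => bif b then 1 else 2
  have hT : ∀ b, Implementable (T b) := by rintro (_ | _); exacts [hS, hR]
  refine (Implementable.graph src tgt hT 0 2).congr fun x v _ v' => ⟨?_, fun h => ?_⟩
  · rintro ⟨u, hR, hS⟩
    exact (Relation.ReflTransGen.single (b := (1, u)) ⟨true, rfl, rfl, hR⟩).tail
      ⟨false, rfl, rfl, hS⟩
  have inv : ∀ b, Relation.ReflTransGen (GraphStep src tgt T x) (0, v) b →
      (b.1 = 0 → b.2 = v) ∧ (b.1 = 1 → R x v b.2) ∧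
        (b.1 = 2 → Relation.Comp (R x) (S x) v b.2) := by
    intro b hb
    induction hb with
    | refl => simp
    | @tail b c _ hstep ih =>
      obtain ⟨_ | _, hsrc, htgt, hj⟩ := hstep
      · have hb : R x v b.2 := ih.2.1 hsrc.symm
        simp only [← htgt, tgt, cond_false, Fin.reduceEq, false_imp_iff, true_and, true_imp_iff]
        exact ⟨b.2, hb, hj⟩
      · have hb : b.2 = v := ih.1 hsrc.symm
        simp only [← htgt, tgt, cond_true, Fin.reduceEq, false_imp_iff, true_and, true_imp_iff,
          and_true]
        exact hb ▸ hj
  exact (inv _ h).2.2 rfl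

theorem Implementable.eq : Implementable fun (_ : List α) (v v' : ι → ℕ) => v' = v := by
  obtain ⟨i⟩ := ‹Nonempty ι›
  refine (Implementable.op i .nop).congr fun x v _ v' => ?_
  simp only [HeadOp.Exec, exists_eq_left, Function.update_eq_self]

theorem Implementable.empty : Implementable fun (_ : List α) (_ _ : ι → ℕ) => False :=
  (Implementable.iUnion (J := Empty) (R := fun _ _ v v' => v' = v) (fun _ => .eq)).congr
    fun x v _ v' => by simp only [IsEmpty.exists_iff]

theorem Implementable.guard (p : Prop) (hR : p → Implementable R) :
    Implementable fun x v v' => p ∧ R x v v' := by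
  by_cases hp : p
  · simpa only [hp, true_and] using hR hp
  · simpa only [hp, false_and] using Implementable.empty

end Closure

theorem Implementable.inc (i : ι) : Implementable fun (x : List α) v v' =>
    v i ≤ x.length ∧ v' = Function.update v i (v i + 1) :=
  (Implementable.op i .inc).congr fun _ _ _ _ =>
    ⟨fun ⟨hi, hv⟩ => ⟨_, ⟨hi, rfl⟩, hv⟩, fun ⟨_, ⟨hi, rfl⟩, hv⟩ => ⟨hi, hv⟩⟩

theorem Implementable.dec (i : ι) : Implementable fun (_ : List α) v v' =>
    1 ≤ v i ∧ v' = Function.update v i (v i - 1) := by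
  refine (Implementable.op i .dec).congr fun x v _ v' => ⟨?_, ?_⟩
  · rintro ⟨hi, rfl⟩
    exact ⟨v i - 1, (Nat.sub_add_cancel hi).symm, rfl⟩
  · rintro ⟨p, hp, rfl⟩
    obtain hp : v i = p + 1 := hp
    rw [hp, Nat.add_sub_cancel]
    exact ⟨Nat.le_add_left 1 p, rfl⟩

theorem Implementable.zero (i : ι) : Implementable fun (_ : List α) v v' =>
    v i = 0 ∧ v' = v := by
  refine (Implementable.op i .zero).congr fun x v _ v' => ⟨?_, ?_⟩
  · rintro ⟨hi, rfl⟩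
    exact ⟨0, ⟨hi, rfl⟩, by rw [← hi, Function.update_eq_self]⟩
  · rintro ⟨_, ⟨hi, rfl⟩, rfl⟩
    exact ⟨hi, by rw [← hi, Function.update_eq_self]⟩

theorem Implementable.sym (i : ι) (o : Option α) : Implementable fun x v v' =>
    inputSymbol x (v i) = o ∧ v' = v := by
  refine (Implementable.op i (.sym o)).congr fun x v _ v' => ⟨?_, ?_⟩
  · rintro ⟨hi, rfl⟩
    exact ⟨v' i, ⟨hi, rfl⟩, (Function.update_eq_self i v').symm⟩
  · rintro ⟨_, ⟨hi, rfl⟩, rfl⟩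
    exact ⟨hi, Function.update_eq_self i v⟩

/-! ### Arithmetic on head positions -/

theorem Implementable.zeros [Nonempty ι] (l : List ι) : Implementable fun (_ : List α) v v' =>
    (∀ i ∈ l, v i = 0) ∧ v' = v := by
  induction l with
  | nil => simpa using Implementable.eq
  | cons i l ih =>
    refine ((Implementable.zero i).comp ih).congr fun x v _ v' => ?_
    simp only [List.forall_mem_cons]
    constructor
    · rintro ⟨⟨hi, hl⟩, rfl⟩
      exact ⟨v', ⟨hi, rfl⟩, hl, rfl⟩
    · rintro ⟨_, ⟨hi, rfl⟩, hl, hv⟩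
      exact ⟨⟨hi, hl⟩, hv⟩

theorem Implementable.add [Nonempty ι] (i : ι) (m : ℕ) : Implementable fun (x : List α) v v' =>
    v i + m ≤ x.length + 1 ∧ v' = Function.update v i (v i + m) := by
  induction m with
  | zero =>
    refine Implementable.eq.congr fun x v hv v' => ?_
    simpa only [add_zero, Function.update_eq_self, and_iff_right_iff_imp] using fun _ => hv i
  | succ m ih =>
    refine (ih.comp (Implementable.inc i)).congr fun x v _ v' => ⟨?_, ?_⟩
    · rintro ⟨hle, rfl⟩
      refine ⟨_, ⟨by omega, rfl⟩, ?_, ?_⟩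
      · simpa only [Function.update_self] using by omega
      · simp only [Function.update_self, Function.update_idem, add_assoc]
    · rintro ⟨_, ⟨-, rfl⟩, hle, rfl⟩
      rw [Function.update_self] at hle
      exact ⟨by omega, by simp only [Function.update_self, Function.update_idem, add_assoc]⟩

theorem Implementable.sub [Nonempty ι] (i : ι) (m : ℕ) : Implementable fun (_ : List α) v v' =>
    m ≤ v i ∧ v' = Function.update v i (v i - m) := by
  induction m with
  | zero =>
    refine Implementable.eq.congr fun x v _ v' => ?_
    simp only [Nat.zero_le, Nat.sub_zero, Function.update_eq_self, true_and]
  | succ m ih =>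
    refine (ih.comp (Implementable.dec i)).congr fun x v _ v' => ⟨?_, ?_⟩
    · rintro ⟨hle, rfl⟩
      refine ⟨_, ⟨by omega, rfl⟩, ?_, ?_⟩
      · simpa only [Function.update_self] using by omega
      · simp only [Function.update_self, Function.update_idem, Nat.sub_sub]
    · rintro ⟨_, ⟨-, rfl⟩, hle, rfl⟩
      rw [Function.update_self] at hle
      exact ⟨by omega, by simp only [Function.update_self, Function.update_idem, Nat.sub_sub]⟩

/-- The head positions after `t` rounds of a loop that moves the head `y` by `k` to the left and the
head `z` by `m` to the right. -/
def transferred (y z : ι) (k m : ℕ) (v : ι → ℕ) (t : ℕ) : ι → ℕ :=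
  Function.update (Function.update v y (v y - k * t)) z (v z + m * t)

section Transfer

variable {y z : ι} (hyz : y ≠ z) (k m : ℕ)

include hyz in
theorem transferred_succ (v : ι → ℕ) (t : ℕ) :
    transferred y z k m v (t + 1) = Function.update
      (Function.update (transferred y z k m v t) y (transferred y z k m v t y - k))
      z (transferred y z k m v t z + m) := by
  funext j
  simp only [transferred, Function.update_apply]
  grind

variable [Nonempty ι]

include hyz in
theorem Implementable.transferLoop : Implementable fun (x : List α) v v' =>
    ∃ t, k * t ≤ v y ∧ v z + m * t ≤ x.length + 1 ∧ v' = transferred y z k m v t := by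
  refine ((Implementable.sub y k).comp (Implementable.add z m)).star.congr
    fun x v hv v' => ⟨?_, fun h => ?_⟩
  · rintro ⟨t, hy, hz, rfl⟩
    induction t with
    | zero => simpa [transferred] using Relation.ReflTransGen.refl
    | succ t ih =>
      rw [mul_add, mul_one] at hy hz
      refine (ih (by omega) (by omega)).tail ⟨_, ⟨?_, rfl⟩, ?_, ?_⟩
      · simpa [transferred, hyz] using by omega
      · simpa [transferred, hyz.symm] using by omega
      · rw [transferred_succ hyz, Function.update_of_ne hyz.symm]
  · induction h with
    | refl => exact ⟨0, by simp, by simpa using hv z, by simp [transferred]⟩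
    | tail _ hstep ih =>
      obtain ⟨t, hle, -, rfl⟩ := ih
      obtain ⟨_, ⟨hk, rfl⟩, hm, rfl⟩ := hstep
      rw [Function.update_of_ne hyz.symm] at hm ⊢
      refine ⟨t + 1, ?_, ?_, (transferred_succ hyz k m v t).symm⟩
      · simp only [transferred, Function.update_of_ne hyz, Function.update_self] at hk
        rw [mul_add]; omega
      · simp only [transferred, Function.update_self] at hm
        rw [mul_add]; omega

include hyz in
theorem Implementable.transfer :
    Implementable fun (x : List α) v v' => ∃ t, v y = k * t ∧ v z + m * t ≤ x.length + 1 ∧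
      v' = Function.update (Function.update v y 0) z (v z + m * t) := by
  refine ((transferLoop hyz k m).comp (.zero y)).congr fun x v _ v' => ⟨?_, ?_⟩
  · rintro ⟨t, hy, hz, rfl⟩
    exact ⟨_, ⟨t, hy.ge, hz, rfl⟩, by simp [transferred, hyz, hy], by simp [transferred, hy]⟩
  · rintro ⟨_, ⟨t, hy, hz, rfl⟩, h0, rfl⟩
    replace h0 : v y - k * t = 0 := by simpa [transferred, hyz] using h0
    exact ⟨t, by omega, hz, by rw [transferred, h0]⟩

include hyz in
theorem Implementable.mulAdd (w c : ℕ) :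
    Implementable fun (x : List α) v v' => v z = 0 ∧ w * v y + c ≤ x.length + 1 ∧
      v' = Function.update v y (w * v y + c) := by
  refine ((((Implementable.zero z).comp (.transfer hyz 1 1)).comp
    (.transfer hyz.symm 1 w)).comp (.add y c)).congr fun x v hv v' => ⟨?_, ?_⟩
  · rintro ⟨hz, hle, rfl⟩
    refine ⟨_, ⟨_, ⟨_, ⟨hz, rfl⟩, v y, (one_mul _).symm, ?_, rfl⟩, v y, ?_, ?_, rfl⟩, ?_, ?_⟩
    · simpa [hz] using hv y
    · simp [hz]
    · simpa [hyz] using by omega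
    · simpa [hyz] using by omega
    · funext j
      simp only [Function.update_apply]
      grind
  · rintro ⟨_, ⟨_, ⟨_, ⟨hz, rfl⟩, t, ht, -, rfl⟩, t', ht', -, rfl⟩, hle, rfl⟩
    simp only [one_mul, Function.update_self, ne_eq, hyz, not_false_eq_true, Function.update_of_ne,
      zero_add, hz] at ht ht' hle ⊢
    subst ht ht'
    refine ⟨trivial, hle, ?_⟩
    funext j
    simp only [Function.update_apply]
    grind

include hyz in
/-- The inverse of `Implementable.mulAdd`. -/
theorem Implementable.divMod {w : ℕ} (hw : 0 < w) (c : ℕ) :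
    Implementable fun (_ : List α) v v' => v z = 0 ∧ ∃ t, v y = w * t + c ∧
      v' = Function.update v y t := by
  refine ((((Implementable.zero z).comp (.sub y c)).comp
    (.transfer hyz w 1)).comp (.transfer hyz.symm 1 1)).congr fun x v hv v' => ⟨?_, ?_⟩
  · rintro ⟨hz, t, ht, rfl⟩
    have hy := hv y
    have hle : t ≤ w * t := Nat.le_mul_of_pos_left t hw
    refine ⟨_, ⟨_, ⟨_, ⟨hz, rfl⟩, by omega, rfl⟩, t, ?_, ?_, rfl⟩, t, ?_, ?_, ?_⟩
    · simpa using by omega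
    · simpa [hyz.symm, hz] using by omega
    · simp [hyz.symm, hz]
    · simpa [hyz] using by omega
    · funext j
      simp only [Function.update_apply]
      grind
  · rintro ⟨_, ⟨_, ⟨_, ⟨hz, rfl⟩, hc, rfl⟩, t, ht, -, rfl⟩, t', ht', -, rfl⟩
    simp only [one_mul, Function.update_self, ne_eq, hyz, hyz.symm, not_false_eq_true,
      Function.update_of_ne, zero_add, hz] at ht ht' ⊢
    subst ht'
    refine ⟨trivial, t, by omega, ?_⟩
    funext j
    simp only [Function.update_apply]
    grind

end Transfer

end Programs

/-! ### Stacks of logarithmic size stored in head positions -/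

section Stacks

variable {W : Type}

/-- The value of a word in bijective base `w`, the digit of the letter `a` being `num a + 1`; it
determines the word because there is no digit `0`. -/
def stackCode (num : W → ℕ) (w : ℕ) : List W → ℕ
  | [] => 0
  | a :: l => w * stackCode num w l + (num a + 1)

theorem stackCode_lt_pow {num : W → ℕ} {w : ℕ} (hw : ∀ a, num a < w) (l : List W) :
    stackCode num w l < (w + 1) ^ l.length := by
  induction l with
  | nil => simp [stackCode]
  | cons a l ih =>
    calc w * stackCode num w l + (num a + 1)
        < w * (stackCode num w l + 1) + (stackCode num w l + 1) := by linarith [hw a]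
      _ = (w + 1) * (stackCode num w l + 1) := by ring
      _ ≤ (w + 1) * (w + 1) ^ l.length := Nat.mul_le_mul_left _ ih
      _ = (w + 1) ^ (a :: l).length := by rw [List.length_cons, pow_succ']

theorem stackCode_eq_zero {num : W → ℕ} {w : ℕ} {l : List W} :
    stackCode num w l = 0 ↔ l = [] := by
  cases l <;> simp [stackCode]

theorem exists_eq_cons_of_stackCode_eq {num : W → ℕ} {w : ℕ} (hw : ∀ a, num a < w)
    (hnum : num.Injective) {l : List W} {a : W} {t : ℕ}
    (h : stackCode num w l = w * t + (num a + 1)) :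
    ∃ l', l = a :: l' ∧ stackCode num w l' = t := by
  cases l with
  | nil => simp [stackCode] at h
  | cons b l =>
    replace h : num b + w * stackCode num w l = num a + w * t := by
      simp only [stackCode] at h
      omega
    have hdigit : num b = num a := by
      simpa [Nat.add_mul_mod_self_left, Nat.mod_eq_of_lt (hw _)] using congrArg (· % w) h
    have hw0 : 0 < w := (hw a).pos
    exact ⟨l, by rw [hnum hdigit], Nat.eq_of_mul_eq_mul_left hw0 (by omega)⟩

/-- The concatenation of the words `g (B - 1), …, g 0`. -/
def joinSegments (g : ℕ → List W) : ℕ → List W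
  | 0 => []
  | B + 1 => g B ++ joinSegments g B

theorem joinSegments_congr {g g' : ℕ → List W} {B : ℕ} (h : ∀ i < B, g i = g' i) :
    joinSegments g B = joinSegments g' B := by
  induction B with
  | zero => rfl
  | succ B ih =>
    simp only [joinSegments]
    rw [h B B.lt_succ_self, ih fun i hi => h i (hi.trans B.lt_succ_self)]

theorem joinSegments_nil {B : ℕ} : joinSegments (fun _ => ([] : List W)) B = [] := by
  induction B with
  | zero => rfl
  | succ B ih => rw [joinSegments, ih, List.append_nil]

theorem joinSegments_update_cons {g : ℕ → List W} {B i : ℕ} (hi : i < B)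
    (htop : ∀ j, i < j → j < B → g j = []) (a : W) (l : List W) :
    joinSegments (Function.update g i (a :: l)) B =
      a :: joinSegments (Function.update g i l) B := by
  induction B with
  | zero => omega
  | succ B ih =>
    simp only [joinSegments]
    rcases eq_or_ne i B with rfl | hB
    · have below : ∀ l', joinSegments (Function.update g i l') i = joinSegments g i := fun l' =>
        joinSegments_congr fun j hj => Function.update_of_ne hj.ne _ _
      rw [Function.update_self, Function.update_self, below, below, List.cons_append]
    · have hiB : i < B := by omega
      rw [Function.update_of_ne hiB.ne', Function.update_of_ne hiB.ne', htop B hiB B.lt_succ_self,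
        ih hiB fun j hij hj => htop j hij (hj.trans B.lt_succ_self), List.nil_append,
        List.nil_append]

/-- The segments of a stack that is cut, from its bottom upwards, into pieces of length `c`. -/
def segments (c : ℕ) : List W → ℕ → List W
  | [] => fun _ => []
  | a :: l => Function.update (segments c l) (l.length / c) (a :: segments c l (l.length / c))

theorem length_segments {c : ℕ} (hc : 0 < c) (l : List W) (i : ℕ) :
    (segments c l i).length = min c (l.length - i * c) := by
  induction l with
  | nil => simp [segments]
  | cons a l ih =>
    have hdiv := Nat.div_add_mod' l.length c
    have hmod := Nat.mod_lt l.length hc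
    rcases lt_trichotomy i (l.length / c) with hi | rfl | hi
    · have : (i + 1) * c ≤ l.length / c * c := Nat.mul_le_mul_right c hi
      rw [segments, Function.update_of_ne hi.ne, ih, List.length_cons]
      grind
    · rw [segments, Function.update_self, List.length_cons, ih, List.length_cons]
      omega
    · have : (l.length / c + 1) * c ≤ i * c := Nat.mul_le_mul_right c hi
      rw [segments, Function.update_of_ne hi.ne', ih, List.length_cons]
      grind

theorem segments_eq_nil {c : ℕ} (hc : 0 < c) {l : List W} {i : ℕ} (hi : l.length / c < i) :
    segments c l i = [] := by
  have hlen : l.length < i * c := (Nat.div_lt_iff_lt_mul hc).1 hi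
  rw [← List.length_eq_zero_iff, length_segments hc, Nat.sub_eq_zero_of_le hlen.le, Nat.min_zero]

theorem length_segments_top_lt {c : ℕ} (hc : 0 < c) (l : List W) :
    (segments c l (l.length / c)).length < c := by
  have hdiv := Nat.div_add_mod' l.length c
  have hmod := Nat.mod_lt l.length hc
  rw [length_segments hc]
  omega

variable {α ι : Type} [DecidableEq ι] {B : ℕ}

/-- The top segment of the stack stored in the heads `y j` is among the segments `0, …, i`. -/
def TopSegment (y : Fin B → ι) (v : ι → ℕ) (i : Fin B) : Prop := ∀ j, i < j → v (y j) = 0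

/-- Pushing the digit `d` on the stack whose segments are stored in the heads `y i`, where the head
`z` is used as a scratch register. -/
def PushRel (y : Fin B → ι) (z : ι) (w d : ℕ) : HeadRel α ι := fun x v v' =>
  ∃ i : Fin B, TopSegment y v i ∧ v z = 0 ∧ w * v (y i) + d ≤ x.length + 1 ∧
    v' = Function.update v (y i) (w * v (y i) + d)

/-- Popping the digit `d` from the stack whose segments are stored in the heads `y i`, where the
head `z` is used as a scratch register. -/
def PopRel (y : Fin B → ι) (z : ι) (w d : ℕ) : HeadRel α ι := fun _ v v' =>
  ∃ i : Fin B, TopSegment y v i ∧ v z = 0 ∧ ∃ t, v (y i) = w * t + d ∧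
    v' = Function.update v (y i) t

/-- The test for an empty stack. -/
def EmptyRel (y : Fin B → ι) : HeadRel α ι := fun _ v v' => (∀ i, v (y i) = 0) ∧ v' = v

section Implementation

variable [Nonempty ι] {y : Fin B → ι} {z : ι}

theorem Implementable.topSegment {R : Fin B → HeadRel α ι} (h : ∀ i, Implementable (R i)) :
    Implementable fun x v v' => ∃ i, TopSegment y v i ∧ R i x v v' := by
  refine (Implementable.iUnion fun i : Fin B =>
    (Implementable.zeros (((Finset.Ioi i).toList).map y)).comp (h i)).congr fun x v hv v' => ?_
  have zeros_iff : ∀ i, (∀ k ∈ (Finset.Ioi i).toList.map y, v k = 0) ↔ TopSegment y v i := by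
    simp [TopSegment]
  refine exists_congr fun i => ⟨fun ⟨htop, hR⟩ => ⟨v, ⟨(zeros_iff i).2 htop, rfl⟩, hR⟩, ?_⟩
  rintro ⟨_, ⟨htop, rfl⟩, hR⟩
  exact ⟨(zeros_iff i).1 htop, hR⟩

theorem implementable_pushRel (hz : ∀ i, y i ≠ z) (w d : ℕ) :
    Implementable (PushRel (α := α) y z w d) :=
  .topSegment fun i => .mulAdd (hz i) w d

theorem implementable_popRel (hz : ∀ i, y i ≠ z) {w : ℕ} (hw : 0 < w) (d : ℕ) :
    Implementable (PopRel (α := α) y z w d) :=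
  .topSegment fun i => .divMod (hz i) hw d

theorem implementable_emptyRel (y : Fin B → ι) : Implementable (EmptyRel (α := α) y) := by
  refine (Implementable.zeros (Finset.univ.toList.map y)).congr fun x v _ v' => ?_
  simp [EmptyRel]

end Implementation

/-- The positions `u i` are the codes of the segments `g i`. -/
def SegmentsRep (num : W → ℕ) (w : ℕ) (u : Fin B → ℕ) (g : ℕ → List W) : Prop :=
  ∀ i : Fin B, u i = stackCode num w (g i)

/-- The positions `u i` encode the stack `l`, cut into segments in an arbitrary way. This suffices
for the soundness of the stack operations. -/
def StackRep (num : W → ℕ) (w : ℕ) (u : Fin B → ℕ) (l : List W) : Prop :=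
  ∃ g : ℕ → List W, SegmentsRep num w u g ∧ joinSegments g B = l

/-- The positions `u i` encode the stack `l`, cut into segments of length `c`, so that no position
becomes too large. -/
def BalancedStackRep (num : W → ℕ) (w c : ℕ) (u : Fin B → ℕ) (l : List W) : Prop :=
  l.length ≤ B * c ∧ SegmentsRep num w u (segments c l)

variable {num : W → ℕ} {w c : ℕ} {x : List α} {v v' : ι → ℕ} {y : Fin B → ι} {z : ι}

theorem stackRep_nil : StackRep num w (fun _ : Fin B => 0) ([] : List W) :=
  ⟨fun _ => [], fun _ => rfl, joinSegments_nil⟩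

theorem balancedStackRep_nil : BalancedStackRep num w c (fun _ : Fin B => 0) ([] : List W) :=
  ⟨Nat.zero_le _, fun _ => rfl⟩

theorem SegmentsRep.update (hy : y.Injective) {g : ℕ → List W}
    (h : SegmentsRep num w (v ∘ y) g) (i : Fin B) (l : List W) :
    SegmentsRep num w (Function.update v (y i) (stackCode num w l) ∘ y)
      (Function.update g i l) := by
  intro j
  rw [Function.update_comp_eq_of_injective _ hy]
  rcases eq_or_ne j i with rfl | hj
  · rw [Function.update_self, Function.update_self]
  · rw [Function.update_of_ne hj, Function.update_of_ne (Fin.val_injective.ne hj), h j]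

omit [DecidableEq ι] in
theorem SegmentsRep.eq_nil {g : ℕ → List W} (h : SegmentsRep num w (v ∘ y) g) {i : Fin B}
    (htop : TopSegment y v i) (j : ℕ) (hij : i < j) (hj : j < B) : g j = [] :=
  stackCode_eq_zero.1 ((h ⟨j, hj⟩).symm.trans (htop ⟨j, hj⟩ hij))

theorem StackRep.push (hy : y.Injective) {l : List W}
    (h : StackRep num w (v ∘ y) l) {a : W} (hpush : PushRel y z w (num a + 1) x v v') :
    StackRep num w (v' ∘ y) (a :: l) := by
  obtain ⟨g, hg, rfl⟩ := h
  obtain ⟨i, htop, -, -, rfl⟩ := hpush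
  refine ⟨Function.update g i (a :: g i), ?_, ?_⟩
  · rw [show v (y i) = stackCode num w (g i) from hg i]
    exact hg.update hy i (a :: g i)
  · rw [joinSegments_update_cons i.2 (hg.eq_nil htop), Function.update_eq_self]

theorem StackRep.pop (hw : ∀ a, num a < w) (hnum : num.Injective) (hy : y.Injective) {l : List W}
    (h : StackRep num w (v ∘ y) l) {a : W} (hpop : PopRel y z w (num a + 1) x v v') :
    ∃ l', l = a :: l' ∧ StackRep num w (v' ∘ y) l' := by
  obtain ⟨g, hg, rfl⟩ := h
  obtain ⟨i, htop, -, t, ht, rfl⟩ := hpop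
  obtain ⟨l, hl, rfl⟩ := exists_eq_cons_of_stackCode_eq hw hnum ((hg i).symm.trans ht)
  refine ⟨_, ?_, _, hg.update hy i l, rfl⟩
  rw [← joinSegments_update_cons i.2 (hg.eq_nil htop), ← hl, Function.update_eq_self]

omit [DecidableEq ι] in
theorem StackRep.empty {l : List W} (h : StackRep num w (v ∘ y) l)
    (hempty : EmptyRel y x v v') : l = [] := by
  obtain ⟨g, hg, rfl⟩ := h
  rw [← joinSegments_nil (B := B)]
  exact joinSegments_congr fun i hi =>
    stackCode_eq_zero.1 ((hg ⟨i, hi⟩).symm.trans (hempty.1 ⟨i, hi⟩))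

theorem BalancedStackRep.push (hw : ∀ a, num a < w) (hy : y.Injective) (hc : 0 < c) {l : List W}
    (h : BalancedStackRep num w c (v ∘ y) l) (hl : l.length < B * c) (hz : v z = 0)
    (hx : (w + 1) ^ c ≤ x.length + 2) (a : W) :
    ∃ v', PushRel y z w (num a + 1) x v v' ∧ BalancedStackRep num w c (v' ∘ y) (a :: l) := by
  obtain ⟨-, hg⟩ := h
  let i : Fin B := ⟨l.length / c, (Nat.div_lt_iff_lt_mul hc).2 hl⟩
  have hi : v (y i) = stackCode num w (segments c l i) := hg i
  have hcode : w * v (y i) + (num a + 1) = stackCode num w (a :: segments c l i) := by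
    rw [hi, stackCode]
  have hbound : stackCode num w (a :: segments c l i) < x.length + 2 :=
    calc stackCode num w (a :: segments c l i)
        < (w + 1) ^ (a :: segments c l i).length := stackCode_lt_pow hw _
      _ ≤ (w + 1) ^ c := Nat.pow_le_pow_right w.succ_pos (length_segments_top_lt hc l)
      _ ≤ x.length + 2 := hx
  refine ⟨_, ⟨i, fun j hj => ?_, hz, by omega, rfl⟩, hl, ?_⟩
  · exact (hg j).trans (stackCode_eq_zero.2 (segments_eq_nil hc hj))
  · rw [hcode]
    exact hg.update hy i _

theorem BalancedStackRep.pop (hy : y.Injective) (hc : 0 < c) {l : List W} {a : W}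
    (h : BalancedStackRep num w c (v ∘ y) (a :: l)) (hz : v z = 0) :
    ∃ v', PopRel y z w (num a + 1) x v v' ∧ BalancedStackRep num w c (v' ∘ y) l := by
  obtain ⟨hl, hg⟩ := h
  let i : Fin B := ⟨l.length / c, (Nat.div_lt_iff_lt_mul hc).2 hl⟩
  have hi : segments c (a :: l) i = a :: segments c l i := Function.update_self ..
  refine ⟨_, ⟨i, fun j hj => ?_, hz, stackCode num w (segments c l i), ?_, rfl⟩, ?_, ?_⟩
  · have hji : (j : ℕ) ≠ i := Fin.val_injective.ne hj.ne'
    rw [show v (y j) = stackCode num w (segments c (a :: l) j) from hg j, stackCode_eq_zero]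
    exact (Function.update_of_ne hji ..).trans (segments_eq_nil hc hj)
  · rw [show v (y i) = stackCode num w (segments c (a :: l) i) from hg i, hi, stackCode]
  · exact (Nat.le_succ _).trans hl
  · have := hg.update hy i (segments c l i)
    rwa [segments, Function.update_idem, Function.update_eq_self] at this

omit [DecidableEq ι] in
theorem BalancedStackRep.empty (h : BalancedStackRep num w c (v ∘ y) ([] : List W)) :
    EmptyRel y x v v :=
  ⟨h.2, rfl⟩

end Stacks

/-! ### Languages of head programs -/

/-- The program accepts `x`, starting with all heads at the left end of the input. -/
def HeadProgram.Accepts {α ι : Type} [DecidableEq ι] (P : HeadProgram α ι) (x : List α) : Prop :=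
  ∃ v, P.Reach x (P.start, fun _ => 0) (P.final, v)

/-- The languages recognized by head programs. -/
def HeadLanguages (α : Type) : Set (Language α) :=
  {L | ∃ (k : ℕ) (P : HeadProgram α (Fin k)), ∀ x, x ∈ L ↔ P.Accepts x}

section Reindex

variable {α ι κ : Type} [DecidableEq ι] [DecidableEq κ]

/-- The program that uses the head `e i` in place of the head `i`. -/
def HeadProgram.reindex (e : ι ≃ κ) (P : HeadProgram α ι) : HeadProgram α κ where
  Node := P.Node
  finNode := P.finNode
  edge a i op b := P.edge a (e.symm i) op b
  start := P.start
  final := P.final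

omit [DecidableEq ι] [DecidableEq κ] in
theorem HeadProgram.reindex_symm_reindex (e : ι ≃ κ) (P : HeadProgram α ι) :
    (P.reindex e).reindex e.symm = P := by
  simp only [reindex, Equiv.symm_symm, Equiv.symm_apply_apply]

theorem HeadProgram.Accepts.reindex {P : HeadProgram α ι} {x : List α} (h : P.Accepts x)
    (e : ι ≃ κ) : (P.reindex e).Accepts x := by
  obtain ⟨v, hv⟩ := h
  refine ⟨v ∘ e.symm, Relation.ReflTransGen.lift
    (fun a : P.Node × (ι → ℕ) => (a.1, a.2 ∘ e.symm)) ?_ _ _ hv⟩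
  rintro ⟨a, v⟩ ⟨b, v'⟩ ⟨i, op, p, hedge, hexec, rfl⟩
  rw [← e.symm_apply_apply i] at hedge hexec
  exact ⟨e i, op, p, hedge, hexec, by simp [Function.update_comp_equiv]⟩

theorem HeadLanguages.of_implementable [Finite ι] {L : Language α} {R : HeadRel α ι}
    (hR : Implementable R) (h : ∀ x, x ∈ L ↔ ∃ v, R x (fun _ => 0) v) : L ∈ HeadLanguages α := by
  obtain ⟨P, hP⟩ := hR
  obtain ⟨k, ⟨e⟩⟩ := Finite.exists_equiv_fin ι
  have mem_iff : ∀ x, x ∈ L ↔ P.Accepts x := fun x =>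
    (h x).trans (exists_congr fun v => hP x _ (fun _ => Nat.zero_le _) v)
  refine ⟨k, P.reindex e, fun x => (mem_iff x).trans ⟨fun hx => hx.reindex e, fun hx => ?_⟩⟩
  simpa only [HeadProgram.reindex_symm_reindex] using hx.reindex e.symm

end Reindex

section Input

variable {α ι : Type} [DecidableEq ι]

theorem inputSymbol_succ (x : List α) (p : ℕ) : inputSymbol x ((p + 1 : ℕ) : ℤ) = x[p]? := by
  simp [inputSymbol]

variable [Nonempty ι]

theorem Implementable.le_length (i : ι) (n : ℕ) :
    Implementable fun (x : List α) v v' => v i + n ≤ x.length ∧ v' = v := by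
  refine ((Implementable.add i (n + 1)).comp (.sub i (n + 1))).congr fun x v _ v' => ⟨?_, ?_⟩
  · rintro ⟨hle, rfl⟩
    exact ⟨_, ⟨by omega, rfl⟩, by simp, by simp⟩
  · rintro ⟨_, ⟨hle, rfl⟩, -, rfl⟩
    exact ⟨by omega, by simp⟩

theorem Implementable.drop_eq (i : ι) (y : List α) : Implementable fun (x : List α) v v' =>
    v i ≤ x.length ∧ x.drop (v i) = y ∧ v' = Function.update v i (x.length + 1) := by
  induction y with
  | nil =>
    refine ((Implementable.inc i).comp (.sym i none)).congr fun x v _ v' => ⟨?_, ?_⟩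
    · rintro ⟨hle, hdrop, rfl⟩
      have hi : v i = x.length := le_antisymm hle (List.drop_eq_nil_iff.1 hdrop)
      refine ⟨_, ⟨hle, rfl⟩, ?_, by rw [hi]⟩
      rw [Function.update_self, inputSymbol_succ, List.getElem?_eq_none_iff, hi]
    · rintro ⟨_, ⟨hle, rfl⟩, hnone, rfl⟩
      rw [Function.update_self, inputSymbol_succ, List.getElem?_eq_none_iff] at hnone
      exact ⟨hle, List.drop_eq_nil_iff.2 hnone, by rw [le_antisymm hle hnone]⟩
  | cons b y ih =>
    refine (((Implementable.inc i).comp (.sym i (some b))).comp ih).congr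
      fun x v _ v' => ⟨?_, ?_⟩
    · rintro ⟨hle, hdrop, rfl⟩
      have hi : v i < x.length := by
        rw [← not_le, ← List.drop_eq_nil_iff, hdrop]
        exact List.cons_ne_nil b y
      obtain ⟨hb, hy⟩ := List.cons.inj ((List.drop_eq_getElem_cons hi).symm.trans hdrop)
      refine ⟨_, ⟨_, ⟨hle, rfl⟩, ?_, rfl⟩, ?_, ?_, ?_⟩
      · rw [Function.update_self, inputSymbol_succ, List.getElem?_eq_getElem hi, hb]
      · rwa [Function.update_self]
      · rwa [Function.update_self]
      · rw [Function.update_idem]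
    · rintro ⟨_, ⟨_, ⟨hle, rfl⟩, hb, rfl⟩, -, hdrop, rfl⟩
      rw [Function.update_self, inputSymbol_succ] at hb
      obtain ⟨hi, hb⟩ := List.getElem?_eq_some_iff.1 hb
      rw [Function.update_self] at hdrop
      exact ⟨hle, by rw [List.drop_eq_getElem_cons hi, hb, hdrop], by rw [Function.update_idem]⟩

/-- Moving the head `i` in the direction `d`. -/
def ShiftRel (i : ι) (d : SignType) : HeadRel α ι := fun x v v' =>
  0 ≤ (v i : ℤ) + d ∧ (v i : ℤ) + d ≤ x.length + 1 ∧
    v' = Function.update v i ((v i : ℤ) + d).toNat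

theorem implementable_shiftRel (i : ι) (d : SignType) :
    Implementable (ShiftRel (α := α) i d) := by
  rcases d.trichotomy with rfl | rfl | rfl
  · refine (Implementable.dec i).congr fun x v hv v' => ?_
    have hi := hv i
    have hdec : ((v i : ℤ) + -1).toNat = v i - 1 := by omega
    simp only [ShiftRel, SignType.coe_neg, SignType.coe_one, hdec, ← and_assoc]
    exact and_congr_left' (by omega)
  · refine Implementable.eq.congr fun x v hv v' => ?_
    have hi : (v i : ℤ) ≤ x.length + 1 := mod_cast hv i
    simp [ShiftRel, hi]
  · refine (Implementable.inc i).congr fun x v _ v' => ?_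
    have hinc : ((v i : ℤ) + 1).toNat = v i + 1 := by omega
    simp only [ShiftRel, SignType.coe_one, hinc, ← and_assoc]
    exact and_congr_left' (by omega)

end Input

/-! ### Work tapes stored in head positions -/

/-- The direction of a side of a tape: `false` is the left side and `true` the right side. -/
def side (σ : Bool) : SignType := bif σ then 1 else -1

theorem eq_zero_or_eq_side (d : SignType) : d = 0 ∨ ∃ σ, d = side σ := by
  rcases d.trichotomy with rfl | rfl | rfl
  · exact .inr ⟨false, rfl⟩
  · exact .inl rfl
  · exact .inr ⟨true, rfl⟩

section TapeRep

variable {W : Type} {blank : W} {f : ℤ → W} {p : ℤ} {S : Bool → List W}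

/-- The words `S σ` are the parts of the tape `f` on the two sides of the position `p`, read
away from `p` and up to blanks. -/
def TapeRep (blank : W) (f : ℤ → W) (p : ℤ) (S : Bool → List W) : Prop :=
  ∀ σ (i : ℕ), f (p + side σ * (i + 1)) = (S σ).getD i blank

/-- The two parts of a tape after a move to the side `σ`, where `b` is the symbol in the cell that
is left behind. -/
def shiftStacks (b : W) (σ : Bool) (S : Bool → List W) : Bool → List W :=
  fun τ => if τ = σ then (S τ).tail else b :: S τ

theorem shiftStacks_same (b : W) (σ : Bool) : shiftStacks b σ S σ = (S σ).tail := if_pos rfl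

theorem shiftStacks_not (b : W) (σ : Bool) : shiftStacks b σ S (!σ) = b :: S !σ :=
  if_neg (Bool.not_ne_self σ)

theorem TapeRep.write (h : TapeRep blank f p S) (b : W) :
    TapeRep blank (Function.update f p b) p S := by
  intro σ i
  rw [Function.update_of_ne, h]
  cases σ <;> simp [side] <;> omega

theorem TapeRep.scanned (h : TapeRep blank f p S) (σ : Bool) :
    f (p + side σ) = (S σ).headD blank := by
  have hσ := h σ 0
  rwa [Nat.cast_zero, zero_add, mul_one, List.getD_eq_getElem?_getD, ← List.head?_eq_getElem?,
    ← List.headD_eq_head?_getD] at hσ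

theorem TapeRep.shift (h : TapeRep blank f p S) (σ : Bool) :
    TapeRep blank f (p + side σ) (shiftStacks (f p) σ S) := by
  intro τ i
  obtain rfl | rfl : τ = σ ∨ τ = !σ := Bool.eq_or_eq_not τ σ
  · have hpos : p + side τ + side τ * (i + 1) = p + side τ * ((i + 1 : ℕ) + 1) := by
      push_cast
      ring
    rw [shiftStacks_same, hpos, h]
    cases S τ <;> simp
  · have hside : ((side !σ : SignType) : ℤ) = -side σ := by cases σ <;> rfl
    rw [shiftStacks_not]
    cases i with
    | zero => simp [hside]
    | succ i =>
      have hpos : p + side σ + side (!σ) * ((i + 1 : ℕ) + 1) = p + side (!σ) * (i + 1) := by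
        rw [hside]
        push_cast
        ring
      rw [hpos, h, List.getD_cons_succ]

theorem length_shiftStacks_le {s : ℤ} (h : ∀ τ, ((S τ).length : ℤ) ≤ s - side τ * p) {σ : Bool}
    (hlo : -s ≤ p + side σ) (hhi : p + side σ ≤ s) (b : W) (τ : Bool) :
    ((shiftStacks b σ S τ).length : ℤ) ≤ s - side τ * (p + side σ) := by
  have hτ := h τ
  cases σ <;> cases τ <;>
    simp only [shiftStacks, side, cond_true, cond_false, SignType.coe_one, SignType.coe_neg,
      if_true, Bool.false_eq_true, Bool.true_eq_false, if_false, List.length_tail,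
      List.length_cons] at * <;>
    omega

end TapeRep

section TapeRel

variable {α ι W : Type} [DecidableEq ι] {B : ℕ}

/-- Popping the symbol `a`, where the empty stack yields the blank symbol. -/
def PopBlankRel (num : W → ℕ) (w : ℕ) (blank : W) (y : Fin B → ι) (z : ι) (a : W) :
    HeadRel α ι := fun x v v' =>
  PopRel y z w (num a + 1) x v v' ∨ (a = blank ∧ EmptyRel y x v v')

/-- Writing `b` on the tape whose two sides are stored in the heads `y false` and `y true`, and
then moving in the direction `d`, where the symbol `a` is found. -/
def TapeRel (num : W → ℕ) (w : ℕ) (blank : W) (y : Bool → Fin B → ι) (z : ι) (b : W)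
    (d : SignType) (a : W) : HeadRel α ι := fun x v v' =>
  ((d = 0 ∧ a = b) ∧ v' = v) ∨ ∃ σ, d = side σ ∧
    Relation.Comp (PushRel (y !σ) z w (num b + 1) x) (PopBlankRel num w blank (y σ) z a x) v v'

variable {num : W → ℕ} {w c : ℕ} {blank a b : W} {d : SignType} {z : ι} {x : List α}
  {v v' : ι → ℕ}

section Stack

variable {y : Fin B → ι}

theorem implementable_popBlankRel [Nonempty ι] (hw : 0 < w) (hz : ∀ i, y i ≠ z) (a : W) :
    Implementable (PopBlankRel (α := α) num w blank y z a) :=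
  (implementable_popRel hz hw _).union (.guard _ fun _ => implementable_emptyRel y)

theorem StackRep.popBlank (hw : ∀ a, num a < w) (hnum : num.Injective) (hy : y.Injective)
    {l : List W} (h : StackRep num w (v ∘ y) l) (hpop : PopBlankRel num w blank y z a x v v') :
    a = l.headD blank ∧ StackRep num w (v' ∘ y) l.tail := by
  rcases hpop with hpop | ⟨rfl, hempty⟩
  · obtain ⟨l, rfl, hl⟩ := h.pop hw hnum hy hpop
    exact ⟨rfl, hl⟩
  · obtain rfl := h.empty hempty
    rw [hempty.2]
    exact ⟨rfl, h⟩

theorem BalancedStackRep.popBlank (hy : y.Injective) (hc : 0 < c) {l : List W}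
    (h : BalancedStackRep num w c (v ∘ y) l) (hz : v z = 0) :
    ∃ v', PopBlankRel num w blank y z (l.headD blank) x v v' ∧
      BalancedStackRep num w c (v' ∘ y) l.tail := by
  cases l with
  | nil => exact ⟨v, .inr ⟨rfl, h.empty⟩, h⟩
  | cons a l =>
    obtain ⟨v', hpop, hl⟩ := h.pop (x := x) hy hc hz
    exact ⟨v', .inl hpop, hl⟩

theorem PushRel.frame {e : ℕ} (h : PushRel y z w e x v v') {j : ι} (hj : ∀ i, y i ≠ j) :
    v' j = v j := by
  obtain ⟨i, -, -, -, rfl⟩ := h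
  exact Function.update_of_ne (hj i).symm _ _

theorem PopBlankRel.frame (h : PopBlankRel num w blank y z a x v v') {j : ι}
    (hj : ∀ i, y i ≠ j) : v' j = v j := by
  rcases h with ⟨i, -, -, t, -, rfl⟩ | ⟨-, -, rfl⟩
  · exact Function.update_of_ne (hj i).symm _ _
  · rfl

end Stack

variable {y : Bool → Fin B → ι}

theorem implementable_tapeRel [Nonempty ι] (hw : 0 < w) (hz : ∀ σ i, y σ i ≠ z) (b : W)
    (d : SignType) (a : W) : Implementable (TapeRel (α := α) num w blank y z b d a) :=
  (Implementable.guard _ fun _ => .eq).union <| .iUnion fun _ => .guard _ fun _ =>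
    (implementable_pushRel (hz _) _ _).comp (implementable_popBlankRel hw (hz _) _)

theorem TapeRel.frame (h : TapeRel num w blank y z b d a x v v') {j : ι}
    (hj : ∀ σ i, y σ i ≠ j) : v' j = v j := by
  rcases h with ⟨-, rfl⟩ | ⟨σ, -, u, hpush, hpop⟩
  · rfl
  · rw [hpop.frame (hj _), hpush.frame (hj _)]

section Simulation

variable (hy : (Function.uncurry y).Injective)
include hy

omit [DecidableEq ι] in
theorem injective_of_uncurry (σ : Bool) : (y σ).Injective := fun i j hij => by
  simpa using @hy (σ, i) (σ, j) hij

omit [DecidableEq ι] in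
theorem ne_of_uncurry {σ τ : Bool} (h : σ ≠ τ) (i j : Fin B) : y σ i ≠ y τ j := fun hij =>
  h (congrArg Prod.fst (@hy (σ, i) (τ, j) hij))

theorem TapeRel.sound (hw : ∀ a, num a < w) (hnum : num.Injective) {f : ℤ → W} {p : ℤ}
    {S : Bool → List W} (hS : TapeRep blank f p S) (hv : ∀ σ, StackRep num w (v ∘ y σ) (S σ))
    (h : TapeRel num w blank y z b d a x v v') :
    ∃ S', TapeRep blank (Function.update f p b) (p + d) S' ∧
      (∀ σ, StackRep num w (v' ∘ y σ) (S' σ)) ∧ Function.update f p b (p + d) = a := by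
  rcases h with ⟨⟨rfl, rfl⟩, rfl⟩ | ⟨σ, rfl, u, hpush, hpop⟩
  · exact ⟨S, by simpa using hS.write a, hv, by simp⟩
  have hpopped : u ∘ y σ = v ∘ y σ :=
    funext fun i => hpush.frame fun j => ne_of_uncurry hy (Bool.not_ne_self σ) j i
  have hpushed : v' ∘ y (!σ) = u ∘ y !σ :=
    funext fun i => hpop.frame fun j => ne_of_uncurry hy (Bool.not_ne_self σ).symm j i
  obtain ⟨rfl, hσ⟩ :=
    (hpopped ▸ hv σ : StackRep num w (u ∘ y σ) (S σ)).popBlank hw hnum (injective_of_uncurry hy σ)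
      hpop
  refine ⟨shiftStacks b σ S, ?_, fun τ => ?_, (hS.write b).scanned σ⟩
  · simpa only [Function.update_self] using (hS.write b).shift σ
  · obtain rfl | rfl := Bool.eq_or_eq_not τ σ
    · rwa [shiftStacks_same]
    · rw [shiftStacks_not, hpushed]
      exact (hv _).push (injective_of_uncurry hy _) hpush

theorem TapeRel.complete (hw : ∀ a, num a < w) (hz : ∀ σ i, y σ i ≠ z) (hc : 0 < c)
    (hx : (w + 1) ^ c ≤ x.length + 2) {f : ℤ → W} {p s : ℤ} {S : Bool → List W}
    (hS : TapeRep blank f p S) (hs : ∀ σ, ((S σ).length : ℤ) ≤ s - side σ * p)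
    (hl : ∀ σ, (S σ).length < B * c) (hv : ∀ σ, BalancedStackRep num w c (v ∘ y σ) (S σ))
    (hvz : v z = 0) (hlo : -s ≤ p + d) (hhi : p + d ≤ s) :
    ∃ v' S', TapeRel num w blank y z b d (Function.update f p b (p + d)) x v v' ∧
      TapeRep blank (Function.update f p b) (p + d) S' ∧
      (∀ σ, ((S' σ).length : ℤ) ≤ s - side σ * (p + d)) ∧
      ∀ σ, BalancedStackRep num w c (v' ∘ y σ) (S' σ) := by
  obtain rfl | ⟨σ, rfl⟩ := eq_zero_or_eq_side d
  · refine ⟨v, S, .inl ⟨⟨rfl, ?_⟩, rfl⟩, ?_, ?_, hv⟩ <;>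
      simp only [SignType.coe_zero, add_zero, Function.update_self]
    exacts [hS.write b, hs]
  obtain ⟨u, hpush, hpushed⟩ := (hv !σ).push hw (injective_of_uncurry hy _) hc (hl _) hvz hx b
  have hkept : u ∘ y σ = v ∘ y σ :=
    funext fun i => hpush.frame fun j => ne_of_uncurry hy (Bool.not_ne_self σ) j i
  obtain ⟨v', hpop, hpopped⟩ :=
    (hkept ▸ hv σ : BalancedStackRep num w c (u ∘ y σ) (S σ)).popBlank (x := x) (blank := blank)
      (injective_of_uncurry hy σ) hc ((hpush.frame (hz _)).trans hvz)
  have hkept' : v' ∘ y (!σ) = u ∘ y !σ :=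
    funext fun i => hpop.frame fun j => ne_of_uncurry hy (Bool.not_ne_self σ).symm j i
  refine ⟨v', shiftStacks b σ S, .inr ⟨σ, rfl, u, hpush, ?_⟩, ?_,
    length_shiftStacks_le hs hlo hhi b, fun τ => ?_⟩
  · rwa [(hS.write b).scanned σ]
  · simpa only [Function.update_self] using (hS.write b).shift σ
  · obtain rfl | rfl := Bool.eq_or_eq_not τ σ
    · rwa [shiftStacks_same]
    · rwa [shiftStacks_not, hkept']

end Simulation

end TapeRel

/-! ### Relations acting on disjoint groups of heads -/

section Seq

variable {α ι J : Type}

/-- Every head belongs to at most one group, given by `owner`, and `R j` moves only heads of the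
group `j`. -/
def ActsOn (owner : ι → Option J) (R : J → HeadRel α ι) : Prop :=
  ∀ ⦃j x v v'⦄, R j x v v' → ∀ i, owner i ≠ some j → v' i = v i

/-- The property `p j` depends only on the heads of the group `j`. -/
def IsLocal (owner : ι → Option J) (p : J → (ι → ℕ) → Prop) : Prop :=
  ∀ ⦃j v v'⦄, (∀ i, owner i = some j → v' i = v i) → p j v → p j v'

/-- The sequential composition of the relations `R j`, `j ∈ l`. -/
def SeqRel (R : J → HeadRel α ι) : List J → HeadRel α ι
  | [] => fun _ v v' => v' = v
  | j :: l => fun x => Relation.Comp (R j x) (SeqRel R l x)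

theorem implementable_seqRel [DecidableEq ι] [Nonempty ι] {R : J → HeadRel α ι}
    (h : ∀ j, Implementable (R j)) (l : List J) : Implementable (SeqRel R l) := by
  induction l with
  | nil => exact .eq
  | cons j l ih => exact (h j).comp ih

variable {R : J → HeadRel α ι} {owner : ι → Option J} {x : List α} {v v' : ι → ℕ}

theorem ActsOn.eqOn (hR : ActsOn owner R) {j k : J} (hkj : k ≠ j) (h : R j x v v') :
    ∀ i, owner i = some k → v' i = v i := fun i hi =>
  hR h i fun hj => hkj (Option.some.inj (hi.symm.trans hj))

variable {Pre Post : J → (ι → ℕ) → Prop} (hR : ActsOn owner R) (hPre : IsLocal owner Pre)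
  (hPost : IsLocal owner Post) {l : List J} (hl : l.Nodup)
include hR hPre hPost hl

theorem SeqRel.sound (hstep : ∀ j v v', R j x v v' → Pre j v → Post j v')
    (h : SeqRel R l x v v') (hpre : ∀ j ∈ l, Pre j v) (hpost : ∀ j ∉ l, Post j v) (j : J) :
    Post j v' := by
  induction l generalizing v with
  | nil =>
    obtain rfl : v' = v := h
    exact hpost j List.not_mem_nil
  | cons k l ih =>
    obtain ⟨u, hk, h⟩ := h
    rw [List.nodup_cons] at hl
    refine ih hl.2 h (fun j hj => ?_) fun j hj => ?_
    · exact hPre (hR.eqOn (by grind) hk) (hpre j (List.mem_cons_of_mem k hj))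
    · rcases eq_or_ne j k with rfl | hjk
      · exact hstep j v u hk (hpre j List.mem_cons_self)
      · exact hPost (hR.eqOn hjk hk) (hpost j (List.not_mem_cons_of_ne_of_not_mem hjk hj))

theorem SeqRel.complete {Inv : (ι → ℕ) → Prop}
    (hstep : ∀ j v, Inv v → Pre j v → ∃ v', R j x v v' ∧ Inv v' ∧ Post j v') (hv : Inv v)
    (hpre : ∀ j ∈ l, Pre j v) (hpost : ∀ j ∉ l, Post j v) :
    ∃ v', SeqRel R l x v v' ∧ Inv v' ∧ ∀ j, Post j v' := by
  induction l generalizing v with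
  | nil => exact ⟨v, rfl, hv, fun j => hpost j List.not_mem_nil⟩
  | cons k l ih =>
    rw [List.nodup_cons] at hl
    obtain ⟨u, hk, hu, hpostk⟩ := hstep k v hv (hpre k List.mem_cons_self)
    obtain ⟨v', h, hv'⟩ := ih hl.2 hu
      (fun j hj => hPre (hR.eqOn (by grind) hk) (hpre j (List.mem_cons_of_mem k hj))) fun j hj => by
        rcases eq_or_ne j k with rfl | hjk
        · exact hpostk
        · exact hPost (hR.eqOn hjk hk) (hpost j (List.not_mem_cons_of_ne_of_not_mem hjk hj))
    exact ⟨v', ⟨u, hk, h⟩, hv'⟩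

end Seq

/-! ### Machines with several input heads -/

/-- A move of a machine with several input heads and several work tapes. -/
structure MultiMove (State Work Head Tape : Type) where
  next : State
  write : Tape → Work
  headMove : Head → SignType
  tapeMove : Tape → SignType

instance {State Work Head Tape : Type} [Finite State] [Finite Work] [Finite Head] [Finite Tape] :
    Finite (MultiMove State Work Head Tape) :=
  Finite.of_injective (fun m => (m.next, m.write, m.headMove, m.tapeMove)) fun m m' h => by
    cases m
    cases m'
    simpa using h

/-- A nondeterministic machine with finitely many input heads and finitely many work tapes. Unlike
`NTM`, it has several possible start states and accepting states, and accepting states need not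
be halting. -/
structure MultiNTM (α : Type) where
  State : Type
  Work : Type
  Head : Type
  Tape : Type
  finState : Finite State
  finWork : Finite Work
  finHead : Finite Head
  finTape : Finite Tape
  start : Set State
  accept : Set State
  blank : Work
  δ : State → (Head → Option α) → (Tape → Work) → Set (MultiMove State Work Head Tape)

namespace MultiNTM

variable {α : Type} (M : MultiNTM α)

/-- A configuration: the state, the positions of the input heads, and the contents and the head
position of each work tape. -/
structure Config where
  state : M.State
  head : M.Head → ℤ
  work : M.Tape → ℤ → M.Work
  workPos : M.Tape → ℤ

/-- The initial configuration with start state `q`. -/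
def init (q : M.State) : M.Config where
  state := q
  head := fun _ => 0
  work := fun _ _ => M.blank
  workPos := fun _ => 0

variable {M} in
/-- The symbols scanned on the work tapes. -/
def Config.scanned (c : M.Config) (t : M.Tape) : M.Work := c.work t (c.workPos t)

/-- The effect of a move. -/
def apply (c : M.Config) (m : MultiMove M.State M.Work M.Head M.Tape) : M.Config where
  state := m.next
  head := fun h => c.head h + m.headMove h
  work := fun t => Function.update (c.work t) (c.workPos t) (m.write t)
  workPos := fun t => c.workPos t + m.tapeMove t

/-- One computation step on input `x`. -/
def Step (x : List α) (c c' : M.Config) : Prop :=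
  ∃ m ∈ M.δ c.state (fun h => inputSymbol x (c.head h)) c.scanned, c' = M.apply c m

/-- The heads are on the input and the work tape heads within distance `s` from the origin. -/
def Within (x : List α) (s : ℕ) (c : M.Config) : Prop :=
  (∀ h, 0 ≤ c.head h ∧ c.head h ≤ (x.length : ℤ) + 1) ∧
    ∀ t, -(s : ℤ) ≤ c.workPos t ∧ c.workPos t ≤ s

/-- `M` recognizes `L`, and accepts the members of `L` in space `s`. -/
def Recognizes (L : Language α) (s : ℕ → ℕ) : Prop :=
  (∀ x ∈ L, ∃ q ∈ M.start, ∃ c : M.Config, c.state ∈ M.accept ∧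
    Relation.ReflTransGen (fun c c' => M.Step x c c' ∧ M.Within x (s x.length) c')
      (M.init q) c) ∧
  ∀ x, ∀ q ∈ M.start, ∀ c : M.Config, c.state ∈ M.accept →
    Relation.ReflTransGen (M.Step x) (M.init q) c → x ∈ L

/-! ### Simulating machines with several input heads -/

/-- The heads of the simulation: a scratch head, the heads of the machine, and the heads holding
the segments of the two stacks of each tape. -/
abbrev Var (B : ℕ) : Type := Option (M.Head ⊕ M.Tape × Bool × Fin B)

/-- A transition, with the symbols found on the tapes afterwards. -/
structure Transition where
  state : M.State
  scanned : M.Tape → M.Work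
  symbols : M.Head → Option α
  move : MultiMove M.State M.Work M.Head M.Tape
  found : M.Tape → M.Work
  mem : move ∈ M.δ state symbols scanned

instance [Finite α] : Finite M.Transition := by
  have := M.finState
  have := M.finWork
  have := M.finHead
  have := M.finTape
  refine Finite.of_injective
    (fun e : M.Transition => (e.state, e.scanned, e.symbols, e.move, e.found)) fun e e' h => ?_
  cases e
  cases e'
  simpa using h

variable {M} {B : ℕ}

/-- The heads holding the part of the tape `t` on the side `σ`. -/
def seg (t : M.Tape) (σ : Bool) (i : Fin B) : M.Var B := some (.inr (t, σ, i))

theorem seg_injective (t : M.Tape) : (Function.uncurry (seg (B := B) t)).Injective := by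
  rintro ⟨σ, i⟩ ⟨τ, j⟩ h
  simpa [seg] using h

/-- The component of the machine to which a head of the simulation belongs. -/
def owner : M.Var B → Option (M.Head ⊕ M.Tape)
  | none => none
  | some (.inl h) => some (.inl h)
  | some (.inr (t, _, _)) => some (.inr t)

theorem seg_ne {t : M.Tape} {j : M.Var B} (h : owner j ≠ some (.inr t)) (σ : Bool) (i : Fin B) :
    seg t σ i ≠ j := by
  rintro rfl
  exact h rfl

/-- The heads of the simulation represent one component of the configuration `c`; `E` says how a
stack is stored in heads, depending on the displacement of the tape head in its direction. -/
def ComponentRep (E : ℤ → (Fin B → ℕ) → List M.Work → Prop) (c : M.Config) :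
    M.Head ⊕ M.Tape → (M.Var B → ℕ) → Prop
  | .inl h, v => (v (some (.inl h)) : ℤ) = c.head h
  | .inr t, v => ∃ S, TapeRep M.blank (c.work t) (c.workPos t) S ∧
      ∀ σ, E (side σ * c.workPos t) (v ∘ seg t σ) (S σ)

variable {num : M.Work → ℕ} {w k s : ℕ} {x : List α} {c : M.Config}

variable (num w) in
/-- The representation for the soundness of the simulation. -/
abbrev LooseRep : M.Config → M.Head ⊕ M.Tape → (M.Var B → ℕ) → Prop :=
  ComponentRep fun _ => StackRep num w

variable (num w k s) in
/-- The representation for the completeness of the simulation: the stacks end within distance `s`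
from the origin and are cut into segments of length `k`. -/
abbrev TightRep : M.Config → M.Head ⊕ M.Tape → (M.Var B → ℕ) → Prop :=
  ComponentRep fun p u l => (l.length : ℤ) ≤ s - p ∧ BalancedStackRep num w k u l

theorem ComponentRep.init {E : ℤ → (Fin B → ℕ) → List M.Work → Prop}
    (hE : E 0 (fun _ => 0) []) (q : M.State) (j : M.Head ⊕ M.Tape) :
    ComponentRep E (M.init q) j (fun _ => 0) := by
  rcases j with h | t
  · rfl
  · refine ⟨fun _ => [], fun _ _ => rfl, fun σ => ?_⟩
    change E (side σ * 0) (fun _ => 0) []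
    rwa [mul_zero]

theorem isLocal_componentRep (E : ℤ → (Fin B → ℕ) → List M.Work → Prop) (c : M.Config) :
    IsLocal owner (ComponentRep E c) := by
  rintro (h | t) v v' heq hv
  · rwa [ComponentRep, heq (some (.inl h)) rfl]
  · obtain ⟨S, hS, hE⟩ := hv
    refine ⟨S, hS, fun σ => ?_⟩
    rw [show v' ∘ seg t σ = v ∘ seg t σ from funext fun i => heq (seg t σ i) rfl]
    exact hE σ

/-- The configuration `c` agrees with the transition `e` in the input symbols before the move and
the tape symbols after it. -/
def Reads (e : M.Transition) (x : List α) (c : M.Config) : M.Head ⊕ M.Tape → Prop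
  | .inl h => inputSymbol x (c.head h) = e.symbols h
  | .inr t => (M.apply c e.move).scanned t = e.found t

variable [DecidableEq M.Head] [DecidableEq M.Tape]

variable (num w) in
/-- The action of a transition on one component. -/
def ComponentRel (e : M.Transition) : M.Head ⊕ M.Tape → HeadRel α (M.Var B)
  | .inl h => fun x => Relation.Comp
      (fun v v' => inputSymbol x (v (some (.inl h))) = e.symbols h ∧ v' = v)
      (ShiftRel (some (.inl h)) (e.move.headMove h) x)
  | .inr t => TapeRel num w M.blank (seg t) none (e.move.write t) (e.move.tapeMove t) (e.found t)

variable {e : M.Transition}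

theorem implementable_componentRel (hw : 0 < w) (j : M.Head ⊕ M.Tape) :
    Implementable (ComponentRel (B := B) num w e j) := by
  rcases j with h | t
  · exact (Implementable.sym (ι := M.Var B) (some (.inl h)) (e.symbols h)).comp
      (implementable_shiftRel _ _)
  · exact implementable_tapeRel (y := seg t) hw (fun _ _ => Option.some_ne_none _) _ _ _

theorem actsOn_componentRel : ActsOn owner (ComponentRel (B := B) num w e) := by
  rintro (h | t) x v v' hrel i hi
  · obtain ⟨_, ⟨-, rfl⟩, -, -, rfl⟩ := hrel
    refine Function.update_of_ne ?_ _ _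
    rintro rfl
    exact hi rfl
  · exact TapeRel.frame hrel (seg_ne hi)

theorem ComponentRel.sound (hw : ∀ a, num a < w) (hnum : num.Injective) (j : M.Head ⊕ M.Tape)
    (v v' : M.Var B → ℕ) (hrel : ComponentRel num w e j x v v') (hv : LooseRep num w c j v) :
    LooseRep num w (M.apply c e.move) j v' ∧ Reads e x c j := by
  rcases j with h | t
  · obtain ⟨u, ⟨hsym, hu⟩, hlo, -, rfl⟩ := hrel
    subst hu
    replace hv : (u (some (.inl h)) : ℤ) = c.head h := hv
    rw [hv] at hsym hlo
    refine ⟨?_, hsym⟩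
    change ((Function.update u _ _ _ : ℕ) : ℤ) = c.head h + e.move.headMove h
    rw [Function.update_self, hv, Int.toNat_of_nonneg hlo]
  · obtain ⟨S, hS, hE⟩ := hv
    obtain ⟨S', hS', hE', hfound⟩ := TapeRel.sound (seg_injective t) hw hnum hS hE hrel
    exact ⟨⟨S', hS', hE'⟩, hfound⟩

theorem ComponentRel.complete (hw : ∀ a, num a < w) (hk : 0 < k) (hs : 2 * s < B * k)
    (hx : (w + 1) ^ k ≤ x.length + 2) (hc : M.Within x s c) (hc' : M.Within x s (M.apply c e.move))
    (hreads : ∀ j, Reads e x c j) (j : M.Head ⊕ M.Tape) (v : M.Var B → ℕ) (hz : v none = 0)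
    (hv : TightRep num w k s c j v) :
    ∃ v', ComponentRel num w e j x v v' ∧ v' none = 0 ∧
      TightRep num w k s (M.apply c e.move) j v' := by
  rcases j with h | t
  · replace hv : (v (some (.inl h)) : ℤ) = c.head h := hv
    have hsym := hreads (.inl h)
    obtain ⟨hlo, hhi⟩ := hc'.1 h
    simp only [apply, ← hv] at hlo hhi
    refine ⟨_, ⟨v, ⟨by rwa [hv], rfl⟩, hlo, hhi, rfl⟩, ?_, ?_⟩
    · rwa [Function.update_of_ne (by simp)]
    · change ((Function.update v _ _ _ : ℕ) : ℤ) = c.head h + e.move.headMove h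
      rw [Function.update_self, Int.toNat_of_nonneg hlo, hv]
  · obtain ⟨S, hS, hE⟩ := hv
    have hlen : ∀ σ, (S σ).length < B * k := by
      have hpos := hc.2 t
      intro σ
      have hσ := (hE σ).1
      cases σ <;> simp only [side, cond_true, cond_false, SignType.coe_neg, SignType.coe_one] at hσ
        <;> omega
    obtain ⟨v', S', hrel, hS', hs', hE'⟩ := TapeRel.complete (b := e.move.write t)
      (d := e.move.tapeMove t) (seg_injective t) hw (fun _ _ => Option.some_ne_none _) hk hx hS
      (fun σ => (hE σ).1) hlen (fun σ => (hE σ).2) hz (hc'.2 t).1 (hc'.2 t).2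
    have hfound : Function.update (c.work t) (c.workPos t) (e.move.write t)
        (c.workPos t + e.move.tapeMove t) = e.found t := hreads (.inr t)
    rw [hfound] at hrel
    exact ⟨v', hrel, (hrel.frame (seg_ne (by simp [owner]))).trans hz, S', hS',
      fun σ => ⟨hs' σ, hE' σ⟩⟩

variable [Fintype M.Head] [Fintype M.Tape]

variable (num w B) in
/-- The simulation of the computation steps; the nodes are the states together with the scanned
symbols. -/
def SimStep (x : List α) : (M.State × (M.Tape → M.Work)) × (M.Var B → ℕ) →
    (M.State × (M.Tape → M.Work)) × (M.Var B → ℕ) → Prop :=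
  GraphStep (fun e : M.Transition => (e.state, e.scanned)) (fun e => (e.move.next, e.found))
    (fun e => SeqRel (ComponentRel num w e) Finset.univ.toList) x

theorem SimStep.sound (hw : ∀ a, num a < w) (hnum : num.Injective) {q : M.State}
    {b : (M.State × (M.Tape → M.Work)) × (M.Var B → ℕ)}
    (h : Relation.ReflTransGen (SimStep B num w x) ((q, fun _ => M.blank), fun _ => 0) b) :
    ∃ c : M.Config, Relation.ReflTransGen (M.Step x) (M.init q) c ∧ c.state = b.1.1 ∧
      c.scanned = b.1.2 ∧ ∀ j, LooseRep num w c j b.2 := by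
  induction h with
  | refl => exact ⟨_, .refl, rfl, rfl, ComponentRep.init stackRep_nil q⟩
  | @tail b b' _ hb ih =>
    obtain ⟨c, hc, hstate, hscanned, hv⟩ := ih
    obtain ⟨⟨q, a⟩, v⟩ := b
    obtain ⟨⟨q', a'⟩, v'⟩ := b'
    obtain ⟨e, hsrc, htgt, hrel⟩ := hb
    obtain ⟨rfl, rfl⟩ := Prod.mk.inj hsrc
    obtain ⟨rfl, rfl⟩ := Prod.mk.inj htgt
    have hrep := SeqRel.sound (Pre := LooseRep num w c)
      (Post := fun j v => LooseRep num w (M.apply c e.move) j v ∧ Reads e x c j)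
      actsOn_componentRel (isLocal_componentRep _ c)
      (fun j v v' h hv => ⟨isLocal_componentRep _ _ h hv.1, hv.2⟩) (Finset.nodup_toList _)
      (ComponentRel.sound hw hnum) hrel (fun j _ => hv j) (by simp)
    have hsymbols : (fun h => inputSymbol x (c.head h)) = e.symbols :=
      funext fun h => (hrep (.inl h)).2
    refine ⟨_, hc.tail ⟨e.move, ?_, rfl⟩, rfl, funext fun t => (hrep (.inr t)).2,
      fun j => (hrep j).1⟩
    rw [hsymbols, hstate, hscanned]
    exact e.mem

theorem SimStep.complete (hw : ∀ a, num a < w) (hk : 0 < k) (hs : 2 * s < B * k)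
    (hx : (w + 1) ^ k ≤ x.length + 2) {q : M.State}
    (hc : Relation.ReflTransGen (fun c c' => M.Step x c c' ∧ M.Within x s c') (M.init q) c) :
    M.Within x s c ∧ ∃ v, v none = 0 ∧ (∀ j, TightRep num w k s c j v) ∧
      Relation.ReflTransGen (SimStep B num w x) ((q, fun _ => M.blank), fun _ => 0)
        ((c.state, c.scanned), v) := by
  induction hc with
  | refl =>
    refine ⟨⟨fun h => ?_, fun t => ?_⟩, fun _ => 0, rfl,
      ComponentRep.init ⟨by simp, balancedStackRep_nil⟩ q, .refl⟩
    all_goals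
      simp only [init]
      omega
  | @tail c c' _ hstep ih =>
    obtain ⟨hc, v, hz, hv, hreach⟩ := ih
    obtain ⟨⟨m, hm, rfl⟩, hc'⟩ := hstep
    let e : M.Transition := ⟨c.state, c.scanned, fun h => inputSymbol x (c.head h), m,
      (M.apply c m).scanned, hm⟩
    have hreads : ∀ j, Reads e x c j := by rintro (_ | _) <;> rfl
    obtain ⟨v', hrel, hz', hv'⟩ := SeqRel.complete (Inv := fun v => v none = 0)
      (Post := TightRep num w k s (M.apply c m)) actsOn_componentRel
      (isLocal_componentRep _ c) (isLocal_componentRep _ _) (Finset.nodup_toList Finset.univ)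
      (ComponentRel.complete hw hk hs hx hc hc' hreads) hz (fun j _ => hv j) (by simp)
    exact ⟨hc', v', hz', hv', hreach.tail ⟨e, rfl, rfl, hrel⟩⟩

end MultiNTM

theorem exists_segments_of_mem_logBound {s : ℕ → ℕ} (hs : s ∈ logBound) {b : ℕ} (hb : 2 ≤ b) :
    ∃ B n₀ : ℕ, ∀ n ≥ n₀, ∃ k, 0 < k ∧ 2 * s n < B * k ∧ b ^ k ≤ n + 2 := by
  obtain ⟨C, hC⟩ := hs.bound
  obtain ⟨n₀, hn₀⟩ := eventually_atTop.1 hC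
  refine ⟨⌈4 * |C| * Real.log b⌉₊ + 1, max n₀ b, fun n hn => ?_⟩
  obtain ⟨hn, hbn⟩ := max_le_iff.1 hn
  have hk : 0 < Nat.log b (n + 2) := Nat.log_pos (by omega) (by omega)
  refine ⟨Nat.log b (n + 2), hk, ?_, Nat.pow_log_le_self b (by omega)⟩
  set k := Nat.log b (n + 2)
  have hk1 : (1 : ℝ) ≤ k := mod_cast hk
  have : 0 ≤ Real.log b := Real.log_natCast_nonneg b
  have hlogn : 0 ≤ Real.log n := Real.log_natCast_nonneg n
  have hpow : n ≤ b ^ (k + 1) := by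
    have : n + 2 < b ^ (k + 1) := Nat.lt_pow_succ_log_self (by omega) _
    omega
  have hlog : Real.log n ≤ 2 * k * Real.log b :=
    calc Real.log n ≤ Real.log ((b : ℝ) ^ (k + 1)) :=
          Real.log_le_log (by norm_cast; omega) (mod_cast hpow)
      _ = (k + 1) * Real.log b := by rw [Real.log_pow]; push_cast; ring
      _ ≤ 2 * k * Real.log b := by gcongr; linarith
  have hsn : (s n : ℝ) ≤ |C| * Real.log n := by
    have := hn₀ n hn
    rw [Real.norm_of_nonneg (Nat.cast_nonneg _), Real.norm_of_nonneg hlogn] at this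
    exact this.trans (mul_le_mul_of_nonneg_right (le_abs_self C) hlogn)
  have hreal : (2 * s n : ℝ) < ((⌈4 * |C| * Real.log b⌉₊ + 1 : ℕ) : ℝ) * k :=
    calc (2 * s n : ℝ) ≤ 2 * (|C| * (2 * k * Real.log b)) := by gcongr; exact hsn.trans (by gcongr)
      _ = 4 * |C| * Real.log b * k := by ring
      _ < ((⌈4 * |C| * Real.log b⌉₊ + 1 : ℕ) : ℝ) * k := by
        gcongr
        push_cast
        exact (Nat.le_ceil _).trans_lt (lt_add_one _)
  exact_mod_cast hreal

/-- Inputs that are too short for the simulation of work tapes by heads are handled by a finite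
table. -/
theorem MultiNTM.Recognizes.mem_headLanguages {α : Type} [Finite α] {M : MultiNTM α}
    {L : Language α} {s : ℕ → ℕ} (h : M.Recognizes L s) (hs : s ∈ logBound) :
    L ∈ HeadLanguages α := by
  classical
  have := M.finState
  have := M.finWork
  have := M.finHead
  have := M.finTape
  have := Fintype.ofFinite M.Head
  have := Fintype.ofFinite M.Tape
  obtain ⟨w, ⟨f⟩⟩ := Finite.exists_equiv_fin M.Work
  let num : M.Work → ℕ := fun a => f a
  have hw : ∀ a, num a < w := fun a => (f a).2
  have hw0 : 0 < w := Fin.pos (f M.blank)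
  obtain ⟨B, n₀, hB⟩ := exists_segments_of_mem_logBound hs (b := w + 1) (by omega)
  let F : Set (List α) := {y | y ∈ L ∧ y.length < n₀}
  have : Finite F := (List.finite_length_lt α n₀).subset fun y hy => hy.2
  have hsim (q : M.start) (b : {b : M.State × (M.Tape → M.Work) // b.1 ∈ M.accept}) :
      Implementable fun x v v' =>
        Relation.ReflTransGen (SimStep B num w x) ((q.1, fun _ => M.blank), v) (b.1, v') :=
    .graph _ _ (fun e => implementable_seqRel (implementable_componentRel hw0) _) _ _
  refine HeadLanguages.of_implementable ((Implementable.iUnion fun y : F => .drop_eq none y.1).union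
    ((Implementable.le_length none n₀).comp (.iUnion fun q => .iUnion (hsim q))))
    fun x => ⟨fun hx => ?_, ?_⟩
  · by_cases hn : x.length < n₀
    · exact ⟨_, .inl ⟨⟨x, hx, hn⟩, Nat.zero_le _, rfl, rfl⟩⟩
    · obtain ⟨q, hq, c, hc, hreach⟩ := h.1 x hx
      obtain ⟨k, hk, hsk, hwk⟩ := hB x.length (not_lt.1 hn)
      obtain ⟨-, v, -, -, hv⟩ := SimStep.complete hw hk hsk hwk hreach
      exact ⟨v, .inr ⟨_, ⟨by simpa using hn, rfl⟩, ⟨q, hq⟩, ⟨_, hc⟩, hv⟩⟩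
  · rintro ⟨v, ⟨y, -, hy, -⟩ | ⟨_, ⟨-, rfl⟩, q, b, hv⟩⟩
    · rw [List.drop_zero] at hy
      exact hy ▸ y.2.1
    · obtain ⟨c, hc, hstate, -, -⟩ :=
        SimStep.sound hw (Fin.val_injective.comp f.injective) hv
      exact h.2 x q q.2 c (hstate ▸ b.2) hc

/-! ### Visited cells and bounds -/

theorem exists_le_eq_of_between {head : ℕ → ℤ} {t : ℕ} (h0 : head 0 = 0)
    (hstep : ∀ i < t, |head (i + 1) - head i| ≤ 1) {z : ℤ}
    (hz : 0 ≤ z ∧ z ≤ head t ∨ head t ≤ z ∧ z ≤ 0) : ∃ i ≤ t, head i = z := by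
  induction t with
  | zero => exact ⟨0, le_rfl, by omega⟩
  | succ t ih =>
    by_cases hlast : z = head (t + 1)
    · exact ⟨t + 1, le_rfl, hlast.symm⟩
    · have hmove := abs_le.1 (hstep t (by omega))
      obtain ⟨i, hi, hiz⟩ := ih (fun i hi => hstep i (by omega)) (by omega)
      exact ⟨i, by omega, hiz⟩

theorem natAbs_lt_cellsVisited {head : ℕ → ℤ} {t : ℕ} (h0 : head 0 = 0)
    (hstep : ∀ i < t, |head (i + 1) - head i| ≤ 1) : (head t).natAbs < cellsVisited head t := by
  have hsub : Finset.uIcc 0 (head t) ⊆ (Finset.range (t + 1)).image head := fun z hz => by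
    rw [Finset.mem_uIcc, inf_le_iff, le_sup_iff] at hz
    obtain ⟨i, hi, hiz⟩ := exists_le_eq_of_between h0 hstep (z := z) (by omega)
    exact Finset.mem_image.2 ⟨i, Finset.mem_range_succ_iff.2 hi, hiz⟩
  have hcard := Finset.card_le_card hsub
  rwa [Int.card_uIcc, sub_zero] at hcard

theorem abs_signType_le_one (d : SignType) : |(d : ℤ)| ≤ 1 := by
  rcases d with _ | _ | _ <;> decide

theorem mem_consBound_iff {f : ℕ → ℕ} : f ∈ consBound ↔ ∃ C, ∀ n, f n ≤ C := by
  simp only [consBound, Set.mem_ofPred_eq, isBigO_one_nat_atTop_iff, Real.norm_natCast]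
  exact ⟨fun ⟨C, hC⟩ => ⟨⌈C⌉₊, fun n => mod_cast (hC n).trans (Nat.le_ceil C)⟩,
    fun ⟨C, hC⟩ => ⟨C, fun n => mod_cast hC n⟩⟩

theorem consBound_subset_logBound : consBound ⊆ logBound := fun _ hf =>
  IsBigO.trans hf ((Real.isLittleO_const_log_atTop (c := 1)).comp_tendsto
    tendsto_natCast_atTop_atTop).isBigO

/-! ### Nondeterministic Turing machines as machines with one input head -/

namespace NTM

variable {α : Type} {M : NTM α} {x : List α}

theorem IsComputation.mono {c : ℕ → M.Config} {t i : ℕ} (h : M.IsComputation x c t)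
    (hi : i ≤ t) : M.IsComputation x c i :=
  ⟨h.1, fun j hj => h.2 j (by omega)⟩

theorem reflTransGen_iff {d : M.Config} :
    Relation.ReflTransGen (M.Step x) M.init d ↔ ∃ c t, M.IsComputation x c t ∧ c t = d := by
  constructor
  · intro h
    induction h with
    | refl => exact ⟨fun _ => M.init, 0, ⟨rfl, by simp⟩, rfl⟩
    | @tail d d' _ hlast ih =>
      obtain ⟨c, t, ⟨h0, hstep⟩, rfl⟩ := ih
      refine ⟨fun i => if i ≤ t then c i else d', t + 1, ⟨by simpa using h0, fun i hi => ?_⟩,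
        by simp⟩
      rcases Nat.lt_succ_iff_lt_or_eq.1 hi with h | rfl
      · simpa [h.le, Nat.succ_le_of_lt h] using hstep i h
      · simpa using hlast
  · rintro ⟨c, t, hc, rfl⟩
    induction t with
    | zero => rw [hc.1]
    | succ t ih => exact (ih (hc.mono t.le_succ)).tail (hc.2 t t.lt_succ_self)

theorem accepts_iff :
    M.Accepts x ↔ ∃ d, Relation.ReflTransGen (M.Step x) M.init d ∧ d.state = M.accept := by
  simp only [reflTransGen_iff]
  constructor
  · rintro ⟨c, t, hc, hacc⟩
    exact ⟨_, ⟨c, t, hc, rfl⟩, hacc⟩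
  · rintro ⟨_, ⟨c, t, hc, rfl⟩, hacc⟩
    exact ⟨c, t, hc, hacc⟩

theorem SpaceBound.natAbs_workPos_le {s : ℕ → ℕ} (h : M.SpaceBound s) {c : ℕ → M.Config} {t : ℕ}
    (hc : M.IsComputation x c t) (j : Fin M.k) : ((c t).workPos j).natAbs ≤ s x.length := by
  have hstep : ∀ i < t, |(c (i + 1)).workPos j - (c i).workPos j| ≤ 1 := fun i hi => by
    obtain ⟨_, m, _, hm⟩ := hc.2 i hi
    simpa only [hm, add_sub_cancel_left] using abs_signType_le_one _
  have hcells : ((c t).workPos j).natAbs < cellsVisited (fun i => (c i).workPos j) t :=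
    natAbs_lt_cellsVisited (head := fun i => (c i).workPos j) (congrArg (·.workPos j) hc.1) hstep
  have hsum : cellsVisited (fun i => (c i).workPos j) t ≤
      ∑ l : Fin M.k, cellsVisited (fun i => (c i).workPos l) t :=
    Finset.single_le_sum (f := fun l : Fin M.k => cellsVisited (fun i => (c i).workPos l) t)
      (fun _ _ => Nat.zero_le _) (Finset.mem_univ j)
  exact hcells.le.trans (hsum.trans (h x c t hc))

variable (M) in
/-- A Turing machine as a machine with one input head. -/
def toMulti : MultiNTM α where
  State := M.State
  Work := M.Work
  Head := Unit
  Tape := Fin M.k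
  finState := M.finState
  finWork := M.finWork
  finHead := inferInstance
  finTape := inferInstance
  start := {M.start}
  accept := {M.accept}
  blank := M.blank
  δ q σ a := {m | q ≠ M.accept ∧ ∃ m' ∈ M.δ q (σ ()) a,
    m = { next := m'.1, write := m'.2.1, headMove := fun _ => m'.2.2.1, tapeMove := m'.2.2.2 }}

/-- A configuration as a configuration of the machine with one input head. -/
def Config.toMulti (c : M.Config) : M.toMulti.Config where
  state := c.state
  head := fun _ => c.inputPos
  work := c.work
  workPos := c.workPos

theorem Step.toMulti {c c' : M.Config} (h : M.Step x c c') :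
    M.toMulti.Step x c.toMulti c'.toMulti := by
  obtain ⟨hne, m, hm, rfl⟩ := h
  exact ⟨_, ⟨hne, m, hm, rfl⟩, rfl⟩

theorem exists_of_toMulti_step {c : M.Config} {d : M.toMulti.Config}
    (h : M.toMulti.Step x c.toMulti d) : ∃ c', M.Step x c c' ∧ c'.toMulti = d := by
  obtain ⟨_, ⟨hne, m, hm, rfl⟩, rfl⟩ := h
  exact ⟨_, ⟨hne, m, hm, rfl⟩, rfl⟩

theorem IsComputation.toMulti (hstay : M.StaysOnInput) {s : ℕ → ℕ} (hs : M.SpaceBound s)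
    {c : ℕ → M.Config} {t : ℕ} (hc : M.IsComputation x c t) :
    Relation.ReflTransGen (fun c c' => M.toMulti.Step x c c' ∧
      M.toMulti.Within x (s x.length) c') (M.toMulti.init M.start) (c t).toMulti := by
  induction t with
  | zero =>
    rw [hc.1]
    exact .refl
  | succ t ih =>
    refine (ih (hc.mono t.le_succ)).tail ⟨(hc.2 t t.lt_succ_self).toMulti,
      fun _ => hstay x c _ hc, fun j => ?_⟩
    have hpos : ((c (t + 1)).workPos j).natAbs ≤ s x.length := hs.natAbs_workPos_le hc j
    change -(s x.length : ℤ) ≤ (c (t + 1)).workPos j ∧ (c (t + 1)).workPos j ≤ s x.length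
    omega

theorem exists_of_toMulti_reflTransGen {d : M.toMulti.Config}
    (h : Relation.ReflTransGen (M.toMulti.Step x) (M.toMulti.init M.start) d) :
    ∃ c, Relation.ReflTransGen (M.Step x) M.init c ∧ c.toMulti = d := by
  induction h with
  | refl => exact ⟨_, .refl, rfl⟩
  | tail _ hstep ih =>
    obtain ⟨c, hc, rfl⟩ := ih
    obtain ⟨c', hstep', rfl⟩ := exists_of_toMulti_step hstep
    exact ⟨c', hc.tail hstep', rfl⟩

theorem toMulti_recognizes {L : Language α} {s : ℕ → ℕ} (hstay : M.StaysOnInput)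
    (hs : M.SpaceBound s) (hL : ∀ x, x ∈ L ↔ M.Accepts x) : M.toMulti.Recognizes L s := by
  refine ⟨fun x hx => ?_, ?_⟩
  · obtain ⟨c, t, hc, hacc⟩ := (hL x).1 hx
    exact ⟨M.start, rfl, (c t).toMulti, hacc, hc.toMulti hstay hs⟩
  · rintro x _ rfl d hacc hd
    obtain ⟨_, hreach, rfl⟩ := exists_of_toMulti_reflTransGen hd
    obtain ⟨c, t, hc, rfl⟩ := reflTransGen_iff.1 hreach
    exact (hL x).2 ⟨c, t, hc, hacc⟩

end NTM

theorem NL_subset_headLanguages (α : Type) [Finite α] : NL α ⊆ HeadLanguages α := by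
  rintro L ⟨M, hstay, ⟨s, hs, hspace⟩, hL⟩
  exact (NTM.toMulti_recognizes hstay hspace hL).mem_headLanguages hs

/-! ### Constantly many coins -/

/-- The coin sequence that extends a finite one by `false`. -/
def extendCoins {r : ℕ} (u : Fin r → Bool) (i : ℕ) : Bool := if h : i < r then u ⟨i, h⟩ else false

theorem extendCoins_apply {r : ℕ} (u : Fin r → Bool) (i : Fin r) : extendCoins u i = u i := by
  simp [extendCoins]

theorem restrict_eq_iff_mem_pi {r : ℕ} {u : Fin r → Bool} {ω : ℕ → Bool} :
    (fun i : Fin r => ω i) = u ↔ ω ∈ Set.pi (Finset.range r) fun i => {extendCoins u i} := by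
  simp only [Set.mem_pi, Finset.coe_range, Set.mem_Iio, Set.mem_singleton_iff]
  refine ⟨?_, fun h => funext fun i => (h i i.2).trans (extendCoins_apply u i)⟩
  rintro rfl i hi
  rw [extendCoins, dif_pos hi]

theorem coinMeasure_cylinder {r : ℕ} (S : Set (Fin r → Bool)) :
    coinMeasure.real {ω | (fun i : Fin r => ω i) ∈ S} = S.ncard / 2 ^ r := by
  classical
  have : IsProbabilityMeasure coinMeasure := by
    unfold coinMeasure
    infer_instance
  have measure_eq : ∀ u : Fin r → Bool,
      coinMeasure.real {ω : ℕ → Bool | (fun i : Fin r => ω i) = u} = 1 / 2 ^ r := fun u => by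
    simp only [restrict_eq_iff_mem_pi, Set.ofPred_mem_eq]
    rw [measureReal_def, coinMeasure, Measure.infinitePi_pi _ (fun i _ => .of_discrete)]
    simp
  have hunion : {ω : ℕ → Bool | (fun i : Fin r => ω i) ∈ S} =
      ⋃ u ∈ S.toFinite.toFinset, {ω : ℕ → Bool | (fun i : Fin r => ω i) = u} := by
    ext ω
    simp
  rw [hunion, measureReal_biUnion_finset]
  · simp only [measure_eq, Finset.sum_const, nsmul_eq_mul, mul_one_div]
    rw [Set.ncard_eq_toFinset_card S]
  · intro u _ u' _ hne
    exact Set.disjoint_left.2 fun ω hu hu' => hne (hu.symm.trans hu')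
  · intro u _
    simp only [restrict_eq_iff_mem_pi, Set.ofPred_mem_eq]
    exact MeasurableSet.pi (Finset.countable_toSet _) fun i _ => .of_discrete

namespace Verifier

variable {α : Type} (V : Verifier α)

theorem run_succ (P : Prover α V.Comm) (x : List α) (ω : ℕ → Bool) (t : ℕ) :
    V.run P x ω (t + 1) = V.step P x ω (V.run P x ω t) := by
  rw [run, run, Function.iterate_succ_apply']

theorem step_congr {P P' : Prover α V.Comm} {x : List α} {ω ω' : ℕ → Bool} {c : V.Config}
    (hω : (∃ q, c.state = .coin q) → ω c.coins = ω' c.coins)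
    (hP : V.msg c.state ≠ V.null →
      P x c.history (V.msg c.state) = P' x c.history (V.msg c.state)) :
    V.step P x ω c = V.step P' x ω' c := by
  have hreceived : V.received P x c = V.received P' x c := by
    unfold received
    split_ifs with h
    · rfl
    · exact hP h
  have hhistory : V.newHistory P x c = V.newHistory P' x c := by
    unfold newHistory
    split_ifs with h
    · rfl
    · rw [hP h]
  unfold step
  rw [hreceived, hhistory]
  split
  case h_1 q hq => rw [hω ⟨q, hq⟩]
  all_goals rfl

theorem run_congr {P : Prover α V.Comm} {x : List α} {ω ω' : ℕ → Bool} {r : ℕ}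
    (hr : ∀ t, (V.run P x ω t).coins ≤ r) (h : ∀ i < r, ω i = ω' i) (t : ℕ) :
    V.run P x ω t = V.run P x ω' t := by
  induction t with
  | zero => rfl
  | succ t ih =>
    rw [run_succ, run_succ, ← ih]
    refine V.step_congr ?_ fun _ => rfl
    rintro ⟨q, hq⟩
    have htoss := hr (t + 1)
    rw [run_succ, step, hq] at htoss
    exact h _ htoss

theorem run_eq_of_halt {P : Prover α V.Comm} {x : List α} {ω : ℕ → Bool} {t t' : ℕ} (h : t ≤ t')
    (hq : (V.run P x ω t).state = .accept ∨ (V.run P x ω t).state = .reject) :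
    V.run P x ω t' = V.run P x ω t := by
  induction t', h using Nat.le_induction with
  | base => rfl
  | succ t' _ ih =>
    rw [run_succ, ih]
    rcases hq with hq | hq <;> rw [step, hq]

theorem probability_eq {P : Prover α V.Comm} {x : List α} {r : ℕ}
    (hr : ∀ ω t, (V.run P x ω t).coins ≤ r) (q : VState V.R V.D) :
    coinMeasure.real {ω | ∃ t, (V.run P x ω t).state = q} =
      {u : Fin r → Bool | ∃ t, (V.run P x (extendCoins u) t).state = q}.ncard / 2 ^ r := by
  rw [← coinMeasure_cylinder]
  congr 1
  ext ω
  have hrun : ∀ t, V.run P x ω t = V.run P x (extendCoins fun i : Fin r => ω i) t :=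
    V.run_congr (hr ω) fun i hi => by rw [extendCoins, dif_pos hi]
  simp only [Set.mem_ofPred_eq, hrun]

theorem acceptProb_add_rejectProb_le_one {P : Prover α V.Comm} {x : List α} {r : ℕ}
    (hr : ∀ ω t, (V.run P x ω t).coins ≤ r) : V.acceptProb P x + V.rejectProb P x ≤ 1 := by
  rw [acceptProb, rejectProb, V.probability_eq hr, V.probability_eq hr, ← add_div,
    div_le_one (by positivity), ← Nat.cast_add, ← Set.ncard_union_eq]
  · refine mod_cast (Set.ncard_le_card _).trans_eq ?_
    rw [Nat.card_fun, Nat.card_eq_fintype_card, Nat.card_eq_fintype_card, Fintype.card_bool,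
      Fintype.card_fin]
  · refine Set.disjoint_left.2 ?_
    rintro u ⟨t, ht⟩ ⟨t', ht'⟩
    rcases le_total t t' with h | h
    · rw [V.run_eq_of_halt h (.inl ht), ht] at ht'
      cases ht'
    · rw [V.run_eq_of_halt h (.inr ht'), ht'] at ht
      cases ht

end Verifier

/-! ### One-way provers as provers that are sent a single symbol -/

namespace Prover

variable {α Γ : Type}

/-- The communication of a prover who is sent the symbol `m` all the time. -/
def muteHistory (P : Prover α Γ) (m : Γ) (x : List α) : ℕ → List (Γ × Γ)
  | 0 => []
  | i + 1 => muteHistory P m x i ++ [(m, P x (muteHistory P m x i) m)]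

/-- The sequence of the responses of a prover who is sent the symbol `m` all the time. -/
def muteSequence (P : Prover α Γ) (m : Γ) (x : List α) (i : ℕ) : Γ :=
  P x (muteHistory P m x i) m

theorem length_muteHistory (P : Prover α Γ) (m : Γ) (x : List α) (i : ℕ) :
    (P.muteHistory m x i).length = i := by
  induction i with
  | zero => rfl
  | succ i ih => simp [muteHistory, ih]

theorem muteSequence_ofSequence (c : List α → ℕ → Γ) (m : Γ) :
    (Prover.ofSequence c).muteSequence m = c := by
  funext x i
  rw [muteSequence, ofSequence, length_muteHistory]

end Prover

namespace Verifier

variable {α : Type} (V : Verifier α)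

open Classical in
/-- The verifier that sends `m` whenever `V` communicates. -/
noncomputable abbrev mute (m : V.Comm) : Verifier α :=
  { V with msg := fun q => if V.msg q = V.null then V.null else m }

theorem mute_run {m : V.Comm} (hm : ∀ q, V.msg q ≠ V.null → m ≠ V.null) (P : Prover α V.Comm)
    (x : List α) (ω : ℕ → Bool) (t : ℕ) :
    (V.mute m).run P x ω t =
      { state := (V.run (.ofSequence (P.muteSequence m)) x ω t).state
        inputPos := (V.run (.ofSequence (P.muteSequence m)) x ω t).inputPos
        work := (V.run (.ofSequence (P.muteSequence m)) x ω t).work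
        workPos := (V.run (.ofSequence (P.muteSequence m)) x ω t).workPos
        history := P.muteHistory m x (V.run (.ofSequence (P.muteSequence m)) x ω t).history.length
        coins := (V.run (.ofSequence (P.muteSequence m)) x ω t).coins } := by
  induction t with
  | zero => rfl
  | succ t ih =>
    rw [run_succ, run_succ, ih]
    generalize V.run (.ofSequence (P.muteSequence m)) x ω t = c
    unfold step
    by_cases hnull : V.msg c.state = V.null
    · rcases hc : c.state with q | q | _ | _ <;> rw [hc] at hnull <;>
        simp [hc, hnull, received, newHistory, apply]
    · have hm' := hm _ hnull
      rcases hc : c.state with q | q | _ | _ <;> rw [hc] at hnull <;>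
        simp [hc, hnull, hm', received, newHistory, apply, Prover.ofSequence, Prover.muteSequence,
          Prover.muteHistory]

theorem mute_acceptProb {m : V.Comm} (hm : ∀ q, V.msg q ≠ V.null → m ≠ V.null)
    (P : Prover α V.Comm) (x : List α) :
    (V.mute m).acceptProb P x = V.acceptProb (.ofSequence (P.muteSequence m)) x := by
  simp only [acceptProb, V.mute_run hm]

theorem Restricted.mute {V : Verifier α} {S C : Set (ℕ → ℕ)}
    (h : V.Restricted (onewayProvers α V.Comm) S C) {m : V.Comm}
    (hm : ∀ q, V.msg q ≠ V.null → m ≠ V.null) : (V.mute m).Restricted Set.univ S C := by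
  obtain ⟨hstay, ⟨s, hs, hspace⟩, r, hr, hcoins⟩ := h
  refine ⟨fun P _ x ω t => ?_, ⟨s, hs, fun P _ x ω t => ?_⟩, r, hr, fun P _ x ω t => ?_⟩
  all_goals simp only [V.mute_run hm]
  · exact hstay _ ⟨_, rfl⟩ x ω t
  · exact hspace _ ⟨_, rfl⟩ x ω t
  · exact hcoins _ ⟨_, rfl⟩ x ω t

theorem Restricted.mono {V : Verifier α} {provers : Set (Prover α V.Comm)} {S S' C : Set (ℕ → ℕ)}
    (h : V.Restricted provers S C) (hS : S ⊆ S') : V.Restricted provers S' C :=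
  ⟨h.1, h.2.1.imp fun _ hs => ⟨hS hs.1, hs.2⟩, h.2.2⟩

end Verifier

theorem onewayIP_subset_weakIP (α : Type) :
    onewayIP α consBound consBound ⊆ weakIP α logBound consBound := by
  rintro L ⟨V, hV, ε, hε, ⟨_, ⟨c, rfl⟩, haccept⟩, hreject⟩
  obtain ⟨m, hm⟩ : ∃ m, ∀ q, V.msg q ≠ V.null → m ≠ V.null := by
    by_cases h : ∃ q, V.msg q ≠ V.null
    · obtain ⟨q, hq⟩ := h
      exact ⟨_, fun _ _ => hq⟩
    · exact ⟨V.null, fun q hq => (h ⟨q, hq⟩).elim⟩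
  refine ⟨V.mute m, (hV.mute hm).mono consBound_subset_logBound, ε, hε,
    ⟨.ofSequence c, trivial, fun x hx => ?_⟩, fun x hx P _ => ?_⟩
  · rw [V.mute_acceptProb hm, Prover.muteSequence_ofSequence]
    exact haccept x hx
  · rw [V.mute_acceptProb hm]
    obtain ⟨-, -, r, -, hcoins⟩ := hV
    have hsum := V.acceptProb_add_rejectProb_le_one (hcoins _ ⟨P.muteSequence m, rfl⟩ x)
    have := hreject x hx _ ⟨P.muteSequence m, rfl⟩
    linarith

/-! ### Simulating all coin outcomes of a verifier in parallel -/

instance {R D : Type} [Finite R] [Finite D] : Finite (VState R D) := by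
  refine Finite.of_surjective
    (fun a : R ⊕ D ⊕ Bool => match a with
      | .inl q => VState.coin q
      | .inr (.inl q) => VState.det q
      | .inr (.inr true) => VState.accept
      | .inr (.inr false) => VState.reject) ?_
  rintro (q | q | _ | _)
  exacts [⟨.inl q, rfl⟩, ⟨.inr (.inl q), rfl⟩, ⟨.inr (.inr true), rfl⟩, ⟨.inr (.inr false), rfl⟩]

/-- The number of coins tossed in a step from the state `q`. -/
def VState.tosses {R D : Type} : VState R D → ℕ
  | .coin _ => 1
  | _ => 0

namespace Verifier

variable {α : Type} (V : Verifier α) (r : ℕ)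

/-- The outcomes of `r` coin tosses for which the interaction with `P` on `x` is accepting. -/
def acceptingCoins (P : Prover α V.Comm) (x : List α) : Set (Fin r → Bool) :=
  {u | ∃ t, (V.run P x (extendCoins u) t).state = .accept}

variable {r} in
theorem half_lt_acceptProb_iff {P : Prover α V.Comm} {x : List α}
    (hr : ∀ ω t, (V.run P x ω t).coins ≤ r) :
    1 / 2 < V.acceptProb P x ↔ 2 ^ r < 2 * (V.acceptingCoins r P x).ncard := by
  rw [acceptProb, V.probability_eq hr, div_lt_div_iff₀ two_pos (by positivity), one_mul,
    mul_comm, acceptingCoins]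
  norm_cast

/-- The state of the parallel simulation: the simulated coin outcomes, the state and the number of
tossed coins for each of them, and a relation that identifies outcomes with the same
communication. -/
structure SimState where
  sel : Set (Fin r → Bool)
  state : (Fin r → Bool) → VState V.R V.D
  coins : (Fin r → Bool) → Fin (r + 1)
  same : (Fin r → Bool) → (Fin r → Bool) → Prop

instance : Finite (V.SimState r) := by
  have := V.finR
  have := V.finD
  refine Finite.of_injective (fun s : V.SimState r => (s.sel, s.state, s.coins, s.same)) ?_
  rintro ⟨_, _, _, _⟩ ⟨_, _, _, _⟩ h
  simpa using h

open Classical in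
/-- The move of the verifier in the state `q` upon the response `g`. -/
noncomputable def move (q : VState V.R V.D) (o : Option α) (a : V.Work) (g : V.Comm) (b : Bool) :
    VState V.R V.D × V.Work × SignType × SignType :=
  match q with
  | .coin q => V.δcoin q o a (if V.msg (.coin q) = V.null then V.null else g) b
  | .det q => V.δdet q o a (if V.msg (.det q) = V.null then V.null else g)
  | .accept => (.accept, a, 0, 0)
  | .reject => (.reject, a, 0, 0)

variable {V r}

theorem apply_stay (c : V.Config) :
    V.apply c (c.state, c.work c.workPos, 0, 0) c.history c.coins = c := by
  simp [apply]

theorem step_eq_move (x : List α) (ω : ℕ → Bool) (c : V.Config) (g : V.Comm) :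
    ∃ h, V.step (fun _ _ _ => g) x ω c = V.apply c
      (V.move c.state (inputSymbol x c.inputPos) (c.work c.workPos) g (ω c.coins)) h
      (c.coins + c.state.tosses) := by
  obtain ⟨q, p, f, p', h, n⟩ := c
  rcases q with q | q | _ | _
  · exact ⟨_, rfl⟩
  · exact ⟨_, rfl⟩
  · exact ⟨h, (apply_stay _).symm⟩
  · exact ⟨h, (apply_stay _).symm⟩

theorem history_step {x : List α} {ω : ℕ → Bool} {c : V.Config} {P : Prover α V.Comm}
    (haccept : c.state ≠ .accept) (hreject : c.state ≠ .reject) :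
    (V.step P x ω c).history = V.newHistory P x c := by
  rcases hc : c.state with q | q | _ | _
  · simp [step, hc, apply]
  · simp [step, hc, apply]
  · exact (haccept hc).elim
  · exact (hreject hc).elim

namespace SimState

variable {s : V.SimState r} {u u' : Fin r → Bool} {γ : (Fin r → Bool) → V.Comm}

/-- The selected outcome `u` has not halted. -/
def Active (s : V.SimState r) (u : Fin r → Bool) : Prop :=
  u ∈ s.sel ∧ s.state u ≠ .accept ∧ s.state u ≠ .reject

/-- All active outcomes are ready to communicate. -/
def Ready (s : V.SimState r) : Prop := ∀ u, s.Active u → V.msg (s.state u) ≠ V.null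

/-- The outcomes for which the next step is carried out. Outcomes that are ready to communicate
wait for the others, so that all of them have the same number of communications. -/
def Moving (s : V.SimState r) (u : Fin r → Bool) : Prop :=
  s.Active u ∧ (s.Ready ∨ V.msg (s.state u) = V.null)

/-- The guessed responses `γ` are functions of the communication. -/
def Consistent (s : V.SimState r) (γ : (Fin r → Bool) → V.Comm) : Prop :=
  s.Ready → ∀ u u', s.Active u → s.Active u' → s.same u u' →
    V.msg (s.state u) = V.msg (s.state u') → γ u = γ u'

theorem exists_moving (h : ∃ u, s.Active u) : ∃ u, s.Moving u := by
  by_cases hready : s.Ready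
  · exact h.imp fun u hu => ⟨hu, .inl hready⟩
  · simp only [Ready, not_forall, not_not] at hready
    obtain ⟨u, hu, hnull⟩ := hready
    exact ⟨u, hu, .inr hnull⟩

open Classical in
/-- The move of the verifier for the outcome `u`; outcomes that wait do not move. -/
noncomputable def moveOf (s : V.SimState r) (σ : (Fin r → Bool) → Option α)
    (a : (Fin r → Bool) → V.Work) (γ : (Fin r → Bool) → V.Comm) (u : Fin r → Bool) :
    VState V.R V.D × V.Work × SignType × SignType :=
  if s.Moving u then V.move (s.state u) (σ u) (a u) (γ u) (extendCoins u (s.coins u))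
  else (s.state u, a u, 0, 0)

open Classical in
/-- The number of coins tossed in the next step for the outcome `u`. -/
noncomputable def tosses (s : V.SimState r) (u : Fin r → Bool) : ℕ :=
  if s.Moving u then (s.state u).tosses else 0

/-- The move of the simulation in which the responses are `γ`. -/
noncomputable def next (s : V.SimState r) (σ : (Fin r → Bool) → Option α)
    (a : (Fin r → Bool) → V.Work) (γ : (Fin r → Bool) → V.Comm) :
    MultiMove (V.SimState r) V.Work (Fin r → Bool) (Fin r → Bool) where
  next :=
    { sel := s.sel
      state := fun u => (s.moveOf σ a γ u).1
      coins := fun u => Fin.ofNat (r + 1) (s.coins u + s.tosses u)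
      same := fun u u' => s.same u u' ∧ (s.Ready → V.msg (s.state u) = V.msg (s.state u')) }
  write u := (s.moveOf σ a γ u).2.1
  headMove u := (s.moveOf σ a γ u).2.2.1
  tapeMove u := (s.moveOf σ a γ u).2.2.2

theorem Active.of_next {σ : (Fin r → Bool) → Option α} {a : (Fin r → Bool) → V.Work}
    (h : (s.next σ a γ).next.Active u) : s.Active u := by
  by_cases hmove : s.Moving u
  · exact hmove.1
  · simpa only [Active, next, moveOf, if_neg hmove] using h

open Classical in
/-- The configurations of the verifier after a move of the simulation. -/
noncomputable def advance (s : V.SimState r) (x : List α) (d : (Fin r → Bool) → V.Config)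
    (γ : (Fin r → Bool) → V.Comm) (u : Fin r → Bool) : V.Config :=
  if s.Moving u then V.step (fun _ _ _ => γ u) x (extendCoins u) (d u) else d u

variable {x : List α} {d : (Fin r → Bool) → V.Config}

theorem history_advance_of_ready (hd : (d u).state = s.state u) (hu : s.Active u) (h : s.Ready) :
    (s.advance x d γ u).history = (d u).history ++ [(V.msg (s.state u), γ u)] := by
  rw [advance, if_pos ⟨hu, .inl h⟩, history_step (hd ▸ hu.2.1) (hd ▸ hu.2.2), newHistory, hd,
    if_neg (h u hu)]

theorem history_advance_of_not_ready (hd : (d u).state = s.state u) (hu : s.Active u)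
    (h : ¬s.Ready) : (s.advance x d γ u).history = (d u).history := by
  by_cases hmove : s.Moving u
  · rw [advance, if_pos hmove, history_step (hd ▸ hu.2.1) (hd ▸ hu.2.2), newHistory, hd,
      if_pos (hmove.2.resolve_left h)]
  · rw [advance, if_neg hmove]

open Classical in
theorem advance_run {P : Prover α V.Comm} {t : ℕ} (ht : V.run P x (extendCoins u) t = d u)
    (hP : s.Moving u → V.msg (d u).state ≠ V.null →
      P x (d u).history (V.msg (d u).state) = γ u) :
    s.advance x d γ u = V.run P x (extendCoins u) (if s.Moving u then t + 1 else t) := by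
  unfold advance
  split_ifs with hmove
  · rw [run_succ, ht]
    exact V.step_congr (fun _ => rfl) fun hne => (hP hmove hne).symm
  · exact ht.symm

end SimState

variable (V r) in
/-- The machine that simulates the verifier for the majority of the outcomes of `r` coin tosses. -/
noncomputable abbrev toMulti : MultiNTM α where
  State := V.SimState r
  Work := V.Work
  Head := Fin r → Bool
  Tape := Fin r → Bool
  finState := inferInstance
  finWork := V.finWork
  finHead := inferInstance
  finTape := inferInstance
  start := {s | 2 ^ r < 2 * s.sel.ncard ∧ s.state = (fun _ => V.start) ∧ s.coins = (fun _ => 0) ∧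
    s.same = fun _ _ => True}
  accept := {s | ∀ u ∈ s.sel, s.state u = .accept}
  blank := V.blank
  δ s σ a := {m | ∃ γ, s.Consistent γ ∧ m = s.next σ a γ}

/-- The state of a configuration of the simulation. -/
abbrev simState (c : (V.toMulti r).Config) : V.SimState r := c.state

/-- The configuration of the simulation after a step with the responses `γ`. -/
noncomputable abbrev simNext (x : List α) (c : (V.toMulti r).Config)
    (γ : (Fin r → Bool) → V.Comm) : (V.toMulti r).Config :=
  (V.toMulti r).apply c ((simState c).next (fun u => inputSymbol x (c.head u)) c.scanned γ)

/-- The configuration of the simulation represents the configurations `d u` of the verifier. -/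
structure Corr (c : (V.toMulti r).Config) (d : (Fin r → Bool) → V.Config) : Prop where
  state : ∀ u, (simState c).state u = (d u).state
  coins : ∀ u, ((simState c).coins u : ℕ) = (d u).coins
  head : ∀ u, c.head u = (d u).inputPos
  work : ∀ u, c.work u = (d u).work
  workPos : ∀ u, c.workPos u = (d u).workPos

namespace Corr

variable {c : (V.toMulti r).Config} {d : (Fin r → Bool) → V.Config} {x : List α}
  {γ : (Fin r → Bool) → V.Comm}

theorem init {q : V.SimState r} (hq : q ∈ (V.toMulti r).start) :
    Corr ((V.toMulti r).init q) fun _ => V.init := by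
  obtain ⟨-, hstate, hcoins, -⟩ := hq
  exact ⟨congrFun hstate, fun u => congrArg Fin.val (congrFun hcoins u), fun _ => rfl,
    fun _ => rfl, fun _ => rfl⟩

theorem advance_eq (h : Corr c d) (x : List α) (γ : (Fin r → Bool) → V.Comm)
    (u : Fin r → Bool) :
    ∃ l, (simState c).advance x d γ u = V.apply (d u)
      ((simState c).moveOf (fun u => inputSymbol x (c.head u)) c.scanned γ u) l
      ((d u).coins + (simState c).tosses u) := by
  unfold SimState.advance SimState.moveOf SimState.tosses MultiNTM.Config.scanned
  simp only [h.state, h.coins, h.head, h.work, h.workPos]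
  split_ifs
  · exact step_eq_move x _ (d u) (γ u)
  · exact ⟨_, (apply_stay (d u)).symm⟩

theorem next (h : Corr c d) (hr : ∀ u, ((simState c).advance x d γ u).coins ≤ r) :
    Corr (simNext x c γ) ((simState c).advance x d γ) := by
  choose l hl using h.advance_eq x γ
  constructor <;> intro u <;> rw [hl]
  · rfl
  · have hle := hr u
    rw [hl] at hle
    change ((simState c).coins u + (simState c).tosses u) % (r + 1) =
      (d u).coins + (simState c).tosses u
    rw [h.coins]
    exact Nat.mod_eq_of_lt (Nat.lt_succ_of_le hle)
  · exact congrArg (· + _) (h.head u)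
  · change Function.update (c.work u) (c.workPos u) _ = Function.update _ _ _
    rw [h.work, h.workPos]
    rfl
  · exact congrArg (· + _) (h.workPos u)

end Corr

/-- The run of the simulation that ends in `c` is the interaction with every prover that agrees
with `P` on the first `k` communications. -/
structure Interacts (x : List α) (c : (V.toMulti r).Config) (d : (Fin r → Bool) → V.Config)
    (P : Prover α V.Comm) (k : ℕ) : Prop where
  corr : Corr c d
  run : ∀ P' : Prover α V.Comm, (∀ y h m, h.length < k → P' y h m = P y h m) →
    ∀ u ∈ (simState c).sel, ∃ t, V.run P' x (extendCoins u) t = d u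
  length : ∀ u, (simState c).Active u → (d u).history.length = k
  same : ∀ u u', (simState c).Active u → (simState c).Active u' →
    (d u).history = (d u').history → (simState c).same u u'

namespace Interacts

variable {c : (V.toMulti r).Config} {d : (Fin r → Bool) → V.Config} {x : List α}
  {γ : (Fin r → Bool) → V.Comm} {P : Prover α V.Comm} {k : ℕ}

open Classical in
theorem exists_prover (h : Interacts x c d P k) (hγ : (simState c).Consistent γ) :
    ∃ P' : Prover α V.Comm, (∀ y l m, l.length < k → P' y l m = P y l m) ∧
      ∀ P'' : Prover α V.Comm,
        (∀ y l m, l.length < (if (simState c).Ready then k + 1 else k) → P'' y l m = P' y l m) →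
        ∀ u, (simState c).Moving u → V.msg (d u).state ≠ V.null →
          P'' x (d u).history (V.msg (d u).state) = γ u := by
  by_cases hready : (simState c).Ready
  · let query : {u // (simState c).Active u} → List (V.Comm × V.Comm) × V.Comm :=
      fun u => ((d u).history, V.msg (d u).state)
    have hfactors : (fun u : {u // (simState c).Active u} => γ u).FactorsThrough query := by
      intro u u' heq
      obtain ⟨hhistory, hmsg⟩ := Prod.mk.inj heq
      refine hγ hready u u' u.2 u'.2 (h.same u u' u.2 u'.2 hhistory) ?_
      rwa [h.corr.state, h.corr.state]
    refine ⟨fun y l m => Function.extend query (fun u => γ u) (fun p => P y p.1 p.2) (l, m),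
      fun y l m hl => Function.extend_apply' _ _ _ ?_, fun P'' hP'' u hu _ => ?_⟩
    · rintro ⟨u, hu⟩
      exact hl.ne ((congrArg (·.1.length) hu).symm.trans (h.length u u.2))
    · rw [hP'' _ _ _ (by rw [h.length u hu.1, if_pos hready]; exact k.lt_succ_self)]
      exact hfactors.extend_apply _ ⟨u, hu.1⟩
  · refine ⟨P, fun _ _ _ _ => rfl, fun P'' _ u hu hne => (hne ?_).elim⟩
    rw [← h.corr.state]
    exact hu.2.resolve_left hready

open Classical in
theorem length_history_advance (h : Interacts x c d P k) {u : Fin r → Bool}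
    (hu : (simState c).Active u) : ((simState c).advance x d γ u).history.length =
      if (simState c).Ready then k + 1 else k := by
  split_ifs with hready
  · rw [SimState.history_advance_of_ready (h.corr.state u).symm hu hready, List.length_append,
      h.length u hu, List.length_singleton]
  · rw [SimState.history_advance_of_not_ready (h.corr.state u).symm hu hready, h.length u hu]

theorem same_next (h : Interacts x c d P k) {u u' : Fin r → Bool} (hu : (simState c).Active u)
    (hu' : (simState c).Active u')
    (heq : ((simState c).advance x d γ u).history = ((simState c).advance x d γ u').history) :
    (simState (simNext x c γ)).same u u' := by
  have hstate := fun u => (h.corr.state u).symm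
  by_cases hready : (simState c).Ready
  · rw [SimState.history_advance_of_ready (hstate u) hu hready,
      SimState.history_advance_of_ready (hstate u') hu' hready] at heq
    obtain ⟨hhistory, hlast⟩ := List.append_inj' heq rfl
    exact ⟨h.same u u' hu hu' hhistory, fun _ => (Prod.mk.inj (List.singleton_inj.1 hlast)).1⟩
  · rw [SimState.history_advance_of_not_ready (hstate u) hu hready,
      SimState.history_advance_of_not_ready (hstate u') hu' hready] at heq
    exact ⟨h.same u u' hu hu' heq, fun h => (hready h).elim⟩

theorem next (hcoin : ∀ P ω t, (V.run P x ω t).coins ≤ r) (h : Interacts x c d P k)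
    (hγ : (simState c).Consistent γ) :
    ∃ P' k', Interacts x (simNext x c γ) ((simState c).advance x d γ) P' k' := by
  classical
  obtain ⟨P', hP', hresponse⟩ := h.exists_prover hγ
  have hrun : ∀ P'' : Prover α V.Comm,
      (∀ y l m, l.length < (if (simState c).Ready then k + 1 else k) → P'' y l m = P' y l m) →
      ∀ u ∈ (simState c).sel,
        ∃ t, V.run P'' x (extendCoins u) t = (simState c).advance x d γ u := by
    intro P'' hP'' u hu
    obtain ⟨t, ht⟩ := h.run P'' (fun y l m hl =>
      (hP'' y l m (hl.trans_le (by split_ifs <;> omega))).trans (hP' y l m hl)) u hu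
    exact ⟨_, (SimState.advance_run ht (hresponse P'' hP'' u)).symm⟩
  refine ⟨P', _, h.corr.next fun u => ?_, hrun,
    fun u hu => h.length_history_advance hu.of_next,
    fun u u' hu hu' => h.same_next hu.of_next hu'.of_next⟩
  by_cases hu : u ∈ (simState c).sel
  · obtain ⟨t, ht⟩ := hrun P' (fun _ _ _ _ => rfl) u hu
    exact ht ▸ hcoin _ _ _
  · rw [SimState.advance, if_neg fun hmove => hu hmove.1.1, ← h.corr.coins]
    exact Nat.le_of_lt_succ (Fin.is_lt _)

end Interacts

theorem toMulti_sound {x : List α} (hcoin : ∀ P ω t, (V.run P x ω t).coins ≤ r) {q : V.SimState r}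
    (hq : q ∈ (V.toMulti r).start) {c : (V.toMulti r).Config}
    (h : Relation.ReflTransGen ((V.toMulti r).Step x) ((V.toMulti r).init q) c) :
    (simState c).sel = q.sel ∧ ∃ d P k, Interacts x c d P k := by
  induction h with
  | refl =>
    refine ⟨rfl, _, fun _ _ _ => V.null, 0, Corr.init hq, fun _ _ u _ => ⟨0, rfl⟩,
      fun _ _ => rfl, fun u u' _ _ _ => ?_⟩
    change q.same u u'
    rw [hq.2.2.2]
    trivial
  | tail _ hstep ih =>
    obtain ⟨hsel, d, P, k, hd⟩ := ih
    obtain ⟨_, ⟨γ, hγ, rfl⟩, rfl⟩ := hstep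
    exact ⟨hsel, _, hd.next hcoin hγ⟩

/-- The configuration `c` of the simulation represents the interaction with `P` after `t u` steps
for each outcome `u`. -/
structure Tracks (P : Prover α V.Comm) (x : List α) (c : (V.toMulti r).Config)
    (t : (Fin r → Bool) → ℕ) : Prop where
  corr : Corr c fun u => V.run P x (extendCoins u) (t u)
  same : ∀ u u', (simState c).Active u → (simState c).Active u' → (simState c).same u u' →
    (V.run P x (extendCoins u) (t u)).history = (V.run P x (extendCoins u') (t u')).history

namespace Tracks

variable {c : (V.toMulti r).Config} {x : List α} {P : Prover α V.Comm} {t T : (Fin r → Bool) → ℕ}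

theorem mem_accept (h : Tracks P x c t) (hactive : ¬∃ u, (simState c).Active u)
    (hT : ∀ u ∈ (simState c).sel, (V.run P x (extendCoins u) (T u)).state = .accept) :
    c.state ∈ (V.toMulti r).accept := by
  intro u hu
  have hhalt : (simState c).state u = .accept ∨ (simState c).state u = .reject := by
    by_contra hne
    exact hactive ⟨u, hu, not_or.1 hne⟩
  rw [h.corr.state] at hhalt ⊢
  rcases le_total (t u) (T u) with hle | hle
  · rw [← V.run_eq_of_halt hle hhalt, hT u hu]
  · rw [V.run_eq_of_halt hle (.inl (hT u hu)), hT u hu]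

theorem lt_of_active (h : Tracks P x c t)
    (hT : ∀ u ∈ (simState c).sel, (V.run P x (extendCoins u) (T u)).state = .accept)
    {u : Fin r → Bool} (hu : (simState c).Active u) : t u < T u := by
  by_contra hle
  refine hu.2.1 ?_
  rw [h.corr.state, V.run_eq_of_halt (not_lt.1 hle) (.inl (hT u hu.1)), hT u hu.1]

open Classical in
theorem next (h : Tracks P x c t) (hcoin : ∀ ω t, (V.run P x ω t).coins ≤ r) :
    ∃ c', (V.toMulti r).Step x c c' ∧ (simState c').sel = (simState c).sel ∧
      Tracks P x c' fun u => if (simState c).Moving u then t u + 1 else t u := by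
  let d : (Fin r → Bool) → V.Config := fun u => V.run P x (extendCoins u) (t u)
  let γ : (Fin r → Bool) → V.Comm := fun u => P x (d u).history (V.msg (d u).state)
  have hγ : (simState c).Consistent γ := by
    intro _ u u' hu hu' hsame hmsg
    rw [h.corr.state, h.corr.state] at hmsg
    exact congrArg₂ (P x) (h.same u u' hu hu' hsame) hmsg
  have hadvance : (simState c).advance x d γ = fun u =>
      V.run P x (extendCoins u) (if (simState c).Moving u then t u + 1 else t u) :=
    funext fun u => SimState.advance_run rfl fun _ _ => rfl
  have hcorr := h.corr.next (x := x) (γ := γ) fun u => by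
    rw [hadvance]
    exact hcoin _ _
  rw [hadvance] at hcorr
  refine ⟨simNext x c γ, ⟨_, ⟨γ, hγ, rfl⟩, rfl⟩, rfl, hcorr, fun u u' hu hu' hsame => ?_⟩
  replace hu := hu.of_next
  replace hu' := hu'.of_next
  obtain ⟨hsame, hmsg⟩ := hsame
  have hhistory : (d u).history = (d u').history := h.same u u' hu hu' hsame
  have hstate := fun u => (h.corr.state u).symm
  rw [← congrFun hadvance u, ← congrFun hadvance u']
  by_cases hready : (simState c).Ready
  · rw [SimState.history_advance_of_ready (hstate u) hu hready,
      SimState.history_advance_of_ready (hstate u') hu' hready, hhistory, hmsg hready,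
      hγ hready u u' hu hu' hsame (hmsg hready)]
  · rw [SimState.history_advance_of_not_ready (hstate u) hu hready,
      SimState.history_advance_of_not_ready (hstate u') hu' hready, hhistory]

end Tracks

theorem toMulti_complete {x : List α} {P : Prover α V.Comm} {b : ℕ}
    (hcoin : ∀ ω t, (V.run P x ω t).coins ≤ r)
    (hin : ∀ ω t, 0 ≤ (V.run P x ω t).inputPos ∧ (V.run P x ω t).inputPos ≤ (x.length : ℤ) + 1)
    (hwork : ∀ ω t, (V.run P x ω t).workPos.natAbs ≤ b) {T t : (Fin r → Bool) → ℕ}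
    {c : (V.toMulti r).Config} (h : Tracks P x c t)
    (hT : ∀ u ∈ (simState c).sel, (V.run P x (extendCoins u) (T u)).state = .accept) :
    ∃ c' : (V.toMulti r).Config, c'.state ∈ (V.toMulti r).accept ∧
      Relation.ReflTransGen (fun c c' => (V.toMulti r).Step x c c' ∧ (V.toMulti r).Within x b c')
        c c' := by
  classical
  induction hn : ∑ u, (T u - t u) using Nat.strong_induction_on generalizing c t with
  | _ n ih =>
    by_cases hactive : ∃ u, (simState c).Active u
    · obtain ⟨c', hstep, hsel, h'⟩ := h.next hcoin
      have hdecrease : ∑ u, (T u - if (simState c).Moving u then t u + 1 else t u) <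
          ∑ u, (T u - t u) := by
        obtain ⟨u, hu⟩ := SimState.exists_moving hactive
        refine Finset.sum_lt_sum (fun u _ => by split_ifs <;> omega) ⟨u, Finset.mem_univ u, ?_⟩
        have := h.lt_of_active hT hu.1
        rw [if_pos hu]
        omega
      have hwithin : (V.toMulti r).Within x b c' := by
        refine ⟨fun u => h'.corr.head u ▸ hin _ _, fun u => ?_⟩
        have := h'.corr.workPos u ▸ hwork (extendCoins u) _
        omega
      obtain ⟨c'', haccept, hreach⟩ := ih _ (hn ▸ hdecrease) h' (hsel ▸ hT) rfl
      exact ⟨c'', haccept, hreach.head ⟨hstep, hwithin⟩⟩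
    · exact ⟨c, h.mem_accept hactive hT, .refl⟩

theorem abs_workPos_step (P : Prover α V.Comm) (x : List α) (ω : ℕ → Bool) (c : V.Config) :
    |(V.step P x ω c).workPos - c.workPos| ≤ 1 := by
  unfold step
  split
  case h_1 | h_2 =>
    simp only [apply, add_sub_cancel_left]
    exact abs_signType_le_one _
  all_goals simp only [sub_self, abs_zero, zero_le_one]

theorem SpaceBound.natAbs_workPos_le {provers : Set (Prover α V.Comm)} {s : ℕ → ℕ}
    (h : V.SpaceBound provers s) {P : Prover α V.Comm} (hP : P ∈ provers) (x : List α)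
    (ω : ℕ → Bool) (t : ℕ) : (V.run P x ω t).workPos.natAbs ≤ s x.length := by
  refine le_trans (natAbs_lt_cellsVisited (head := fun i => (V.run P x ω i).workPos) rfl
    fun i _ => ?_).le (h P hP x ω t)
  rw [V.run_succ]
  exact abs_workPos_step P x ω _

theorem toMulti_recognizes {L : Language α} {s : ℕ → ℕ} {ε : ℝ} (hε : ε < 1 / 2)
    (hstay : V.StaysOnInput Set.univ) (hs : V.SpaceBound Set.univ s)
    (hcoin : ∀ P x ω t, (V.run P x ω t).coins ≤ r) (hL : V.WeakIPS Set.univ L ε) :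
    (V.toMulti r).Recognizes L s := by
  obtain ⟨⟨P, -, hmem⟩, hnotMem⟩ := hL
  refine ⟨fun x hx => ?_, fun x q hq c hc hreach => ?_⟩
  · have hmajority : 2 ^ r < 2 * (V.acceptingCoins r P x).ncard :=
      (V.half_lt_acceptProb_iff (hcoin P x)).1 (by linarith [hmem x hx])
    let q : V.SimState r := ⟨V.acceptingCoins r P x, fun _ => V.start, fun _ => 0, fun _ _ => True⟩
    have hq : q ∈ (V.toMulti r).start := ⟨hmajority, rfl, rfl, rfl⟩
    have hT : ∀ u, ∃ t, u ∈ V.acceptingCoins r P x →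
        (V.run P x (extendCoins u) t).state = .accept := fun u => by
      by_cases hu : u ∈ V.acceptingCoins r P x
      · exact hu.imp fun t ht _ => ht
      · exact ⟨0, fun h => (hu h).elim⟩
    choose T hT using hT
    exact ⟨q, hq, toMulti_complete (hcoin P x) (hstay P trivial x)
      (hs.natAbs_workPos_le trivial x) (t := fun _ => 0) ⟨Corr.init hq, fun _ _ _ _ _ => rfl⟩ hT⟩
  · obtain ⟨hsel, d, P, k, hd⟩ := toMulti_sound (fun P => hcoin P x) hq hreach
    by_contra hx
    have hsub : q.sel ⊆ V.acceptingCoins r P x := fun u hu => by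
      obtain ⟨t, ht⟩ := hd.run P (fun _ _ _ _ => rfl) u (hsel ▸ hu)
      exact ⟨t, by rw [ht, ← hd.corr.state]; exact hc u (hsel ▸ hu)⟩
    have hmajority : 2 ^ r < 2 * (V.acceptingCoins r P x).ncard :=
      hq.1.trans_le (Nat.mul_le_mul_left 2 (Set.ncard_le_ncard hsub))
    have := (V.half_lt_acceptProb_iff (hcoin P x)).2 hmajority
    linarith [hnotMem x hx P trivial]

end Verifier

theorem weakIP_subset_headLanguages (α : Type) [Finite α] :
    weakIP α logBound consBound ⊆ HeadLanguages α := by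
  rintro L ⟨V, ⟨hstay, ⟨s, hs, hspace⟩, f, hf, hcoins⟩, ε, hε, hL⟩
  obtain ⟨r, hr⟩ := mem_consBound_iff.1 hf
  exact (Verifier.toMulti_recognizes hε hstay hspace
    (fun P x ω t => (hcoins P trivial x ω t).trans (hr _)) hL).mem_headLanguages hs

/-! ### Heads between end-markers that look alike -/

theorem inputSymbol_eq_none {α : Type} {x : List α} {p : ℕ} (hp : p ≤ x.length + 1) :
    inputSymbol x p = none ↔ p = 0 ∨ p = x.length + 1 := by
  cases p with
  | zero => simp [inputSymbol]
  | succ p =>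
    rw [inputSymbol_succ, List.getElem?_eq_none_iff]
    omega

/-- The flag `b` of a head at `p` tells the end-markers apart: the head is not on the left one if
`b` is `true`, and not on the right one if `b` is `false`. -/
def FlagOK (n : ℕ) (b : Bool) (p : ℕ) : Prop :=
  p ≤ n + 1 ∧ (b = true → 0 < p) ∧ (b = false → p ≤ n)

open Classical in
/-- The new flag and the movement of a head that carries out an operation, `none` if the operation
is impossible. -/
noncomputable def HeadOp.flagStep {α : Type} (op : HeadOp α) (b : Bool) (o : Option α) :
    Option (Bool × SignType) :=
  match op with
  | .nop => some (b, 0)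
  | .inc => if o = none ∧ b = true then none else some (true, 1)
  | .dec => if o = none ∧ b = false then none else some (false, -1)
  | .zero => if o = none ∧ b = false then some (b, 0) else none
  | .sym o' => if o = o' then some (b, 0) else none

section

variable {α : Type} {x : List α}

theorem FlagOK.none_and_true_iff {b : Bool} {p : ℕ} (h : FlagOK x.length b p) :
    inputSymbol x p = none ∧ b = true ↔ p = x.length + 1 := by
  rw [inputSymbol_eq_none h.1]
  grind [FlagOK]

theorem FlagOK.none_and_false_iff {b : Bool} {p : ℕ} (h : FlagOK x.length b p) :
    inputSymbol x p = none ∧ b = false ↔ p = 0 := by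
  rw [inputSymbol_eq_none h.1]
  grind [FlagOK]

theorem HeadOp.exec_of_flagStep {op : HeadOp α} {b b' : Bool} {p : ℕ} {d : SignType}
    (h : FlagOK x.length b p) (hstep : op.flagStep b (inputSymbol x p) = some (b', d)) :
    ∃ p' : ℕ, op.Exec x p p' ∧ (p' : ℤ) = p + d ∧ FlagOK x.length b' p' := by
  have hp := h.1
  cases op with
  | nop =>
    obtain ⟨rfl, rfl⟩ := Prod.mk.inj (Option.some.inj hstep)
    exact ⟨p, rfl, by simp, h⟩
  | inc =>
    simp only [flagStep, h.none_and_true_iff, Option.ite_none_left_eq_some, Option.some.injEq,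
      Prod.mk.injEq] at hstep
    obtain ⟨hne, rfl, rfl⟩ := hstep
    exact ⟨p + 1, ⟨by omega, rfl⟩, by simp, by omega, by simp, by simp⟩
  | dec =>
    simp only [flagStep, h.none_and_false_iff, Option.ite_none_left_eq_some, Option.some.injEq,
      Prod.mk.injEq] at hstep
    obtain ⟨hne, rfl, rfl⟩ := hstep
    obtain ⟨p', rfl⟩ := Nat.exists_eq_succ_of_ne_zero hne
    exact ⟨p', rfl, by simp, by omega, by simp, fun _ => by omega⟩
  | zero =>
    simp only [flagStep, h.none_and_false_iff, Option.ite_none_right_eq_some, Option.some.injEq,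
      Prod.mk.injEq] at hstep
    obtain ⟨rfl, rfl, rfl⟩ := hstep
    exact ⟨0, ⟨rfl, rfl⟩, by simp, h⟩
  | sym o =>
    simp only [flagStep, Option.ite_none_right_eq_some, Option.some.injEq, Prod.mk.injEq] at hstep
    obtain ⟨ho, rfl, rfl⟩ := hstep
    exact ⟨p, ⟨ho, rfl⟩, by simp, h⟩

theorem HeadOp.Exec.exists_flagStep {op : HeadOp α} {b : Bool} {p p' : ℕ} (hop : op.Exec x p p')
    (h : FlagOK x.length b p) :
    ∃ b' d, op.flagStep b (inputSymbol x p) = some (b', d) ∧ (p' : ℤ) = p + (d : ℤ) ∧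
      FlagOK x.length b' p' := by
  have hp := h.1
  cases op with
  | nop =>
    obtain rfl : p' = p := hop
    exact ⟨b, 0, rfl, by simp, h⟩
  | inc =>
    obtain ⟨hle, rfl⟩ := hop
    refine ⟨true, 1, ?_, by simp, by omega, by simp, by simp⟩
    simp only [flagStep, h.none_and_true_iff]
    exact if_neg (by omega)
  | dec =>
    obtain rfl : p = p' + 1 := hop
    refine ⟨false, -1, ?_, by simp, by omega, by simp, by omega⟩
    simp only [flagStep, h.none_and_false_iff]
    exact if_neg (by omega)
  | zero =>
    obtain ⟨rfl, rfl⟩ := hop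
    refine ⟨b, 0, ?_, by simp, h⟩
    simp only [flagStep, h.none_and_false_iff, if_true]
  | sym o =>
    obtain ⟨ho, rfl⟩ := hop
    exact ⟨b, 0, if_pos ho, by simp, h⟩

/-! ### Digits of a clock -/

/-- The change of a digit with largest value `n + 1` when a number is incremented. The ordering
compares the position of the digit with that of the first digit that is not maximal. -/
def DigitStep (n : ℕ) : Ordering → ℕ → ℕ → Prop
  | .lt, c, c' => c = n + 1 ∧ c' = 0
  | .eq, c, c' => c ≤ n ∧ c' = c + 1
  | .gt, c, c' => c' = c

/-- A head that runs to and fro between the end-markers holds a digit `c`. The flags tell whether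
the head runs to the left and whether the digit is zero. -/
def ClockOK (n : ℕ) (f : Bool × Bool) (p c : ℕ) : Prop :=
  c ≤ n + 1 ∧ (f.1 = false → p = c) ∧ (f.1 = true → p + c = n + 1) ∧ (f.2 = true ↔ c = 0)

open Classical in
/-- The new flags and the movement of the head that holds a digit, `none` if the digit may not
change in this way. A digit is reset by turning the head. -/
noncomputable def clockStep (f : Bool × Bool) (o : Option α) :
    Ordering → Option ((Bool × Bool) × SignType)
  | .lt => if o = none ∧ f.2 = false then some ((!f.1, true), 0) else none
  | .eq => if o = none ∧ f.2 = false then none else some ((f.1, false), if f.1 then -1 else 1)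
  | .gt => some (f, 0)

theorem ClockOK.le {f : Bool × Bool} {p c n : ℕ} (h : ClockOK n f p c) : p ≤ n + 1 := by
  obtain ⟨hc, hright, hleft, -⟩ := h
  rcases hf : f.1
  · exact (hright hf).trans_le hc
  · have := hleft hf
    omega

theorem ClockOK.none_and_false_iff {f : Bool × Bool} {p c : ℕ} (h : ClockOK x.length f p c) :
    inputSymbol x p = none ∧ f.2 = false ↔ c = x.length + 1 := by
  rw [inputSymbol_eq_none h.le]
  grind [ClockOK]

theorem digitStep_of_clockStep {f f' : Bool × Bool} {p c : ℕ} {a : Ordering} {d : SignType}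
    (h : ClockOK x.length f p c) (hstep : clockStep f (inputSymbol x p) a = some (f', d)) :
    ∃ p' c' : ℕ, DigitStep x.length a c c' ∧ (p' : ℤ) = p + d ∧ ClockOK x.length f' p' c' := by
  cases a with
  | lt =>
    simp only [clockStep, h.none_and_false_iff, Option.ite_none_right_eq_some, Option.some.injEq,
      Prod.mk.injEq] at hstep
    obtain ⟨hmax, rfl, rfl⟩ := hstep
    exact ⟨p, 0, ⟨hmax, rfl⟩, by simp, by grind [ClockOK]⟩
  | eq =>
    simp only [clockStep, h.none_and_false_iff, Option.ite_none_left_eq_some, Option.some.injEq,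
      Prod.mk.injEq] at hstep
    obtain ⟨hne, rfl, rfl⟩ := hstep
    have hc : c ≤ x.length := by grind [ClockOK]
    cases hleft : f.1
    · exact ⟨p + 1, c + 1, ⟨hc, rfl⟩, by simp, by grind [ClockOK]⟩
    · exact ⟨p - 1, c + 1, ⟨hc, rfl⟩, by simp; grind [ClockOK], by grind [ClockOK]⟩
  | gt =>
    obtain ⟨rfl, rfl⟩ := Prod.mk.inj (Option.some.inj hstep)
    exact ⟨p, c, rfl, by simp, h⟩

theorem DigitStep.unique {n c c' c'' : ℕ} {a : Ordering} (h : DigitStep n a c c')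
    (h' : DigitStep n a c c'') : c' = c'' := by
  cases a
  · exact h.2.trans h'.2.symm
  · exact h.2.trans h'.2.symm
  · exact h.trans (Eq.symm h')

theorem DigitStep.exists_clockStep {f : Bool × Bool} {p c c' : ℕ} {a : Ordering}
    (hdigit : DigitStep x.length a c c') (h : ClockOK x.length f p c) :
    ∃ (f' : Bool × Bool) (d : SignType) (p' : ℕ), clockStep f (inputSymbol x p) a = some (f', d) ∧
      (p' : ℤ) = p + (d : ℤ) ∧ ClockOK x.length f' p' c' := by
  have hsome : ∃ m, clockStep f (inputSymbol x p) a = some m := by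
    cases a with
    | lt => exact ⟨_, if_pos (h.none_and_false_iff.2 hdigit.1)⟩
    | eq =>
      refine ⟨_, if_neg fun hmax => ?_⟩
      exact (hdigit.1.trans_lt x.length.lt_succ_self).ne (h.none_and_false_iff.1 hmax)
    | gt => exact ⟨_, rfl⟩
  obtain ⟨⟨f', d⟩, hstep⟩ := hsome
  obtain ⟨p', c'', hdigit', hp', h'⟩ := digitStep_of_clockStep h hstep
  exact ⟨f', d, p', hstep, hp', hdigit.unique hdigit' ▸ h'⟩

end

theorem toColex_lt_of_digitStep {n m : ℕ} {a a' : Fin m → Fin (n + 2)} {τ : Fin m}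
    (h : ∀ j, DigitStep n (compare j τ) (a j) (a' j)) : toColex a < toColex a' := by
  refine ⟨τ, fun j hj => ?_, ?_⟩
  · have := h j
    rw [compare_gt_iff_gt.2 hj] at this
    exact Fin.ext (Eq.symm this)
  · have := h τ
    rw [compare_eq_iff_eq.2 rfl] at this
    exact Fin.lt_def.2 (this.2 ▸ Nat.lt_succ_self _)

theorem digitStep_mod_of_dvd {n c : ℕ} (h : n + 2 ∣ c + 1) :
    DigitStep n .lt (c % (n + 2)) ((c + 1) % (n + 2)) := by
  have hzero := Nat.mod_eq_zero_of_dvd h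
  exact ⟨Nat.succ_mod_succ_eq_zero_iff.1 hzero, hzero⟩

theorem digitStep_mod_of_not_dvd {n c : ℕ} (h : ¬n + 2 ∣ c + 1) :
    DigitStep n .eq (c % (n + 2)) ((c + 1) % (n + 2)) := by
  have hlt : c % (n + 2) < n + 2 := Nat.mod_lt c (by omega)
  have hne : c % (n + 2) ≠ n + 1 := fun hmax =>
    h (Nat.dvd_of_mod_eq_zero (Nat.succ_mod_succ_eq_zero_iff.2 hmax))
  refine ⟨by omega, ?_⟩
  rw [Nat.add_mod_of_add_mod_lt] <;> rw [Nat.mod_eq_of_lt (by omega : 1 < n + 2)]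
  omega

theorem exists_digitStep_succ {n m t : ℕ} (ht : t + 1 < (n + 2) ^ m) :
    ∃ τ : Fin m, ∀ j : Fin m, DigitStep n (compare j τ) (t / (n + 2) ^ (j : ℕ) % (n + 2))
      ((t + 1) / (n + 2) ^ (j : ℕ) % (n + 2)) := by
  obtain ⟨e, s, hs, hes⟩ := Nat.exists_eq_pow_mul_and_not_dvd t.succ_ne_zero (n + 2) (by omega)
  replace hes : t + 1 = (n + 2) ^ e * s := hes
  have hdvd : (n + 2) ^ e ∣ t + 1 := ⟨s, hes⟩
  have hem : e < m := (Nat.pow_lt_pow_iff_right (by omega)).1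
    ((Nat.le_of_dvd t.succ_pos hdvd).trans_lt ht)
  refine ⟨⟨e, hem⟩, fun j => ?_⟩
  rcases lt_trichotomy (j : ℕ) e with hj | hj | hj
  · have hnext : (n + 2) ^ (j : ℕ) * (n + 2) ∣ t + 1 := (pow_dvd_pow _ hj).trans hdvd
    have hsucc := Nat.succ_div_of_dvd (dvd_of_mul_right_dvd hnext)
    rw [compare_lt_iff_lt.2 (Fin.lt_def.2 hj), hsucc]
    exact digitStep_mod_of_dvd (hsucc ▸ Nat.dvd_div_of_mul_dvd hnext)
  · have hsucc := Nat.succ_div_of_dvd hdvd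
    rw [compare_eq_iff_eq.2 (Fin.ext hj), hj, hsucc]
    refine digitStep_mod_of_not_dvd ?_
    rwa [← hsucc, hes, Nat.mul_div_cancel_left s (by positivity)]
  · have hnot : ¬(n + 2) ^ (j : ℕ) ∣ t + 1 := fun h => by
      have := (pow_dvd_pow (n + 2) hj).trans h
      rw [hes, pow_succ] at this
      exact hs (Nat.dvd_of_mul_dvd_mul_left (by positivity) this)
    rw [compare_gt_iff_gt.2 (Fin.lt_def.2 hj), Nat.succ_div_of_not_dvd hnot]
    rfl

/-! ### Verifying the computation of a head program -/

theorem exists_injOn_path {X : Type} {r : X → X → Prop} {a b : X}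
    (h : Relation.ReflTransGen r a b) :
    ∃ (l : ℕ) (f : ℕ → X), f 0 = a ∧ f l = b ∧ (∀ i < l, r (f i) (f (i + 1))) ∧
      Set.InjOn f (Set.Iic l) := by
  induction h using Relation.ReflTransGen.head_induction_on with
  | refl => exact ⟨0, fun _ => b, rfl, rfl, by simp, by simp [Set.InjOn]⟩
  | @head a a' hstep _ ih =>
    obtain ⟨l, f, rfl, rfl, hf, hinj⟩ := ih
    by_cases hmem : ∃ i ≤ l, f i = a
    · obtain ⟨i, hi, rfl⟩ := hmem
      refine ⟨l - i, fun j => f (j + i), by simp, by simp [hi], fun j hj => ?_,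
        fun j hj j' hj' heq => ?_⟩
      · simpa only [add_right_comm] using hf (j + i) (by omega)
      · simp only [Set.mem_Iic] at hj hj'
        exact Nat.add_right_cancel (hinj (by simp; omega) (by simp; omega) heq)
    · push Not at hmem
      refine ⟨l + 1, fun i => i.casesOn a f, rfl, rfl, fun i hi => ?_, fun i hi j hj heq => ?_⟩
      · cases i with
        | zero => exact hstep
        | succ i => exact hf i (by omega)
      · simp only [Set.mem_Iic] at hi hj
        cases i <;> cases j
        · rfl
        · exact (hmem _ (by omega) (Eq.symm heq)).elim
        · exact (hmem _ (by omega) heq).elim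
        · exact congrArg _ (hinj (by simp; omega) (by simp; omega) heq)

theorem succ_two_pow_le_ncard {r : ℕ} {A : Set (Fin (r + 1) → Bool)}
    {w : Fin (r + 1) → Bool} {f : (Fin r → Bool) → Fin (r + 1) → Bool} (hw : w ∈ A)
    (hf : ∀ v, f v ∈ A) (hinj : f.Injective) (hne : ∀ v, f v ≠ w) : 2 ^ r + 1 ≤ A.ncard := by
  have hcard : (Set.range f).ncard = 2 ^ r := by
    rw [← Nat.card_coe_set_eq, Nat.card_range_of_injective hinj, Nat.card_fun]
    simp
  rw [← hcard, ← Set.ncard_insert_of_notMem (a := w) (by simpa using hne)]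
  exact Set.ncard_le_ncard (Set.insert_subset hw (Set.range_subset_iff.2 hf))

/-- A random choice of a test, or of none: a test is chosen for one outcome more than half of them,
and each test is chosen for at least two outcomes. -/
theorem exists_selection (T : Type) [Finite T] [Nonempty T] :
    ∃ (r : ℕ) (sel : (Fin (r + 1) → Bool) → Option T),
      2 ^ r + 1 ≤ {u | ∃ τ, sel u = some τ}.ncard ∧
      ∀ τ, 2 ^ r + 1 ≤ {u | sel u = none ∨ sel u = some τ}.ncard := by
  classical
  obtain ⟨r, hr⟩ : ∃ r, Nat.card (T × Bool) ≤ 2 ^ r := ⟨_, Nat.lt_two_pow_self.le⟩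
  obtain ⟨e⟩ : Nonempty (T × Bool ↪ (Fin r → Bool)) := by
    have := Fintype.ofFinite T
    refine Function.Embedding.nonempty_of_card_le ?_
    rw [Fintype.card_fun, ← Nat.card_eq_fintype_card]
    simpa using hr
  let test : (Fin r → Bool) → T := fun w => (Function.invFun e w).1
  have htest : ∀ p, test (e p) = p.1 := fun p =>
    congrArg Prod.fst (Function.leftInverse_invFun e.injective p)
  let w₀ : Fin r → Bool := fun _ => false
  refine ⟨r, fun u => if u 0 = true ∨ Fin.tail u = w₀ then some (test (Fin.tail u)) else none,
    ?_, fun τ => ?_⟩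
  · refine succ_two_pow_le_ncard (w := Fin.cons false w₀) (f := fun v => Fin.cons true v) ?_ ?_
      (fun v v' h => ?_) fun v h => ?_
    · exact ⟨_, if_pos (Or.inr (Fin.tail_cons _ _))⟩
    · exact fun v => ⟨_, if_pos (Or.inl (Fin.cons_zero _ _))⟩
    · exact (Fin.cons_inj.1 h).2
    · simpa using congrFun h 0
  · refine succ_two_pow_le_ncard (w := Fin.cons true (e (τ, false)))
      (f := fun v => if v = w₀ then Fin.cons true (e (τ, true)) else Fin.cons false v)
      (by simp [htest]) (fun v => ?_) (fun v v' h => ?_) fun v h => ?_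
    · by_cases hv : v = w₀ <;> simp [hv, htest]
    · by_cases hv : v = w₀ <;> by_cases hv' : v' = w₀ <;>
        simp_all [Fin.cons_inj]
    · by_cases hv : v = w₀ <;> simp [hv, Fin.cons_inj] at h

instance {α : Type} [Finite α] : Finite (HeadOp α) := by
  refine Finite.of_surjective (fun s : Option α ⊕ Fin 4 => match s with
    | .inl o => HeadOp.sym o
    | .inr 0 => .nop
    | .inr 1 => .inc
    | .inr 2 => .dec
    | .inr 3 => .zero) ?_
  rintro (_ | _ | _ | _ | o)
  exacts [⟨.inr 0, rfl⟩, ⟨.inr 1, rfl⟩, ⟨.inr 2, rfl⟩, ⟨.inr 3, rfl⟩, ⟨.inl o, rfl⟩]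

namespace HeadProgram

section Tests

variable {α : Type} {k : ℕ} (P : HeadProgram α (Fin k)) (m : ℕ)

/-- A letter of a certificate: an edge of the program, and the first digit of a clock with `m`
digits that is not maximal. -/
structure Letter where
  src : P.Node
  head : Fin k
  op : HeadOp α
  tgt : P.Node
  isEdge : P.edge src head op tgt
  clock : Fin m

instance [Finite α] : Finite (P.Letter m) := by
  have := P.finNode
  refine Finite.of_injective
    (fun l : P.Letter m => (l.src, l.head, l.op, l.tgt, l.clock)) ?_
  rintro ⟨_, _, _, _, _, _⟩ ⟨_, _, _, _, _, _⟩ h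
  simpa using h

variable {P m}

/-- What a letter does to the value that a test follows, which is the position of one of the heads
or one of the digits of the clock. -/
def Letter.Act (l : P.Letter m) (x : List α) : Fin k ⊕ Fin m → ℕ → ℕ → Prop
  | .inl i, c, c' => if l.head = i then l.op.Exec x c c' else c' = c
  | .inr j, c, c' => DigitStep x.length (compare j l.clock) c c'

/-- The flags of a test are correct when its head is at `p` and it follows the value `c`. -/
def TestOK (x : List α) (τ : Fin k ⊕ Fin m) (f : Bool × Bool) (c p : ℕ) : Prop :=
  match τ with
  | .inl _ => p = c ∧ FlagOK x.length f.1 p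
  | .inr _ => ClockOK x.length f p c

/-- The new flags and the movement of the head of a test that reads a letter, `none` standing for
rejection. -/
noncomputable def testStep (τ : Fin k ⊕ Fin m) (f : Bool × Bool) (o : Option α) (l : P.Letter m) :
    Option ((Bool × Bool) × SignType) :=
  match τ with
  | .inl i => if l.head = i then (l.op.flagStep f.1 o).map fun s => ((s.1, f.2), s.2)
      else some (f, 0)
  | .inr j => clockStep f o (compare j l.clock)

open Classical in
/-- The step of a test that receives a symbol; besides the flags, it stores the current node. -/
noncomputable def testMove (τ : Fin k ⊕ Fin m) (q : P.Node) (f : Bool × Bool) (o : Option α) :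
    Option (Option (P.Letter m)) → Option ((P.Node × (Bool × Bool)) × SignType)
  | some (some l) => if l.src = q then (testStep τ f o l).map fun s => ((l.tgt, s.1), s.2) else none
  | _ => none

variable {x : List α} {τ : Fin k ⊕ Fin m} {f f' : Bool × Bool} {o : Option α} {l : P.Letter m}
  {d : SignType} {c c' p : ℕ}

theorem testMove_eq_some {q q' : P.Node} {g : Option (Option (P.Letter m))} :
    testMove τ q f o g = some ((q', f'), d) ↔ ∃ l : P.Letter m, g = some (some l) ∧ l.src = q ∧
      l.tgt = q' ∧ testStep τ f o l = some (f', d) := by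
  rcases g with _ | _ | l
  · simp [testMove]
  · simp [testMove]
  · simp only [testMove, Option.ite_none_right_eq_some, Option.map_eq_some_iff, Prod.mk.injEq,
      Option.some.injEq]
    constructor
    · rintro ⟨hsrc, ⟨f', d⟩, hstep, ⟨rfl, rfl⟩, rfl⟩
      exact ⟨l, rfl, hsrc, rfl, hstep⟩
    · rintro ⟨_, rfl, hsrc, rfl, hstep⟩
      exact ⟨hsrc, (f', d), hstep, ⟨rfl, rfl⟩, rfl⟩

theorem testOK_init (x : List α) (τ : Fin k ⊕ Fin m) : TestOK x τ (false, true) 0 0 := by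
  cases τ
  · exact ⟨rfl, by omega, by simp, by simp⟩
  · exact ⟨Nat.zero_le _, by simp, by simp, by simp⟩

theorem TestOK.pos_le (h : TestOK x τ f c p) : p ≤ x.length + 1 := by
  cases τ
  · exact h.2.1
  · exact ClockOK.le h

theorem TestOK.value_le (h : TestOK x τ f c p) : c ≤ x.length + 1 := by
  cases τ
  · exact h.1 ▸ h.2.1
  · exact h.1

theorem act_of_testStep (h : TestOK x τ f c p)
    (hstep : testStep τ f (inputSymbol x p) l = some (f', d)) :
    ∃ p' c' : ℕ, l.Act x τ c c' ∧ (p' : ℤ) = p + d ∧ TestOK x τ f' c' p' := by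
  rcases τ with i | j
  · obtain ⟨rfl, hflag⟩ := h
    by_cases hi : l.head = i
    · simp only [testStep, hi, if_true, Option.map_eq_some_iff, Prod.mk.injEq, Prod.exists] at hstep
      obtain ⟨b, d, hstep, rfl, rfl⟩ := hstep
      obtain ⟨p', hexec, hp', hflag'⟩ := HeadOp.exec_of_flagStep hflag hstep
      exact ⟨p', p', (if_pos hi).mpr hexec, hp', rfl, hflag'⟩
    · simp only [testStep, hi, if_false, Option.some.injEq, Prod.mk.injEq] at hstep
      obtain ⟨rfl, rfl⟩ := hstep
      exact ⟨p, p, (if_neg hi).mpr rfl, by simp, rfl, hflag⟩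
  · exact digitStep_of_clockStep h hstep

theorem Letter.Act.exists_testStep (hact : l.Act x τ c c') (h : TestOK x τ f c p) :
    ∃ f' d, ∃ p' : ℕ, testStep τ f (inputSymbol x p) l = some (f', d) ∧ (p' : ℤ) = p + (d : ℤ) ∧
      TestOK x τ f' c' p' := by
  rcases τ with i | j
  · obtain ⟨rfl, hflag⟩ := h
    by_cases hi : l.head = i
    · have hexec : l.op.Exec x p c' := (if_pos hi).mp hact
      obtain ⟨b, d, hstep, hp', hflag'⟩ := hexec.exists_flagStep hflag
      exact ⟨(b, f.2), d, c', by simp [testStep, hi, hstep], hp', rfl, hflag'⟩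
    · obtain rfl : c' = p := (if_neg hi).mp hact
      exact ⟨f, 0, c', by simp [testStep, hi], by simp, rfl, hflag⟩
  · exact DigitStep.exists_clockStep hact h

theorem Letter.step_of_act {v v' : Fin k → ℕ} (h : ∀ i, l.Act x (.inl i) (v i) (v' i)) :
    P.Step x (l.src, v) (l.tgt, v') := by
  refine ⟨l.head, l.op, v' l.head, l.isEdge, (if_pos rfl).mp (h l.head), funext fun i => ?_⟩
  rcases eq_or_ne i l.head with rfl | hi
  · rw [Function.update_self]
  · rw [Function.update_of_ne hi]
    exact (if_neg hi.symm).mp (h i)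

theorem Step.exists_letter {y z : P.Node × (Fin k → ℕ)} (h : P.Step x y z) {a a' : Fin m → ℕ}
    {j : Fin m} (hdigits : ∀ i, DigitStep x.length (compare i j) (a i) (a' i)) :
    ∃ l : P.Letter m, l.src = y.1 ∧ l.tgt = z.1 ∧
      ∀ τ, l.Act x τ (Sum.elim y.2 a τ) (Sum.elim z.2 a' τ) := by
  obtain ⟨i, op, p, hedge, hexec, hz⟩ := h
  refine ⟨⟨y.1, i, op, z.1, hedge, j⟩, rfl, rfl, fun τ => ?_⟩
  rcases τ with i' | i'
  · rw [Sum.elim_inl, Sum.elim_inl, hz]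
    rcases eq_or_ne i' i with rfl | hi
    · exact (if_pos rfl).mpr (by rwa [Function.update_self])
    · exact (if_neg hi.symm).mpr (Function.update_of_ne hi _ _)
  · exact hdigits i'

/-- The certificate `g` describes a computation that takes `n` steps, where `q t` and `value t` are
the node and the values that the tests follow, at time `t`. -/
structure IsCertificate (x : List α) (g : ℕ → Option (Option (P.Letter m))) (n : ℕ) (q : ℕ → P.Node)
    (value : ℕ → Fin k ⊕ Fin m → ℕ) : Prop where
  start : q 0 = P.start
  final : q n = P.final
  value_zero : ∀ τ, value 0 τ = 0
  step : ∀ t < n, ∃ l : P.Letter m, g t = some (some l) ∧ l.src = q t ∧ l.tgt = q (t + 1) ∧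
    ∀ τ, l.Act x τ (value t τ) (value (t + 1) τ)

theorem lt_card_of_injOn {n : ℕ} {y : ℕ → P.Node × (Fin k → ℕ)}
    (hon : ∀ t ≤ n, HeadsOn x (y t).2) (hinj : Set.InjOn y (Set.Iic n)) :
    n < Nat.card P.Node * (x.length + 2) ^ k := by
  have := P.finNode
  let pos (t : Set.Iic n) (i : Fin k) : Fin (x.length + 2) :=
    ⟨(y t).2 i, Nat.lt_succ_of_le (hon t t.2 i)⟩
  have hpos : Function.Injective fun t : Set.Iic n => ((y t).1, pos t) := fun t t' h => by
    obtain ⟨hnode, hpos⟩ := Prod.mk.inj h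
    refine Subtype.ext (hinj t.2 t'.2 (Prod.ext hnode (funext fun i => ?_)))
    exact congrArg Fin.val (congrFun hpos i)
  simpa [Nat.card_prod, Nat.card_fun] using Nat.card_le_card_of_injective _ hpos

theorem Accepts.exists_isCertificate
    (hm : Nat.card P.Node * (x.length + 2) ^ k ≤ (x.length + 2) ^ m) (h : P.Accepts x) :
    ∃ (g : ℕ → Option (Option (P.Letter m))) (n : ℕ) (q : ℕ → P.Node)
      (value : ℕ → Fin k ⊕ Fin m → ℕ), IsCertificate x g n q value := by
  obtain ⟨v, hv⟩ := h
  obtain ⟨n, y, h0, hn, hstep, hinj⟩ := exists_injOn_path hv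
  have hon : ∀ t ≤ n, HeadsOn x (y t).2 := by
    intro t ht
    induction t with
    | zero => exact h0 ▸ fun _ => Nat.zero_le _
    | succ t ih => exact (hstep t ht).headsOn (ih (by omega))
  let digit (t : ℕ) (j : Fin m) : ℕ := t / (x.length + 2) ^ (j : ℕ) % (x.length + 2)
  have hletter : ∀ t < n, ∃ l : P.Letter m, l.src = (y t).1 ∧ l.tgt = (y (t + 1)).1 ∧
      ∀ τ, l.Act x τ (Sum.elim (y t).2 (digit t) τ) (Sum.elim (y (t + 1)).2 (digit (t + 1)) τ) := by
    intro t ht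
    obtain ⟨j, hj⟩ := exists_digitStep_succ (n := x.length) (m := m) (t := t)
      ((Nat.succ_le_of_lt ht).trans_lt ((lt_card_of_injOn hon hinj).trans_le hm))
    exact (hstep t ht).exists_letter hj
  choose l hl using hletter
  exact ⟨fun t => if ht : t < n then some (some (l t ht)) else none, n, fun t => (y t).1,
    fun t => Sum.elim (y t).2 (digit t), by rw [h0], by rw [hn],
    fun τ => by cases τ <;> simp [h0, digit],
    fun t ht => ⟨l t ht, dif_pos ht, hl t ht⟩⟩

end Tests

/-! ### The one-way verifier of a head program -/

/-- The outcomes of the first `t` coins; the other coins are set to `false`. -/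
def tossed {r : ℕ} (ω : ℕ → Bool) (t : ℕ) : Fin (r + 1) → Bool :=
  fun i => if (i : ℕ) < t then ω i else false

theorem tossed_zero {r : ℕ} (ω : ℕ → Bool) : (tossed ω 0 : Fin (r + 1) → Bool) = fun _ => false :=
  funext fun _ => if_neg (Nat.not_lt_zero _)

theorem tossed_all {r : ℕ} (ω : ℕ → Bool) :
    tossed ω (r + 1) = fun i : Fin (r + 1) => ω i :=
  funext fun i => if_pos i.2

theorem update_tossed {r t : ℕ} (ω : ℕ → Bool) (ht : t < r + 1) :
    Function.update (tossed ω t) ⟨t, ht⟩ (ω t) = tossed ω (t + 1) := by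
  funext i
  rcases lt_trichotomy (i : ℕ) t with hi | rfl | hi
  · rw [Function.update_of_ne (Fin.ne_of_lt hi), tossed, tossed, if_pos hi,
      if_pos (Nat.lt_succ_of_lt hi)]
  · rw [Function.update_self, tossed, if_pos (Nat.lt_succ_self _)]
  · rw [Function.update_of_ne (Fin.ne_of_gt hi), tossed, tossed, if_neg hi.asymm,
      if_neg (by omega)]

section Verifier

variable {α : Type} [Finite α] {k : ℕ} (P : HeadProgram α (Fin k)) {m r : ℕ}
  (sel : (Fin (r + 1) → Bool) → Option (Fin k ⊕ Fin m))

open Classical in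
/-- The verifier that tosses `r + 1` coins and then reads a certificate, carrying out the test
selected by the coins; it rejects if none is selected. The coins are part of the state. -/
noncomputable abbrev verifier : Verifier α where
  R := Fin (r + 1) × (Fin (r + 1) → Bool)
  D := (Fin k ⊕ Fin m) × P.Node × (Bool × Bool)
  Work := Unit
  Comm := Option (Option (P.Letter m))
  finR := inferInstance
  finD := by have := P.finNode; infer_instance
  finWork := inferInstance
  finComm := inferInstance
  start := .coin (0, fun _ => false)
  start_ne_accept := by simp
  start_ne_reject := by simp
  blank := ()
  null := none
  msg
    | .det _ => some none
    | _ => none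
  δcoin q _ _ _ b :=
    (if h : (q.1 : ℕ) + 1 < r + 1 then .coin (⟨q.1 + 1, h⟩, Function.update q.2 q.1 b) else
      match sel (Function.update q.2 q.1 b) with
      | none => .reject
      | some τ => .det (τ, P.start, (false, true)), (), 0, 0)
  δdet q o _ g := if q.2.1 = P.final then (.accept, (), 0, 0) else
    match testMove q.1 q.2.1 q.2.2 o g with
    | none => (.reject, (), 0, 0)
    | some ((q', f'), d) => (.det (q.1, q', f'), (), d, 0)

/-- A configuration of the verifier after the coin tosses. -/
def afterCoins (s : VState (P.verifier sel).R (P.verifier sel).D) (p : ℕ)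
    (h : List ((P.verifier sel).Comm × (P.verifier sel).Comm)) : (P.verifier sel).Config :=
  ⟨s, p, fun _ => (), 0, h, r + 1⟩

variable {P sel} {Q : Prover α (P.verifier sel).Comm} {x : List α} {ω : ℕ → Bool}

theorem run_of_lt {t : ℕ} (ht : t < r + 1) : (P.verifier sel).run Q x ω t =
    ⟨.coin (⟨t, ht⟩, tossed ω t), 0, fun _ => (), 0, [], t⟩ := by
  induction t with
  | zero => simp [Verifier.run, Verifier.init, tossed_zero]
  | succ t ih =>
    rw [Verifier.run_succ, ih (by omega)]
    simp [Verifier.step, Verifier.apply, Verifier.newHistory, ht, update_tossed]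

theorem run_selection : (P.verifier sel).run Q x ω (r + 1) = P.afterCoins sel
    ((sel fun i => ω i).elim .reject fun τ => .det (τ, P.start, (false, true))) 0 [] := by
  rw [Verifier.run_succ, run_of_lt r.lt_succ_self, ← tossed_all]
  rcases hsel : sel (tossed ω (r + 1)) with _ | τ <;>
    simp [Verifier.step, Verifier.apply, Verifier.newHistory, update_tossed, afterCoins, hsel]

section Step

variable {τ : Fin k ⊕ Fin m} {q : P.Node} {f : Bool × Bool} {p : ℕ}
  {h : List ((P.verifier sel).Comm × (P.verifier sel).Comm)}

theorem step_final : (P.verifier sel).step Q x ω (P.afterCoins sel (.det (τ, P.final, f)) p h) =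
    P.afterCoins sel .accept p (h ++ [(some none, Q x h (some none))]) := by
  simp [Verifier.step, Verifier.apply, Verifier.newHistory, afterCoins]

theorem step_reject (hq : q ≠ P.final)
    (hmove : testMove τ q f (inputSymbol x p) (Q x h (some none)) = none) :
    (P.verifier sel).step Q x ω (P.afterCoins sel (.det (τ, q, f)) p h) =
      P.afterCoins sel .reject p (h ++ [(some none, Q x h (some none))]) := by
  simp [Verifier.step, Verifier.apply, Verifier.newHistory, Verifier.received, afterCoins, hq,
    hmove]

theorem step_test (hq : q ≠ P.final) {q' : P.Node} {f' : Bool × Bool} {d : SignType} {p' : ℕ}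
    (hmove : testMove τ q f (inputSymbol x p) (Q x h (some none)) = some ((q', f'), d))
    (hp' : (p' : ℤ) = p + d) :
    (P.verifier sel).step Q x ω (P.afterCoins sel (.det (τ, q, f)) p h) =
      P.afterCoins sel (.det (τ, q', f')) p' (h ++ [(some none, Q x h (some none))]) := by
  simp [Verifier.step, Verifier.apply, Verifier.newHistory, Verifier.received, afterCoins, hq,
    hmove, hp']

end Step

/-- After the coin tosses, the head of the verifier is between the end-markers, and the flags of its
test are correct. -/
def StateOK (x : List α) (p : ℕ) : VState (P.verifier sel).R (P.verifier sel).D → Prop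
  | .coin _ => False
  | .det (τ, _, f) => ∃ value, TestOK x τ f value p
  | .accept | .reject => p ≤ x.length + 1

theorem StateOK.pos_le {s : VState (P.verifier sel).R (P.verifier sel).D} {p : ℕ}
    (hs : StateOK x p s) : p ≤ x.length + 1 := by
  rcases s with q | ⟨τ, q, f⟩ | _ | _
  · exact hs.elim
  · exact hs.choose_spec.pos_le
  · exact hs
  · exact hs

theorem StateOK.exists_step {s : VState (P.verifier sel).R (P.verifier sel).D} {p : ℕ}
    (hs : StateOK x p s) (h : List ((P.verifier sel).Comm × (P.verifier sel).Comm)) :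
    ∃ s' p' h', (P.verifier sel).step Q x ω (P.afterCoins sel s p h) = P.afterCoins sel s' p' h' ∧
      StateOK x p' s' := by
  have hp := hs.pos_le
  rcases s with q | ⟨τ, q, f⟩ | _ | _
  · exact hs.elim
  · by_cases hq : q = P.final
    · exact ⟨.accept, p, _, hq ▸ step_final, hp⟩
    rcases hmove : testMove τ q f (inputSymbol x p) (Q x h (some none)) with _ | ⟨⟨q', f'⟩, d⟩
    · exact ⟨.reject, p, _, step_reject hq hmove, hp⟩
    · obtain ⟨l, -, -, -, hstep⟩ := testMove_eq_some.1 hmove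
      obtain ⟨p', value, -, hp', hok⟩ := act_of_testStep hs.choose_spec hstep
      exact ⟨_, p', _, step_test hq hmove hp', value, hok⟩
  · exact ⟨_, p, h, rfl, hp⟩
  · exact ⟨_, p, h, rfl, hp⟩

theorem exists_run_eq_afterCoins (t : ℕ) : ∃ s p h,
    (P.verifier sel).run Q x ω (r + 1 + t) = P.afterCoins sel s p h ∧ StateOK x p s := by
  induction t with
  | zero =>
    refine ⟨_, 0, [], run_selection, ?_⟩
    rcases sel fun i => ω i with _ | τ
    · exact Nat.zero_le _
    · exact ⟨0, testOK_init x τ⟩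
  | succ t ih =>
    obtain ⟨s, p, h, hrun, hs⟩ := ih
    obtain ⟨s', p', h', hstep, hs'⟩ := hs.exists_step (Q := Q) (ω := ω) h
    exact ⟨s', p', h', by rw [← add_assoc, Verifier.run_succ, hrun, hstep], hs'⟩

theorem run_bounds (Q : Prover α (P.verifier sel).Comm) (x : List α) (ω : ℕ → Bool) (t : ℕ) :
    ((P.verifier sel).run Q x ω t).workPos = 0 ∧ ((P.verifier sel).run Q x ω t).coins ≤ r + 1 ∧
      ∃ p ≤ x.length + 1, ((P.verifier sel).run Q x ω t).inputPos = (p : ℤ) := by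
  rcases lt_or_ge t (r + 1) with ht | ht
  · rw [run_of_lt ht]
    exact ⟨rfl, ht.le, 0, Nat.zero_le _, rfl⟩
  · obtain ⟨t, rfl⟩ := Nat.exists_eq_add_of_le ht
    obtain ⟨s, p, h, hrun, hs⟩ := exists_run_eq_afterCoins (Q := Q) (x := x) (ω := ω) (sel := sel) t
    rw [hrun]
    exact ⟨rfl, le_rfl, p, hs.pos_le, rfl⟩

theorem verifier_restricted (provers : Set (Prover α (P.verifier sel).Comm)) :
    (P.verifier sel).Restricted provers consBound consBound := by
  refine ⟨fun Q _ x ω t => ?_, ⟨fun _ => 1, mem_consBound_iff.2 ⟨1, fun _ => le_rfl⟩,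
    fun Q _ x ω t => ?_⟩, fun _ => r + 1, mem_consBound_iff.2 ⟨r + 1, fun _ => le_rfl⟩,
    fun Q _ x ω t => (run_bounds Q x ω t).2.1⟩
  · obtain ⟨-, -, p, hp, hpos⟩ := run_bounds Q x ω t
    omega
  · simp only [cellsVisited, (run_bounds Q x ω _).1]
    exact Finset.card_le_one.2 (by simp)

section Certificate

variable {c : List α → ℕ → (P.verifier sel).Comm} {t : ℕ} {τ : Fin k ⊕ Fin m} {q : P.Node}
  {value : ℕ}

/-- At the time `t` after the coin tosses, the test `τ` of the certificate `c x` is at the node `q`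
and follows the value `value`. -/
def IsTesting (c : List α → ℕ → (P.verifier sel).Comm) (x : List α) (ω : ℕ → Bool) (t : ℕ)
    (τ : Fin k ⊕ Fin m) (q : P.Node) (value : ℕ) : Prop :=
  ∃ f p h, (P.verifier sel).run (.ofSequence c) x ω (r + 1 + t) =
    P.afterCoins sel (.det (τ, q, f)) p h ∧ h.length = t ∧ TestOK x τ f value p

theorem isTesting_zero (hτ : sel (fun i => ω i) = some τ) : IsTesting c x ω 0 τ P.start 0 :=
  ⟨(false, true), 0, [], by rw [add_zero, run_selection, hτ]; rfl, rfl, testOK_init x τ⟩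

theorem IsTesting.exists_accept (h : IsTesting c x ω t τ P.final value) :
    ∃ t, ((P.verifier sel).run (.ofSequence c) x ω t).state = .accept := by
  obtain ⟨f, p, h, hrun, -, -⟩ := h
  exact ⟨r + 1 + t + 1, by rw [Verifier.run_succ, hrun, step_final]; rfl⟩

theorem IsTesting.reject_or_exists_act (h : IsTesting c x ω t τ q value) (hq : q ≠ P.final) :
    (∃ t, ((P.verifier sel).run (.ofSequence c) x ω t).state = .reject) ∨
      ∃ (l : P.Letter m) (value' : ℕ), c x t = some (some l) ∧ l.src = q ∧
        l.Act x τ value value' ∧ IsTesting c x ω (t + 1) τ l.tgt value' := by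
  obtain ⟨f, p, h, hrun, rfl, hok⟩ := h
  rcases hmove : testMove τ q f (inputSymbol x p) (c x h.length) with _ | ⟨⟨q', f'⟩, d⟩
  · exact .inl ⟨r + 1 + h.length + 1, by rw [Verifier.run_succ, hrun, step_reject hq hmove]; rfl⟩
  · obtain ⟨l, hl, hsrc, rfl, hstep⟩ := testMove_eq_some.1 hmove
    obtain ⟨p', value', hact, hp', hok'⟩ := act_of_testStep hok hstep
    refine .inr ⟨l, value', hl, hsrc, hact, f', p', h ++ [(some none, c x h.length)], ?_,
      List.length_append, hok'⟩
    rw [← add_assoc, Verifier.run_succ, hrun, step_test hq hmove hp']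
    rfl

theorem IsTesting.succ (h : IsTesting c x ω t τ q value) (hq : q ≠ P.final) {l : P.Letter m}
    (hl : c x t = some (some l)) (hsrc : l.src = q) {value' : ℕ} (hact : l.Act x τ value value') :
    IsTesting c x ω (t + 1) τ l.tgt value' := by
  obtain ⟨f, p, h, hrun, rfl, hok⟩ := h
  obtain ⟨f', d, p', hstep, hp', hok'⟩ := hact.exists_testStep hok
  refine ⟨f', p', h ++ [(some none, c x h.length)], ?_, List.length_append, hok'⟩
  rw [← add_assoc, Verifier.run_succ, hrun,
    step_test hq (testMove_eq_some.2 ⟨l, hl, hsrc, rfl, hstep⟩) hp']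
  rfl

theorem exists_accept_of_isCertificate {n : ℕ} {q : ℕ → P.Node} {value : ℕ → Fin k ⊕ Fin m → ℕ}
    (h : IsCertificate x (c x) n q value) (hτ : sel (fun i => ω i) = some τ) :
    ∃ t, ((P.verifier sel).run (.ofSequence c) x ω t).state = .accept := by
  by_contra! hno
  have htesting : ∀ t ≤ n, IsTesting c x ω t τ (q t) (value t τ) := by
    intro t ht
    induction t with
    | zero => rw [h.start, h.value_zero]; exact isTesting_zero hτ
    | succ t ih =>
      obtain ⟨l, hl, hsrc, htgt, hact⟩ := h.step t ht
      have ih := ih (by omega)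
      rw [← htgt]
      refine ih.succ (fun hq => ?_) hl hsrc (hact τ)
      obtain ⟨t, hacc⟩ := IsTesting.exists_accept (hq ▸ ih)
      exact hno t hacc
  obtain ⟨t, hacc⟩ := IsTesting.exists_accept (h.final ▸ htesting n le_rfl)
  exact hno t hacc

/-- With the coins `ω τ` selecting the test `τ`, none of the tests has failed by the time `t`. They
have followed a computation of the program to the node `q` and the head positions `v`, and the clock
shows the digits `a`. -/
structure Survives (c : List α → ℕ → (P.verifier sel).Comm) (x : List α)
    (ω : Fin k ⊕ Fin m → ℕ → Bool) (t : ℕ) (q : P.Node) (v : Fin k → ℕ)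
    (a : Fin m → Fin (x.length + 2)) : Prop where
  reach : P.Reach x (P.start, fun _ => 0) (q, v)
  head : ∀ i, IsTesting c x (ω (.inl i)) t (.inl i) q (v i)
  clock : ∀ j, IsTesting c x (ω (.inr j)) t (.inr j) q (a j)

theorem Survives.exists_succ [Nonempty (Fin k ⊕ Fin m)] {ω : Fin k ⊕ Fin m → ℕ → Bool}
    {v : Fin k → ℕ} {a : Fin m → Fin (x.length + 2)} (h : Survives c x ω t q v a)
    (hq : q ≠ P.final)
    (hrej : ∀ τ t, ((P.verifier sel).run (.ofSequence c) x (ω τ) t).state ≠ .reject) :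
    ∃ q' v' a', Survives c x ω (t + 1) q' v' a' ∧ toColex a < toColex a' := by
  have hact : ∀ τ value, IsTesting c x (ω τ) t τ q value → ∃ (l : P.Letter m) (value' : ℕ),
      c x t = some (some l) ∧ l.src = q ∧ l.Act x τ value value' ∧
        IsTesting c x (ω τ) (t + 1) τ l.tgt value' := fun τ value hτ =>
    (hτ.reject_or_exists_act hq).resolve_left fun ⟨t, ht⟩ => hrej τ t ht
  obtain ⟨l, hl, rfl⟩ : ∃ l : P.Letter m, c x t = some (some l) ∧ l.src = q := by
    obtain ⟨i | j⟩ := ‹Nonempty (Fin k ⊕ Fin m)›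
    · obtain ⟨l, _, hl, hsrc, -⟩ := hact _ _ (h.head i)
      exact ⟨l, hl, hsrc⟩
    · obtain ⟨l, _, hl, hsrc, -⟩ := hact _ _ (h.clock j)
      exact ⟨l, hl, hsrc⟩
  replace hact : ∀ τ value, IsTesting c x (ω τ) t τ l.src value → ∃ value',
      l.Act x τ value value' ∧ IsTesting c x (ω τ) (t + 1) τ l.tgt value' := fun τ value hτ => by
    obtain ⟨l', value', hl', -, hact, htest⟩ := hact τ value hτ
    obtain rfl : l = l' := Option.some.inj (Option.some.inj (hl.symm.trans hl'))
    exact ⟨value', hact, htest⟩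
  choose v' hv' hhead using fun i => hact _ _ (h.head i)
  choose a' ha' hclock using fun j => hact _ _ (h.clock j)
  have hlt : ∀ j, a' j < x.length + 2 := fun j => by
    obtain ⟨f, p, _, -, -, hok⟩ := hclock j
    exact Nat.lt_succ_of_le hok.value_le
  exact ⟨l.tgt, v', fun j => ⟨a' j, hlt j⟩, ⟨h.reach.tail (l.step_of_act hv'), hhead, hclock⟩,
    toColex_lt_of_digitStep ha'⟩

theorem exists_test_reject [Nonempty (Fin k ⊕ Fin m)] (c : List α → ℕ → (P.verifier sel).Comm)
    (hx : ¬P.Accepts x) : ∃ τ, ∀ ω : ℕ → Bool, sel (fun i => ω i) = some τ →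
      ∃ t, ((P.verifier sel).run (.ofSequence c) x ω t).state = .reject := by
  by_contra! hno
  choose ω hω hrej using hno
  have : Finite (Colex (Fin m → Fin (x.length + 2))) := .of_equiv _ toColex
  have hdies : ∀ (b : Colex (Fin m → Fin (x.length + 2))) t q v,
      ¬Survives c x ω t q v (ofColex b) := fun b => by
    induction b using WellFoundedGT.induction with
    | ind b ih =>
      intro t q v h
      obtain ⟨q', v', a', h', hlt⟩ := h.exists_succ (by rintro rfl; exact hx ⟨v, h.reach⟩) hrej
      exact ih _ hlt _ _ _ h'
  exact hdies (toColex fun _ => 0) 0 P.start _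
    ⟨.refl, fun i => isTesting_zero (hω _), fun j => isTesting_zero (hω _)⟩

end Certificate

end Verifier

end HeadProgram

theorem mul_pow_le_pow_add (c n k : ℕ) : c * (n + 2) ^ k ≤ (n + 2) ^ (c + k) := by
  rw [pow_add]
  exact Nat.mul_le_mul_right _ (Nat.lt_pow_self (by omega)).le

theorem Verifier.one_sub_le_probability {α : Type} {V : Verifier α} {Q : Prover α V.Comm}
    {x : List α} {r : ℕ} (hr : ∀ ω t, (V.run Q x ω t).coins ≤ r + 1) {A : Set (Fin (r + 1) → Bool)}
    (hA : 2 ^ r + 1 ≤ A.ncard) {s : VState V.R V.D}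
    (hs : ∀ u ∈ A, ∃ t, (V.run Q x (extendCoins u) t).state = s) :
    1 - (1 / 2 - 1 / 2 ^ (r + 1)) ≤ coinMeasure.real {ω | ∃ t, (V.run Q x ω t).state = s} := by
  have hcard : (2 ^ r + 1 : ℝ) ≤
      {u : Fin (r + 1) → Bool | ∃ t, (V.run Q x (extendCoins u) t).state = s}.ncard := by
    exact_mod_cast hA.trans (Set.ncard_le_ncard hs)
  rw [V.probability_eq hr]
  calc 1 - (1 / 2 - 1 / 2 ^ (r + 1)) = (2 ^ r + 1 : ℝ) / 2 ^ (r + 1) := by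
        field_simp
        ring
    _ ≤ _ := by gcongr

theorem headLanguages_subset_onewayIP (α : Type) [Finite α] :
    HeadLanguages α ⊆ onewayIP α consBound consBound := by
  rintro L ⟨k, P, hL⟩
  have := P.finNode
  have : Nonempty P.Node := ⟨P.start⟩
  let m := Nat.card P.Node + k
  have : Nonempty (Fin k ⊕ Fin m) := ⟨.inr ⟨0, Nat.add_pos_left Nat.card_pos k⟩⟩
  obtain ⟨r, sel, hchosen, hnot⟩ := exists_selection (Fin k ⊕ Fin m)
  have hcoins Q x ω t := (HeadProgram.run_bounds (P := P) (sel := sel) Q x ω t).2.1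
  have hsel {u τ} (hu : sel u = some τ) : sel (fun i => extendCoins u i) = some τ := by
    simpa only [extendCoins_apply] using hu
  have hcert : ∀ x, ∃ g : ℕ → Option (Option (P.Letter m)), x ∈ L →
      ∃ n q value, HeadProgram.IsCertificate x g n q value := fun x => by
    by_cases hx : x ∈ L
    · obtain ⟨g, hg⟩ := ((hL x).1 hx).exists_isCertificate (mul_pow_le_pow_add _ _ _)
      exact ⟨g, fun _ => hg⟩
    · exact ⟨fun _ => none, fun h => (hx h).elim⟩
  choose c hc using hcert
  refine ⟨P.verifier sel, HeadProgram.verifier_restricted _, 1 / 2 - 1 / 2 ^ (r + 1),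
    sub_lt_self _ (by positivity), ⟨.ofSequence c, ⟨c, rfl⟩, fun x hx => ?_⟩, ?_⟩
  · obtain ⟨n, q, value, hcert⟩ := hc x hx
    refine Verifier.one_sub_le_probability (hcoins _ x) hchosen ?_
    rintro u ⟨τ, hu⟩
    exact HeadProgram.exists_accept_of_isCertificate hcert (hsel hu)
  · rintro x hx _ ⟨c, rfl⟩
    obtain ⟨τ, hτ⟩ := HeadProgram.exists_test_reject (sel := sel) c fun h => hx ((hL x).2 h)
    refine Verifier.one_sub_le_probability (hcoins _ x) (hnot τ) ?_
    rintro u (hu | hu)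
    · refine ⟨r + 1, ?_⟩
      simp only [HeadProgram.run_selection, extendCoins_apply, hu]
      rfl
    · exact hτ _ (hsel hu)

/-! ### Binary counters -/

/-- The number whose binary digits, the least significant one first, are `l`. -/
def bitValue (l : List Bool) : ℕ := Nat.ofDigits 2 (l.map Bool.toNat)

@[simp]
theorem bitValue_nil : bitValue [] = 0 := rfl

@[simp]
theorem bitValue_cons (b : Bool) (l : List Bool) :
    bitValue (b :: l) = b.toNat + 2 * bitValue l := by
  simp [bitValue, Nat.ofDigits_cons]

theorem length_lt_size_bitValue_append (l₁ l₂ : List Bool) :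
    l₁.length < (bitValue (l₁ ++ true :: l₂)).size := by
  rw [Nat.lt_size]
  induction l₁ with
  | nil => simp
  | cons b l₁ ih =>
    rw [List.cons_append, bitValue_cons, List.length_cons, pow_succ]
    omega

section CounterTape

variable {β : Type} {l l₁ l₂ : List β} {z : ℕ}

theorem inputSymbol_append_length :
    inputSymbol (l₁ ++ l₂) ((l₁.length + 1 : ℕ) : ℤ) = l₂.head? := by
  rw [inputSymbol_succ, List.getElem?_append_right le_rfl, Nat.sub_self, List.head?_eq_getElem?]

theorem inputSymbol_nil : inputSymbol ([] : List β) = fun _ => none :=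
  funext fun z => by simp [inputSymbol]

theorem update_inputSymbol_append (b : β) :
    Function.update (inputSymbol (l₁ ++ l₂)) ((l₁.length + 1 : ℕ) : ℤ) (some b) =
      inputSymbol (l₁ ++ b :: l₂.tail) := by
  funext z
  rcases eq_or_ne z ((l₁.length + 1 : ℕ) : ℤ) with rfl | hz
  · rw [Function.update_self, inputSymbol_append_length, List.head?_cons]
  rw [Function.update_of_ne hz]
  obtain hz0 | ⟨n, rfl⟩ : z ≤ 0 ∨ ∃ n : ℕ, z = ((n + 1 : ℕ) : ℤ) :=
    (le_or_gt z 0).imp_right fun h => ⟨z.toNat - 1, by omega⟩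
  · simp [inputSymbol, hz0]
  rw [inputSymbol_succ, inputSymbol_succ]
  rcases lt_or_ge n l₁.length with hn | hn
  · rw [List.getElem?_append_left hn, List.getElem?_append_left hn]
  · obtain ⟨i, rfl⟩ := Nat.exists_eq_add_of_lt (lt_of_le_of_ne hn (by rintro rfl; exact hz rfl))
    have hi : l₁.length + i + 1 - l₁.length = i + 1 := by omega
    rw [List.getElem?_append_right hn, List.getElem?_append_right hn, hi, List.getElem?_cons_succ,
      List.getElem?_tail]

theorem eq_zero_of_inputSymbol_eq_none (hz : z ≤ l.length) (h : inputSymbol l z = none) :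
    z = 0 := by
  rw [inputSymbol_eq_none (by omega)] at h
  omega

theorem pos_of_inputSymbol_eq_some {b : β} (h : inputSymbol l z = some b) : 0 < z := by
  rcases Nat.eq_zero_or_pos z with rfl | hz
  · simp [inputSymbol] at h
  · exact hz

end CounterTape

/-- A pass of a head over the digits of a binary counter, from the least significant one on: `dec`
subtracts one from a positive number, `zero` checks that the number is zero, `inc` adds one. -/
inductive Pass : Type
  | dec | zero | inc

namespace Pass

/-- The movement of the input head after the pass. -/
def dir : Pass → SignType
  | dec => 1
  | zero => 0
  | inc => -1

instance : Finite Pass :=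
  .of_injective dir fun
    | dec, dec, _ | zero, zero, _ | inc, inc, _ => rfl

/-- The digit at which the pass goes on. -/
def skip : Pass → Bool
  | inc => true
  | _ => false

/-- The digit that replaces the digit `skip`. -/
def skipped : Pass → Bool
  | dec => true
  | _ => false

/-- The pass ends at a cell that holds `a`, by writing `a'`; the cells beyond the most significant
digit hold `none`. -/
def Ends : Pass → Option Bool → Option Bool → Prop
  | dec, a, a' => a = some true ∧ a' = some false
  | zero, a, a' => a = none ∧ a' = none
  | inc, a, a' => a ≠ some true ∧ a' = some true

/-- The pass replaces the first list of digits by the second one. -/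
inductive Run (k : Pass) : List Bool → List Bool → Prop
  | skip {l l' : List Bool} : k.Run l l' → k.Run (k.skip :: l) (k.skipped :: l')
  | finish {l : List Bool} {a : Option Bool} : k.Ends l.head? a → k.Run l (a.toList ++ l.tail)

/-- The effect of the pass on the value of the counter. -/
def Effect : Pass → ℕ → ℕ → Prop
  | dec, v, v' => v = v' + 1
  | zero, v, v' => v = 0 ∧ v' = 0
  | inc, v, v' => v' = v + 1

variable {k : Pass} {l l₁ l₂ : List Bool}

theorem Run.effect {l' : List Bool} (h : k.Run l l') : k.Effect (bitValue l) (bitValue l') := by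
  induction h with
  | skip _ ih => cases k <;> simp [Effect, Pass.skip, skipped] at ih ⊢ <;> omega
  | @finish l a hends =>
    cases k <;> obtain ⟨hhead, rfl⟩ := hends <;> rcases l with _ | ⟨_ | _, l⟩ <;>
      simp_all [Effect, add_comm]

theorem exists_run {v : ℕ} (h : k.Effect (bitValue l) v) : ∃ l', k.Run l l' ∧ bitValue l' = v := by
  suffices ∃ l', k.Run l l' by
    obtain ⟨l', hrun⟩ := this
    have := hrun.effect
    refine ⟨l', hrun, ?_⟩
    cases k <;> simp only [Effect] at this h <;> omega
  induction l generalizing v with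
  | nil =>
    cases k
    · simp [Effect] at h
    · exact ⟨_, .finish ⟨rfl, rfl⟩⟩
    · exact ⟨_, .finish ⟨nofun, rfl⟩⟩
  | cons b l ih =>
    rcases eq_or_ne b k.skip with rfl | hb
    · obtain ⟨v', hv'⟩ : ∃ v', k.Effect (bitValue l) v' := by
        cases k
        · exact ⟨bitValue l - 1, by simp [Effect, Pass.skip] at h ⊢; omega⟩
        · exact ⟨0, by simp [Effect, Pass.skip] at h ⊢; omega⟩
        · exact ⟨_, rfl⟩
      obtain ⟨l', hrun⟩ := ih hv'
      exact ⟨_, hrun.skip⟩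
    · obtain rfl := Bool.eq_not.2 hb
      cases k
      · exact ⟨_, .finish ⟨rfl, rfl⟩⟩
      · simp [Effect, Pass.skip] at h
      · exact ⟨_, .finish ⟨nofun, rfl⟩⟩

theorem Ends.update_inputSymbol {a : Option Bool} (h : k.Ends l₂.head? a) :
    Function.update (inputSymbol (l₁ ++ l₂)) ((l₁.length + 1 : ℕ) : ℤ) a =
      inputSymbol (l₁ ++ (a.toList ++ l₂.tail)) := by
  rcases a with _ | b
  · obtain rfl : l₂ = [] := by
      cases k <;> simp_all [Ends]
    simp only [Option.toList_none, List.tail_nil, List.append_nil]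
    rw [Function.update_eq_self_iff, (inputSymbol_eq_none le_rfl).2 (.inr rfl)]
  · exact update_inputSymbol_append b

theorem Ends.length_le {a : Option Bool} (h : k.Ends l₂.head? a) {n : ℕ}
    (hlength : (l₁ ++ l₂).length ≤ n.size) (hvalue : bitValue (l₁ ++ (a.toList ++ l₂.tail)) ≤ n) :
    (l₁ ++ (a.toList ++ l₂.tail)).length ≤ n.size := by
  rcases a with _ | b
  · refine le_trans ?_ hlength
    simp
  rcases l₂ with _ | ⟨c, l₂⟩
  · obtain rfl : b = true := by
      cases k <;> simp_all [Ends]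
    have := (length_lt_size_bitValue_append l₁ []).trans_le (Nat.size_le_size hvalue)
    simpa using this
  · simpa using hlength

end Pass

/-- The stages of the simulation of an operation on a head whose position is held by a binary
counter: `fetch` moves the position from the counter to the input head, `oper` applies the operation
to the input head, `store` moves its position back to the counter; `run k` and `back k` are a pass
over the digits and the return of the work head from it. -/
inductive CounterStage : Type
  | fetch | oper | store
  | run (k : Pass)
  | back (k : Pass)

instance : Finite CounterStage :=
  .of_surjective (α := Fin 3 ⊕ Pass ⊕ Pass)
    (Sum.elim ![.fetch, .oper, .store] (Sum.elim .run .back)) fun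
    | .fetch => ⟨.inl 0, rfl⟩
    | .oper => ⟨.inl 1, rfl⟩
    | .store => ⟨.inl 2, rfl⟩
    | .run k => ⟨.inr (.inl k), rfl⟩
    | .back k => ⟨.inr (.inr k), rfl⟩

/-- The stage and the flag after a pass that was begun with the flag `b`. -/
def Pass.next : Pass → Bool → CounterStage × Bool
  | dec, _ => (.fetch, true)
  | zero, b => (.oper, b)
  | inc, _ => (.store, false)

/-- The moves of the simulation of `op`: stage and flag, scanned symbols, new stage and flag
(`none` at the end), written symbol, movements of the input head and of the work head. -/
inductive CounterMove {α : Type} (op : HeadOp α) : CounterStage → Bool → Option α → Option Bool →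
    Option (CounterStage × Bool) → Option Bool → SignType → SignType → Prop
  | fetch {k b o} (hk : k ≠ .inc) : CounterMove op .fetch b o none (some (.run k, b)) none 0 1
  | oper {b o b' d} (h : op.flagStep b o = some (b', d)) :
      CounterMove op .oper b o none (some (.store, b')) none d 0
  | store {b o} (h : ¬(o = none ∧ b = false)) :
      CounterMove op .store b o none (some (.run .inc, b)) none 0 1
  | leave : CounterMove op .store false none none none none 0 0
  | skip {k b o} : CounterMove op (.run k) b o (some k.skip) (some (.run k, b)) (some k.skipped) 0 1
  | finish {k b o a a'} (h : k.Ends a a') :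
      CounterMove op (.run k) b o a (some (.back k, b)) a' 0 (-1)
  | back {k b o a} : CounterMove op (.back k) b o (some a) (some (.back k, b)) (some a) 0 (-1)
  | done {k b o} : CounterMove op (.back k) b o none (some (k.next b)) none k.dir 0

/-- A configuration of the simulation of an operation: stage and flag (`none` at the end), position
of the input head, digits of the counter, and position of the work head. -/
structure CounterConfig where
  state : Option (CounterStage × Bool)
  pos : ℕ
  digits : List Bool
  head : ℕ

/-- The new stage and flag `t`, the written symbol `w` and the head movements `d` and `e` lead from
`c` to `c'`. -/
structure CounterConfig.MovesTo (c : CounterConfig) (t : Option (CounterStage × Bool))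
    (w : Option Bool) (d e : SignType) (c' : CounterConfig) : Prop where
  state : c'.state = t
  pos : (c'.pos : ℤ) = c.pos + d
  tape : Function.update (inputSymbol c.digits) c.head w = inputSymbol c'.digits
  head : (c'.head : ℤ) = c.head + e

section Counter

variable {α : Type} {x : List α} {op : HeadOp α} {u p z : ℕ} {l : List Bool} {b : Bool}

/-- The state of affairs in the stages outside the passes, for a head that is at the position `u`
before the operation. -/
def AtRest (x : List α) (op : HeadOp α) (u : ℕ) : CounterStage → Bool → ℕ → List Bool → Prop
  | .fetch, b, p, l => FlagOK x.length b p ∧ bitValue l + p = u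
  | .oper, b, p, l => FlagOK x.length b p ∧ bitValue l = 0 ∧ p = u
  | .store, b, p, l => FlagOK x.length b p ∧ op.Exec x u (bitValue l + p)
  | _, _, _, _ => False

/-- The state of affairs when the pass `k` is completed, but the work head has not returned. -/
def AfterPass (x : List α) (op : HeadOp α) (u : ℕ) (k : Pass) (b : Bool) (p : ℕ) (l : List Bool) :
    Prop :=
  ∃ p' : ℕ, (p' : ℤ) = p + k.dir ∧ AtRest x op u (k.next b).1 (k.next b).2 p' l

/-- The state of affairs in each stage. During a pass, it is given by the result of the pass, for
which the digits `l₁` have been completed and the digits `l₂` remain. -/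
def StageOK (x : List α) (op : HeadOp α) (u : ℕ) :
    Option (CounterStage × Bool) → ℕ → List Bool → ℕ → Prop
  | some (.run k, b), p, l, z => ∃ l₁ l₂, l = l₁ ++ l₂ ∧ z = l₁.length + 1 ∧
      ∀ l', k.Run l₂ l' → AfterPass x op u k b p (l₁ ++ l')
  | some (.back k, b), p, l, z => z ≤ l.length ∧ AfterPass x op u k b p l
  | some (s, b), p, l, z => z = 0 ∧ AtRest x op u s b p l
  | none, p, l, z => z = 0 ∧ p = 0 ∧ op.Exec x u (bitValue l)

/-- An invariant of the simulation of `op`, for a head that is at the position `u` before the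
operation. -/
structure CounterInv (x : List α) (op : HeadOp α) (u : ℕ) (c : CounterConfig) : Prop where
  pos_le : c.pos ≤ x.length + 1
  length_le : c.digits.length ≤ (x.length + 1).size
  stageOK : StageOK x op u c.state c.pos c.digits c.head

theorem AtRest.pos_le {s : CounterStage} (h : AtRest x op u s b p l) : p ≤ x.length + 1 := by
  rcases s with _ | _ | _ | k | k
  exacts [h.1.1, h.1.1, h.1.1, h.elim, h.elim]

theorem AtRest.stageOK {s : CounterStage} (h : AtRest x op u s b p l) :
    StageOK x op u (some (s, b)) p l 0 := by
  rcases s with _ | _ | _ | k | k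
  exacts [⟨rfl, h⟩, ⟨rfl, h⟩, ⟨rfl, h⟩, h.elim, h.elim]

theorem AtRest.bitValue_le {s : CounterStage} (h : AtRest x op u s b p l)
    (hu : u ≤ x.length + 1) : bitValue l ≤ x.length + 1 := by
  rcases s with _ | _ | _ | k | k
  · have := h.2
    omega
  · have := h.2.1
    omega
  · have := h.2.le hu
    omega
  · exact h.elim
  · exact h.elim

theorem CounterInv.head_le {c : CounterConfig} (h : CounterInv x op u c) :
    c.head ≤ c.digits.length + 1 := by
  obtain ⟨s, p, l, z⟩ := c
  obtain ⟨-, -, h⟩ := h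
  rcases s with _ | ⟨_ | _ | _ | k | k, b⟩
  · exact h.1 ▸ Nat.zero_le _
  · exact h.1 ▸ Nat.zero_le _
  · exact h.1 ▸ Nat.zero_le _
  · exact h.1 ▸ Nat.zero_le _
  · obtain ⟨l₁, l₂, rfl, rfl, -⟩ := h
    simp
  · exact h.1.trans (Nat.le_succ _)

theorem CounterInv.of_run {k : Pass} (hp : p ≤ x.length + 1)
    (hlength : l.length ≤ (x.length + 1).size)
    (h : ∀ l', k.Run l l' → AfterPass x op u k b p l') :
    CounterInv x op u ⟨some (.run k, b), p, l, 1⟩ :=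
  ⟨hp, hlength, [], l, rfl, rfl, h⟩

theorem AtRest.afterPass_of_fetch {k : Pass} {l' : List Bool} (h : AtRest x op u .fetch b p l)
    (hu : u ≤ x.length + 1) (hk : k ≠ .inc) (hrun : k.Run l l') : AfterPass x op u k b p l' := by
  obtain ⟨hflag, hval⟩ := h
  have heff := hrun.effect
  cases k with
  | dec =>
    simp only [Pass.Effect] at heff
    exact ⟨p + 1, by simp [Pass.dir], ⟨by omega, by simp, nofun⟩, by omega⟩
  | zero =>
    obtain ⟨h0, h0'⟩ := heff
    exact ⟨p, by simp [Pass.dir], hflag, h0', by omega⟩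
  | inc => exact absurd rfl hk

theorem AtRest.afterPass_of_store {l' : List Bool} (h : AtRest x op u .store b p l)
    (hp : p ≠ 0) (hrun : Pass.inc.Run l l') : AfterPass x op u .inc b p l' := by
  obtain ⟨hflag, hexec⟩ := h
  obtain ⟨p, rfl⟩ := Nat.exists_eq_succ_of_ne_zero hp
  have heff : bitValue l' = bitValue l + 1 := hrun.effect
  refine ⟨p, by simp [Pass.dir], ⟨?_, nofun, fun _ => ?_⟩, ?_⟩
  · exact (Nat.le_succ p).trans hflag.1
  · exact Nat.le_of_succ_le_succ hflag.1
  · rwa [heff, add_right_comm, add_assoc]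

theorem CounterInv.of_ends {k : Pass} {l₁ l₂ : List Bool} {a : Option Bool}
    (hp : p ≤ x.length + 1) (hlength : (l₁ ++ l₂).length ≤ (x.length + 1).size)
    (hu : u ≤ x.length + 1) (ha : k.Ends l₂.head? a)
    (h : AfterPass x op u k b p (l₁ ++ (a.toList ++ l₂.tail))) :
    CounterInv x op u ⟨some (.back k, b), p, l₁ ++ (a.toList ++ l₂.tail), l₁.length⟩ := by
  obtain ⟨_, -, hrest⟩ := id h
  exact ⟨hp, ha.length_le hlength (hrest.bitValue_le hu), by simp [StageOK, h]⟩

section Move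

variable {s : CounterStage} {t : Option (CounterStage × Bool)} {w : Option Bool} {d e : SignType}

theorem AtRest.exists_movesTo (h : AtRest x op u s b p l) (hu : u ≤ x.length + 1)
    (hlength : l.length ≤ (x.length + 1).size)
    (hmove : CounterMove op s b (inputSymbol x p) (inputSymbol l (0 : ℕ)) t w d e) :
    ∃ c', CounterConfig.MovesTo ⟨some (s, b), p, l, 0⟩ t w d e c' ∧ CounterInv x op u c' := by
  have hp := h.pos_le
  have hkeep {a} (ha : inputSymbol l (0 : ℕ) = a) :
      Function.update (inputSymbol l) (0 : ℕ) a = inputSymbol l :=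
    Function.update_eq_self_iff.2 ha.symm
  generalize ho : inputSymbol x p = o at hmove
  generalize ha : inputSymbol l (0 : ℕ) = a at hmove
  cases hmove with
  | @fetch k _ _ hk =>
    exact ⟨_, ⟨rfl, by simp, hkeep ha, by simp⟩,
      .of_run hp hlength fun l' => h.afterPass_of_fetch hu hk⟩
  | oper hop =>
    obtain ⟨hflag, hval, rfl⟩ := h
    obtain ⟨p', hexec, hp', hflag'⟩ := HeadOp.exec_of_flagStep hflag (ho ▸ hop)
    exact ⟨⟨_, p', l, 0⟩, ⟨rfl, hp', hkeep ha, by simp⟩, hflag'.1, hlength, rfl, hflag',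
      by rwa [hval, zero_add]⟩
  | store hne =>
    rw [← ho, h.1.none_and_false_iff] at hne
    exact ⟨_, ⟨rfl, by simp, hkeep ha, by simp⟩,
      .of_run hp hlength fun l' => h.afterPass_of_store hne⟩
  | leave =>
    obtain ⟨hflag, hexec⟩ := h
    obtain rfl := hflag.none_and_false_iff.1 ⟨ho, rfl⟩
    exact ⟨⟨_, 0, l, 0⟩, ⟨rfl, by simp, hkeep ha, by simp⟩, hp, hlength, rfl, rfl, hexec⟩
  | skip | finish | back | done => exact h.elim

theorem CounterInv.exists_movesTo_of_run {k : Pass}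
    (h : CounterInv x op u ⟨some (.run k, b), p, l, z⟩) (hu : u ≤ x.length + 1)
    (hmove : CounterMove op (.run k) b (inputSymbol x p) (inputSymbol l z) t w d e) :
    ∃ c', CounterConfig.MovesTo ⟨some (.run k, b), p, l, z⟩ t w d e c' ∧
      CounterInv x op u c' := by
  obtain ⟨hp, hlength, l₁, l₂, rfl, rfl, hrun⟩ := h
  generalize ha : inputSymbol (l₁ ++ l₂) (l₁.length + 1 : ℕ) = a at hmove
  rw [inputSymbol_append_length] at ha
  cases hmove with
  | skip =>
    obtain ⟨l₂, rfl⟩ := List.head?_eq_some_iff.1 ha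
    refine ⟨⟨_, p, l₁ ++ k.skipped :: l₂, l₁.length + 2⟩,
      ⟨rfl, by simp, update_inputSymbol_append _, by simp; ring⟩, hp, by simpa using hlength,
      l₁ ++ [k.skipped], l₂, by simp, by simp, fun l' hl' => ?_⟩
    simpa using hrun _ hl'.skip
  | finish hends =>
    subst ha
    exact ⟨_, ⟨rfl, by simp, hends.update_inputSymbol, by simp⟩,
      CounterInv.of_ends hp hlength hu hends (hrun _ (.finish hends))⟩

theorem CounterInv.exists_movesTo_of_back {k : Pass}
    (h : CounterInv x op u ⟨some (.back k, b), p, l, z⟩)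
    (hmove : CounterMove op (.back k) b (inputSymbol x p) (inputSymbol l z) t w d e) :
    ∃ c', CounterConfig.MovesTo ⟨some (.back k, b), p, l, z⟩ t w d e c' ∧
      CounterInv x op u c' := by
  obtain ⟨hp, hlength, hz, h⟩ := h
  generalize ha : inputSymbol l z = a at hmove
  have hkeep : Function.update (inputSymbol l) z a = inputSymbol l :=
    Function.update_eq_self_iff.2 ha.symm
  cases hmove with
  | back =>
    have := pos_of_inputSymbol_eq_some ha
    exact ⟨⟨_, p, l, z - 1⟩, ⟨rfl, by simp, hkeep, by simp; omega⟩, hp, hlength,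
      (Nat.sub_le _ _).trans hz, h⟩
  | done =>
    obtain ⟨p', hp', h⟩ := h
    obtain rfl := eq_zero_of_inputSymbol_eq_none hz ha
    exact ⟨⟨_, p', l, 0⟩, ⟨rfl, hp', hkeep, by simp⟩, h.pos_le, hlength, h.stageOK⟩

theorem CounterInv.exists_movesTo {c : CounterConfig} (h : CounterInv x op u c)
    (hu : u ≤ x.length + 1) (hs : c.state = some (s, b))
    (hmove : CounterMove op s b (inputSymbol x c.pos) (inputSymbol c.digits c.head) t w d e) :
    ∃ c', c.MovesTo t w d e c' ∧ CounterInv x op u c' := by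
  obtain ⟨_, p, l, z⟩ := c
  obtain rfl := hs
  rcases s with _ | _ | _ | k | k
  case run => exact h.exists_movesTo_of_run hu hmove
  case back => exact h.exists_movesTo_of_back hmove
  all_goals
    obtain ⟨-, hlength, rfl, hrest⟩ := h
    exact hrest.exists_movesTo hu hlength hmove

end Move

/-- One step of the simulation of `op`. -/
def CounterStep (x : List α) (op : HeadOp α) (c c' : CounterConfig) : Prop :=
  ∃ s b t w d e, c.state = some (s, b) ∧
    CounterMove op s b (inputSymbol x c.pos) (inputSymbol c.digits c.head) t w d e ∧
    c.MovesTo t w d e c'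

/-- The simulation of `op` can get from `c` to `c'`. -/
def CounterReach (x : List α) (op : HeadOp α) : CounterConfig → CounterConfig → Prop :=
  Relation.ReflTransGen (CounterStep x op)

namespace CounterReach

theorem of_keep {s : CounterStage} {t : Option (CounterStage × Bool)} {a : Option Bool}
    {d e : SignType} {p' z' : ℕ} (ha : inputSymbol l z = a)
    (h : CounterMove op s b (inputSymbol x p) a t a d e)
    (hp : (p' : ℤ) = p + d) (hz : (z' : ℤ) = z + e) :
    CounterReach x op ⟨some (s, b), p, l, z⟩ ⟨t, p', l, z'⟩ :=
  .single ⟨s, b, t, a, d, e, rfl, ha ▸ h, rfl, hp, Function.update_eq_self_iff.2 ha.symm, hz⟩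

theorem of_back {k : Pass} {p' : ℕ} (hz : z ≤ l.length) (hp : (p' : ℤ) = p + k.dir) :
    CounterReach x op ⟨some (.back k, b), p, l, z⟩ ⟨some (k.next b), p', l, 0⟩ := by
  induction z with
  | zero => exact of_keep ((inputSymbol_eq_none (Nat.zero_le _)).2 (.inl rfl)) .done hp (by simp)
  | succ z ih =>
    have ha : inputSymbol l ((z + 1 : ℕ) : ℤ) = some l[z] := by
      rw [inputSymbol_succ, List.getElem?_eq_getElem hz]
    exact .trans (of_keep (d := 0) (e := -1) ha .back (by simp) (by simp)) (ih (by omega))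

theorem of_run {k : Pass} {p' : ℕ} {l₁ l₂ l' : List Bool} (h : k.Run l₂ l')
    (hp : (p' : ℤ) = p + k.dir) :
    CounterReach x op ⟨some (.run k, b), p, l₁ ++ l₂, l₁.length + 1⟩
      ⟨some (k.next b), p', l₁ ++ l', 0⟩ := by
  induction h generalizing l₁ with
  | @skip l l' _ ih =>
    specialize ih (l₁ := l₁ ++ [k.skipped])
    rw [List.append_assoc, List.append_assoc, List.length_append] at ih
    refine .head ⟨_, _, _, _, 0, 1, rfl, ?_, rfl, ?_, update_inputSymbol_append _, ?_⟩ ih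
    · rw [inputSymbol_append_length]
      exact .skip
    · simp
    · simp
  | finish h =>
    refine .head ⟨_, _, _, _, 0, -1, rfl, ?_, rfl, ?_, h.update_inputSymbol, ?_⟩
      (of_back (z := l₁.length) (by simp) hp)
    · rw [inputSymbol_append_length]
      exact .finish h
    · simp
    · simp

theorem of_effect {s : CounterStage} {k : Pass} {v p' : ℕ}
    (hmove : CounterMove op s b (inputSymbol x p) none (some (.run k, b)) none 0 1)
    (heff : k.Effect (bitValue l) v) (hp : (p' : ℤ) = p + k.dir) :
    ∃ l', CounterReach x op ⟨some (s, b), p, l, 0⟩ ⟨some (k.next b), p', l', 0⟩ ∧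
      bitValue l' = v := by
  obtain ⟨l', hrun, rfl⟩ := Pass.exists_run heff
  exact ⟨l', .trans (of_keep (z' := 1) rfl hmove (by simp) (by simp))
    (of_run (l₁ := []) hrun hp), rfl⟩

theorem exists_fetch (hb : FlagOK x.length b p) (hle : bitValue l + p ≤ x.length + 1) :
    ∃ b' l', CounterReach x op ⟨some (.fetch, b), p, l, 0⟩
      ⟨some (.oper, b'), bitValue l + p, l', 0⟩ ∧ bitValue l' = 0 ∧
      FlagOK x.length b' (bitValue l + p) := by
  induction hv : bitValue l generalizing b p l with
  | zero =>
    obtain ⟨l', hreach, hl'⟩ := of_effect (x := x) (op := op) (b := b) (p := p) (p' := p)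
      (k := .zero) (.fetch nofun) ⟨hv, rfl⟩ (by simp [Pass.dir])
    rw [zero_add]
    exact ⟨b, l', hreach, hl', hb⟩
  | succ v ih =>
    obtain ⟨l₁, hdec, hl₁⟩ := of_effect (x := x) (op := op) (b := b) (p := p) (p' := p + 1)
      (k := .dec) (.fetch nofun) hv (by simp [Pass.dir])
    obtain ⟨b', l', hreach, hl', hb'⟩ := ih (b := true) (p := p + 1) (l := l₁)
      ⟨by omega, by simp, nofun⟩ (by omega) hl₁
    rw [Nat.add_right_comm, add_assoc]
    exact ⟨b', l', hdec.trans hreach, hl', hb'⟩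

theorem exists_store (hb : FlagOK x.length b p) :
    ∃ l', CounterReach x op ⟨some (.store, b), p, l, 0⟩ ⟨none, 0, l', 0⟩ ∧
      bitValue l' = bitValue l + p := by
  induction p generalizing b l with
  | zero =>
    obtain ⟨ho, rfl⟩ := hb.none_and_false_iff.2 rfl
    exact ⟨l, of_keep (d := 0) (e := 0) rfl (ho.symm ▸ .leave) (by simp) (by simp), rfl⟩
  | succ p ih =>
    have hne : ¬(inputSymbol x (p + 1 : ℕ) = none ∧ b = false) := by
      rw [hb.none_and_false_iff]
      exact p.succ_ne_zero
    obtain ⟨l₁, hinc, hl₁⟩ := of_effect (l := l) (k := .inc) (p' := p) (.store hne) rfl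
      (by simp [Pass.dir])
    have hp := hb.1
    obtain ⟨l', hreach, hl'⟩ := ih (b := false) (l := l₁) ⟨by omega, nofun, fun _ => by omega⟩
    exact ⟨l', hinc.trans hreach, by omega⟩

theorem exists_of_exec {v : ℕ} (hl : bitValue l ≤ x.length + 1) (h : op.Exec x (bitValue l) v) :
    ∃ l', CounterReach x op ⟨some (.fetch, false), 0, l, 0⟩ ⟨none, 0, l', 0⟩ ∧ bitValue l' = v := by
  obtain ⟨b, l₁, hfetch, hl₁, hb⟩ := exists_fetch (op := op) (b := false) (p := 0) (l := l)
    ⟨Nat.zero_le _, nofun, fun _ => Nat.zero_le _⟩ hl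
  obtain ⟨b', d, hop, hd, hb'⟩ := h.exists_flagStep hb
  obtain ⟨l', hstore, hl'⟩ := exists_store (op := op) (l := l₁) hb'
  exact ⟨l', hfetch.trans (.trans (of_keep rfl (.oper hop) hd (by simp)) hstore), by omega⟩

end CounterReach

end Counter

/-! ### Simulating head programs in logarithmic space -/

namespace HeadProgram

variable {α : Type} {k : ℕ} (P : HeadProgram α (Fin k))

/-- What the Turing machine that simulates the program keeps in mind about an edge: the head and the
operation that is applied to it, and the node that follows. -/
structure Task where
  head : Fin k
  op : HeadOp α
  target : P.Node

instance [Finite α] : Finite P.Task := by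
  have := P.finNode
  refine .of_injective (β := Fin k × HeadOp α × P.Node) (fun τ => (τ.head, τ.op, τ.target)) ?_
  rintro ⟨⟩ ⟨⟩ h
  simpa using h

/-- The states of the simulating Turing machine: the nodes, and the stages of the tasks. -/
abbrev SimState : Type := P.Node ⊕ P.Task × CounterStage × Bool

variable {P}

/-- The state of the Turing machine in a stage of a task, or at its end. -/
def Task.state (τ : P.Task) : Option (CounterStage × Bool) → P.SimState
  | some t => .inr (τ, t)
  | none => .inl τ.target

variable [Finite α]

variable (P) in
/-- The Turing machine that simulates the program, holding the position of each head in binary on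
a work tape of its own. -/
def toNTM : NTM α where
  State := P.SimState
  Work := Option Bool
  finState := by
    have := P.finNode
    infer_instance
  finWork := inferInstance
  k := k
  start := .inl P.start
  accept := .inl P.final
  blank := none
  δ s o a :=
    match s with
    | .inl q => {m | ∃ τ : P.Task, P.edge q τ.head τ.op τ.target ∧
        m = (.inr (τ, .fetch, false), a, 0, 0)}
    | .inr (τ, s, b) => {m | ∃ t w d e, CounterMove τ.op s b o (a τ.head) t w d e ∧
        m = (τ.state t, Function.update a τ.head w, d, Pi.single τ.head e)}

/-- The configuration with state `s`, input head at `p`, work tapes `W` and work heads at `w`. -/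
def simConfig (s : P.SimState) (p : ℤ) (W : Fin k → ℤ → Option Bool) (w : Fin k → ℤ) :
    P.toNTM.Config :=
  ⟨s, p, W, w⟩

/-- The configuration between two tasks, in which the work tapes hold the digits `l`. -/
def restConfig (q : P.Node) (l : Fin k → List Bool) : P.toNTM.Config :=
  simConfig (.inl q) 0 (fun i => inputSymbol (l i)) 0

/-- The configuration during a task that began with the digits `l` on the work tapes. -/
def Task.config (τ : P.Task) (l : Fin k → List Bool) (c : CounterConfig) : P.toNTM.Config :=
  simConfig (τ.state c.state) c.pos (Function.update (fun i => inputSymbol (l i)) τ.head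
    (inputSymbol c.digits)) (Pi.single τ.head c.head)

section Step

variable {x : List α} {q : P.Node} {τ : P.Task} {p : ℤ} {W : Fin k → ℤ → Option Bool}
  {w : Fin k → ℤ} {C : P.toNTM.Config}

theorem step_simConfig_inl : P.toNTM.Step x (simConfig (.inl q) p W w) C ↔
    q ≠ P.final ∧ ∃ τ : P.Task, P.edge q τ.head τ.op τ.target ∧
      C = simConfig (.inr (τ, .fetch, false)) p W w := by
  have hnext (s : P.SimState) : simConfig s (p + ((0 : SignType) : ℤ))
      (fun i => Function.update (W i) (w i) (W i (w i)))
      (fun i => w i + ((0 : SignType) : ℤ)) = simConfig s p W w := by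
    simp only [SignType.coe_zero, add_zero, Function.update_eq_self]
  constructor
  · rintro ⟨hq, _, ⟨τ, hedge, rfl⟩, rfl⟩
    exact ⟨fun h => hq (congrArg Sum.inl h), τ, hedge, hnext _⟩
  · rintro ⟨hq, τ, hedge, rfl⟩
    exact ⟨fun h => hq (Sum.inl_injective h), _, ⟨τ, hedge, rfl⟩, (hnext _).symm⟩

theorem step_simConfig_inr {s : CounterStage} {b : Bool} :
    P.toNTM.Step x (simConfig (.inr (τ, s, b)) p W w) C ↔ ∃ t a d e,
      CounterMove τ.op s b (inputSymbol x p) (W τ.head (w τ.head)) t a d e ∧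
      C = simConfig (τ.state t) (p + (d : ℤ))
        (Function.update W τ.head (Function.update (W τ.head) (w τ.head) a))
        (Function.update w τ.head (w τ.head + (e : ℤ))) := by
  have hnext (s : P.SimState) (a : Option Bool) (d e : SignType) : simConfig s (p + (d : ℤ))
      (fun i => Function.update (W i) (w i)
        (Function.update (fun i => W i (w i)) τ.head a i))
      (fun i => w i + (((Pi.single τ.head e : Fin k → SignType) i : SignType) : ℤ)) =
      simConfig s (p + (d : ℤ))
        (Function.update W τ.head (Function.update (W τ.head) (w τ.head) a))
        (Function.update w τ.head (w τ.head + (e : ℤ))) := by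
    congr 1 <;> funext i <;> rcases eq_or_ne i τ.head with rfl | hi
    · simp
    · simp [hi]
    · simp
    · simp [hi]
  constructor
  · rintro ⟨-, _, ⟨t, a, d, e, hmove, rfl⟩, rfl⟩
    exact ⟨t, a, d, e, hmove, hnext _ _ _ _⟩
  · rintro ⟨t, a, d, e, hmove, rfl⟩
    exact ⟨nofun, _, ⟨t, a, d, e, hmove, rfl⟩, (hnext _ _ _ _).symm⟩

end Step

variable {x : List α} {q : P.Node} {l : Fin k → List Bool} {τ : P.Task} {c c' : CounterConfig}
  {C C' : P.toNTM.Config}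

theorem toNTM_init : P.toNTM.init = restConfig P.start fun _ => [] := by
  rw [restConfig, inputSymbol_nil]
  rfl

theorem Task.config_none (l' : List Bool) :
    τ.config l ⟨none, 0, l', 0⟩ = restConfig τ.target (Function.update l τ.head l') := by
  simp only [config, restConfig, Nat.cast_zero, Pi.single_zero, state]
  congr
  funext i
  rcases eq_or_ne i τ.head with rfl | hi
  · simp
  · simp [hi]

theorem Task.config_start : τ.config l ⟨some (.fetch, false), 0, l τ.head, 0⟩ =
    simConfig (.inr (τ, .fetch, false)) 0 (fun i => inputSymbol (l i)) 0 := by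
  simp only [config, Nat.cast_zero, Pi.single_zero, state]
  congr
  exact Function.update_eq_self τ.head fun i => inputSymbol (l i)

theorem Task.step_config_iff {s : CounterStage} {b : Bool} (hs : c.state = some (s, b)) :
    P.toNTM.Step x (τ.config l c) C ↔ ∃ t a d e,
      CounterMove τ.op s b (inputSymbol x c.pos) (inputSymbol c.digits c.head) t a d e ∧
      C = simConfig (τ.state t) (c.pos + (d : ℤ))
        (Function.update (fun i => inputSymbol (l i)) τ.head
          (Function.update (inputSymbol c.digits) c.head a))
        (Pi.single τ.head (c.head + (e : ℤ))) := by
  simp only [config, hs]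
  exact step_simConfig_inr.trans <| by
    simp only [Function.update_self, Function.update_idem, Pi.single]

theorem Task.config_eq_of_movesTo {t : Option (CounterStage × Bool)} {a : Option Bool}
    {d e : SignType} (h : c.MovesTo t a d e c') : τ.config l c' =
      simConfig (τ.state t) (c.pos + (d : ℤ))
        (Function.update (fun i => inputSymbol (l i)) τ.head
          (Function.update (inputSymbol c.digits) c.head a))
        (Pi.single τ.head (c.head + (e : ℤ))) := by
  rw [config, h.state, h.pos, h.tape, h.head]

theorem Task.reflTransGen_config (h : CounterReach x τ.op c c') :
    Relation.ReflTransGen (P.toNTM.Step x) (τ.config l c) (τ.config l c') := by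
  refine Relation.ReflTransGen.lift (τ.config l) (fun c c' hstep => ?_) _ _ h
  obtain ⟨s, b, t, a, d, e, hs, hmove, hc'⟩ := hstep
  exact (step_config_iff hs).2 ⟨t, a, d, e, hmove, config_eq_of_movesTo hc'⟩

theorem exists_reflTransGen_restConfig {v : ℕ} (hq : q ≠ P.final)
    (hedge : P.edge q τ.head τ.op τ.target) (hl : bitValue (l τ.head) ≤ x.length + 1)
    (h : τ.op.Exec x (bitValue (l τ.head)) v) : ∃ l',
      Relation.ReflTransGen (P.toNTM.Step x) (restConfig q l)
        (restConfig τ.target (Function.update l τ.head l')) ∧ bitValue l' = v := by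
  obtain ⟨l', hreach, hl'⟩ := CounterReach.exists_of_exec hl h
  refine ⟨l', .head (step_simConfig_inl.2 ⟨hq, τ, hedge, rfl⟩) ?_, hl'⟩
  rw [← Task.config_start, ← Task.config_none]
  exact Task.reflTransGen_config hreach

theorem bitValue_update (l : Fin k → List Bool) (i : Fin k) (l' : List Bool) :
    (fun j => bitValue (Function.update l i l' j)) =
      Function.update (fun j => bitValue (l j)) i (bitValue l') :=
  Function.comp_update bitValue l i l'

theorem Reach.toNTM_accepts_or {a : P.Node × (Fin k → ℕ)}
    (h : P.Reach x (P.start, fun _ => 0) a) :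
    P.toNTM.Accepts x ∨ ∃ l, Relation.ReflTransGen (P.toNTM.Step x) P.toNTM.init
      (restConfig a.1 l) ∧ (fun i => bitValue (l i)) = a.2 := by
  induction h with
  | refl => exact .inr ⟨fun _ => [], by rw [toNTM_init], rfl⟩
  | @tail a b ha hstep ih =>
    obtain hacc | ⟨l, hreach, hval⟩ := ih
    · exact .inl hacc
    by_cases hq : a.1 = P.final
    · exact .inl (NTM.accepts_iff.2 ⟨_, hreach, congrArg Sum.inl hq⟩)
    obtain ⟨i, op, v, hedge, hexec, hb⟩ := hstep
    have hle := Reach.headsOn ha (fun _ => Nat.zero_le _) i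
    rw [← hval] at hexec hle hb
    obtain ⟨l', hreach', rfl⟩ :=
      exists_reflTransGen_restConfig (τ := ⟨i, op, b.1⟩) hq hedge hle hexec
    exact .inr ⟨_, hreach.trans hreach', (bitValue_update l i l').trans hb.symm⟩

/-- An invariant of the simulating Turing machine: it is at rest or busy with a task, and the
program can reach the node and the head positions that it holds. -/
def SimInv (x : List α) (C : P.toNTM.Config) : Prop :=
  ∃ q l, P.Reach x (P.start, fun _ => 0) (q, fun i => bitValue (l i)) ∧
    (∀ i, (l i).length ≤ (x.length + 1).size) ∧
    (C = restConfig q l ∨ ∃ (τ : P.Task) (s : CounterStage) (b : Bool) (c : CounterConfig),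
      P.edge q τ.head τ.op τ.target ∧ c.state = some (s, b) ∧
      CounterInv x τ.op (bitValue (l τ.head)) c ∧ C = τ.config l c)

theorem SimInv.step (h : SimInv x C) (hstep : P.toNTM.Step x C C') : SimInv x C' := by
  obtain ⟨q, l, hreach, hlength, rfl | ⟨τ, s, b, c, hedge, hs, hinv, rfl⟩⟩ := h
  · obtain ⟨-, τ, hedge, rfl⟩ := step_simConfig_inl.1 hstep
    refine ⟨q, l, hreach, hlength, .inr ⟨τ, _, _, _, hedge, rfl, ?_, Task.config_start.symm⟩⟩
    exact ⟨Nat.zero_le _, hlength _, rfl, ⟨Nat.zero_le _, nofun, fun _ => Nat.zero_le _⟩, rfl⟩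
  obtain ⟨t, a, d, e, hmove, rfl⟩ := (Task.step_config_iff hs).1 hstep
  obtain ⟨c', hc', hinv'⟩ :=
    hinv.exists_movesTo (hreach.headsOn (fun _ => Nat.zero_le _) τ.head) hs hmove
  rw [← Task.config_eq_of_movesTo hc']
  obtain ⟨_ | ⟨s', b'⟩, p, l', z⟩ := c'
  · obtain ⟨-, hlength', rfl, rfl, hexec⟩ := hinv'
    refine ⟨τ.target, Function.update l τ.head l',
      hreach.tail ⟨_, _, _, hedge, hexec, bitValue_update l _ l'⟩, fun i => ?_,
      .inl (Task.config_none l')⟩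
    rcases eq_or_ne i τ.head with rfl | hi
    · simpa using hlength'
    · simpa [hi] using hlength i
  · exact ⟨q, l, hreach, hlength, .inr ⟨τ, s', b', _, hedge, rfl, hinv', rfl⟩⟩

theorem SimInv.of_reflTransGen (h : Relation.ReflTransGen (P.toNTM.Step x) P.toNTM.init C) :
    SimInv x C := by
  induction h with
  | refl => exact ⟨P.start, fun _ => [], .refl, fun _ => Nat.zero_le _, .inl toNTM_init⟩
  | tail _ hstep ih => exact ih.step hstep

theorem SimInv.inputPos_mem (h : SimInv x C) : C.inputPos ∈ Set.Icc 0 ((x.length : ℤ) + 1) := by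
  obtain ⟨q, l, -, -, rfl | ⟨τ, s, b, c, -, -, hinv, rfl⟩⟩ := h
  · exact ⟨le_rfl, by positivity⟩
  · exact ⟨Int.natCast_nonneg _, Int.ofNat_le.2 hinv.pos_le⟩

theorem SimInv.workPos_mem (h : SimInv x C) (i : Fin k) :
    C.workPos i ∈ Finset.Icc 0 (((x.length + 1).size : ℤ) + 1) := by
  rw [Finset.mem_Icc]
  obtain ⟨q, l, -, -, rfl | ⟨τ, s, b, c, -, -, hinv, rfl⟩⟩ := h
  · exact ⟨le_rfl, by positivity⟩
  change 0 ≤ (Pi.single τ.head (c.head : ℤ) : Fin k → ℤ) i ∧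
    (Pi.single τ.head (c.head : ℤ) : Fin k → ℤ) i ≤ _
  have := hinv.head_le.trans (Nat.succ_le_succ hinv.length_le)
  rcases eq_or_ne i τ.head with rfl | hi
  · rw [Pi.single_eq_same]
    omega
  · rw [Pi.single_eq_of_ne hi]
    omega

theorem toNTM_accepts_iff : P.toNTM.Accepts x ↔ P.Accepts x := by
  constructor
  · rw [NTM.accepts_iff]
    rintro ⟨C, hreach, hacc⟩
    obtain ⟨q, l, hq, -, rfl | ⟨τ, s, b, c, -, hs, -, rfl⟩⟩ := SimInv.of_reflTransGen hreach
    · obtain rfl : q = P.final := Sum.inl_injective hacc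
      exact ⟨_, hq⟩
    · change τ.state c.state = .inl P.final at hacc
      rw [hs] at hacc
      exact absurd hacc nofun
  · rintro ⟨v, hreach⟩
    obtain hacc | ⟨l, hl, -⟩ := hreach.toNTM_accepts_or
    · exact hacc
    · exact NTM.accepts_iff.2 ⟨_, hl, rfl⟩

theorem toNTM_spaceBound : P.toNTM.SpaceBound fun n => k * ((n + 1).size + 2) := by
  intro x c t hc
  have hcells (j : Fin k) :
      cellsVisited (fun i => (c i).workPos j) t ≤ (x.length + 1).size + 2 := by
    have hsub : (Finset.range (t + 1)).image (fun i => (c i).workPos j) ⊆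
        Finset.Icc 0 (((x.length + 1).size : ℤ) + 1) := by
      refine Finset.image_subset_iff.2 fun i hi => ?_
      have hi : i ≤ t := Nat.lt_succ_iff.1 (Finset.mem_range.1 hi)
      exact (SimInv.of_reflTransGen (NTM.reflTransGen_iff.2 ⟨c, i, hc.mono hi, rfl⟩)).workPos_mem j
    refine (Finset.card_le_card hsub).trans ?_
    rw [Int.card_Icc]
    omega
  calc _ ≤ ∑ _ : Fin k, ((x.length + 1).size + 2) := Finset.sum_le_sum fun j _ => hcells j
    _ = _ := by simp

theorem toNTM_staysOnInput : P.toNTM.StaysOnInput := fun _ c t hc =>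
  (SimInv.of_reflTransGen (NTM.reflTransGen_iff.2 ⟨c, t, hc, rfl⟩)).inputPos_mem

end HeadProgram

theorem size_succ_isBigO_log :
    (fun n : ℕ => (((n + 1).size : ℕ) : ℝ)) =O[atTop] fun n : ℕ => Real.log n := by
  refine .of_bound (4 / Real.log 2) ?_
  filter_upwards [eventually_ge_atTop 2] with n hn
  rw [Real.norm_natCast, Real.norm_of_nonneg (Real.log_natCast_nonneg n)]
  have hsize : (n + 1).size ≤ 4 * Nat.log 2 n := by
    have hlog : 1 ≤ Nat.log 2 n := Nat.log_pos one_lt_two hn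
    have hlt : n < 2 ^ (Nat.log 2 n + 1) := Nat.lt_pow_succ_log_self one_lt_two n
    exact Nat.size_le.2 (lt_of_le_of_lt hlt (Nat.pow_lt_pow_right one_lt_two (by omega)))
  calc ((n + 1).size : ℝ) ≤ 4 * Nat.log 2 n := by exact_mod_cast hsize
    _ ≤ 4 * (Real.log n / Real.log 2) := by gcongr; exact Real.natLog_le_logb n 2
    _ = _ := by ring

theorem mul_size_mem_logBound (k : ℕ) : (fun n => k * ((n + 1).size + 2)) ∈ logBound := by
  have htwo : (fun _ : ℕ => (2 : ℕ)) ∈ logBound :=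
    consBound_subset_logBound (mem_consBound_iff.2 ⟨2, fun _ => le_rfl⟩)
  simp only [logBound, Set.mem_ofPred_eq] at htwo ⊢
  push_cast at htwo ⊢
  exact (size_succ_isBigO_log.add htwo).const_mul_left _

theorem headLanguages_subset_NL (α : Type) [Finite α] : HeadLanguages α ⊆ NL α := by
  rintro L ⟨k, P, hL⟩
  exact ⟨P.toNTM, P.toNTM_staysOnInput, ⟨_, mul_size_mem_logBound k, P.toNTM_spaceBound⟩,
    fun x => (hL x).trans HeadProgram.toNTM_accepts_iff.symm⟩

theorem theorem3p5 (α : Type) [Finite α] :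
    onewayIP α consBound consBound = NL α ∧ NL α = weakIP α logBound consBound := by
  have weakIP_subset : weakIP α logBound consBound ⊆ NL α :=
    (weakIP_subset_headLanguages α).trans (headLanguages_subset_NL α)
  have subset_onewayIP : NL α ⊆ onewayIP α consBound consBound :=
    (NL_subset_headLanguages α).trans (headLanguages_subset_onewayIP α)
  have oneway_subset_weak := onewayIP_subset_weakIP α
  exact ⟨(oneway_subset_weak.trans weakIP_subset).antisymm subset_onewayIP,
    (subset_onewayIP.trans oneway_subset_weak).antisymm weakIP_subset⟩
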